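/- **Hodge–Tate structures and framings.** A ($\mathbb Q$-)*Hodge–Tate structure* is a mixed $\mathbb Q$-Hodge structure $H$ with $\mathrm{gr}^W_{2k+1}H=0$ and $\mathrm{gr}^W_{2k}H$ a direct sum of copies of $\mathbb Q(-k)$, for all $k$; with the morphisms of mixed Hodge structures they form an abelian category $\mathbb Q\mathrm{HT}$. For $n\ge 0$, an *$n$-framed* Hodge–Tate structure is a triple $(H,v,f)$ with $v:\mathbb Q(0)\to \mathrm{gr}^W_0H$ and $f:\mathrm{gr}^W_{-2n}H\to\mathbb Q(n)$ non-zero. Let $\mathcal H_n$ be the set of classes $[H,v,f]$ of $n$-framed Hodge–Tate structures for the equivalence relation generated by: $(H,v,f)\sim(H',v',f')$ if there is a morphism $H\to H'$ compatible with the framings. It is a $\mathbb Q$-vector space with $[H,v,f]+[H',v',f']=[H\oplus H',v+v',f+f']$, $c[H,v,f]=[H,v,cf]$ for $c\neq0$, and zero the class of $\mathbb Q(0)\oplus\mathbb Q(n)$ with its obvious framing; put $[H,v,f]:=0$ if $v=0$ or $f=0$. **The coalgebra.** Let $\mathcal H_\bullet=\bigoplus_{n\ge0}\mathcal H_n$ with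 comultiplication $\nu=\sum_{k+l=n}\nu_{kl}$ on $\mathcal H_n$, where $$\nu_{kl}([H,v,f])=\sum_i\,[H,v,b_i^\vee]\otimes[H(-k),b_i(-k),f(-k)]\in\mathcal H_k\otimes\mathcal H_l$$ for a basis $(b_i)$ of $\mathrm{Hom}(\mathbb Q(k),\mathrm{gr}^W_{-2k}H)$ with dual basis $(b_i^\vee)$; unit $1=[\mathbb Q(0),\mathrm{id},\mathrm{id}]\in\mathcal H_0$; and counit $\varepsilon$ given by $[H,v,f]\mapsto f(v)$ on $\mathcal H_0$ and $0$ on $\mathcal H_n$, $n>0$. On $\mathcal H_{>0}$ let $\bar\nu(x)=\nu(x)-1\otimes x-x\otimes1$. **Comodules.** A graded (left) $\mathcal H_\bullet$-comodule is a $\mathbb Z$-graded $\mathbb Q$-vector space $V=\bigoplus_mV_m$ with a counital, coassociative coaction $V\to\mathcal H_\bullet\otimes V$ mapping $V_m$ into $\bigoplus_{k}\mathcal H_k\otimes V_{m+k}$. Each Hodge–Tate structure $H$ gives such a comodule $\omega(H)=\bigoplus_m\omega(H)_m$, $\omega(H)_m=\mathrm{Hom}(\mathbb Q(m),\mathrm{gr}^W_{-2m}H)$,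 with coaction $v\mapsto\sum_{r\ge m}\sum_i[H(-m),v(-m),b_{r,i}^\vee(-m)]\otimes b_{r,i}$ for $v\in\omega(H)_m$ and bases $(b_{r,i})_i$ of $\omega(H)_r$. Let $\mathbb Q_{(n)}$ be $\mathbb Q$ in degree $n$ with coaction $v\mapsto 1\otimes v$, so that $\omega(\mathbb Q(n))\cong\mathbb Q_{(n)}$ through the generator. $\mathrm{Ext}^1$ denotes the set of isomorphism classes of (Yoneda) extensions, in $\mathbb Q\mathrm{HT}$ or for graded comodules. **Three maps.** Let $n\ge1$. (a) An extension $0\to\mathbb Q(n)\to E\to\mathbb Q(0)\to0$ in $\mathbb Q\mathrm{HT}$ induces $\mathrm{gr}^W_0E=\mathbb Q(0)$ and $\mathrm{gr}^W_{-2n}E=\mathbb Q(n)$, hence an $n$-framing of $E$; its class in $\mathcal H_n$ defines $\iota_n:\mathrm{Ext}^1_{\mathbb Q\mathrm{HT}}(\mathbb Q(0),\mathbb Q(n))\to\mathcal H_n$. (b) Let $c_n:\mathrm{Ker}(\bar\nu|_{\mathcal H_n})\to\mathrm{Ext}^1_{\mathcal H_\bullet}(\mathbb Q_{(0)},\mathbb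 Q_{(n)})$ send $\gamma$, viewed as a $1$-cocycle of the degree-$0$ part of the reduced cobar complex $\mathbb Q\xrightarrow{0}\mathcal H_{>0}\xrightarrow{\bar\nu}\mathcal H_{>0}^{\otimes2}\to\cdots$ with coefficients in $\mathbb Q_{(n)}$, to the class of $\mathbb Qe_0\oplus\mathbb Qe_n$ ($e_j$ of degree $j$) with coaction $e_0\mapsto1\otimes e_0+\gamma\otimes e_n$, $e_n\mapsto1\otimes e_n$. (c) Let $\omega_*:\mathrm{Ext}^1_{\mathbb Q\mathrm{HT}}(\mathbb Q(0),\mathbb Q(n))\to\mathrm{Ext}^1_{\mathcal H_\bullet}(\mathbb Q_{(0)},\mathbb Q_{(n)})$ be induced by $\omega$. **Proposition.** For every $n\ge1$: 1. the image of $\iota_n$ is exactly $\mathrm{Ker}(\bar\nu|_{\mathcal H_n})$, and $\iota_n$ is injective; 2. $c_n$ and $\omega_*$ are bijective; 3. $\iota_n$ is the canonical bijection $\mathrm{Ker}(\bar\nu|_{\mathcal H_n})\cong\mathrm{Ext}^1_{\mathbb Q\mathrm{HT}}(\mathbb Q(0),\mathbb Q(n))$ obtained from $c_n$ and $\omega_*$: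 for $\gamma\in\mathrm{Ker}(\bar\nu|_{\mathcal H_n})$ and $\xi\in\mathrm{Ext}^1_{\mathbb Q\mathrm{HT}}(\mathbb Q(0),\mathbb Q(n))$ one has $c_n(\gamma)=\omega_*(\xi)$ if and only if $\iota_n(\xi)=\gamma$; that is, the extension $\omega_*^{-1}(c_n(\gamma))$ has class $\gamma$ in $\mathcal H_n$. -/

import Mathlib

open TensorProduct DirectSum

noncomputable section

/-- A (mixed) `ℚ`-Hodge–Tate structure: a finite-dimensional `ℚ`-vector space `V` with a finite
increasing weight filtration `W` and a finite decreasing Hodge filtration `F` on `ℂ ⊗ V` such that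
`gr^W_{2k+1} = 0` and the filtration induced by `F` on `gr^W_{2k} ⊗ ℂ` satisfies
`F^k = everything`, `F^{k+1} = 0`, i.e. `gr^W_{2k}` is pure of type `(k,k)`,
a direct sum of copies of `ℚ(-k)`. -/
structure HTStructure where
  V : Type
  [addCommGroup : AddCommGroup V]
  [module : Module ℚ V]
  [finite : FiniteDimensional ℚ V]
  W : ℤ → Submodule ℚ V
  F : ℤ → Submodule ℂ (ℂ ⊗[ℚ] V)
  W_mono : Monotone W
  W_bot : ∃ k, W k = ⊥
  W_top : ∃ k, W k = ⊤
  F_anti : Antitone F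
  F_bot : ∃ p, F p = ⊥
  F_top : ∃ p, F p = ⊤
  W_odd : ∀ k, W (2 * k + 1) = W (2 * k)
  F_gr_top : ∀ k, (W (2 * k)).baseChange ℂ ≤
    (F k ⊓ (W (2 * k)).baseChange ℂ) ⊔ (W (2 * k - 1)).baseChange ℂ
  F_gr_bot : ∀ k, F (k + 1) ⊓ (W (2 * k)).baseChange ℂ ≤ (W (2 * k - 1)).baseChange ℂ

namespace HTStructure

attribute [instance] addCommGroup module finite

/-- The graded piece `gr^W_k H = W_k / W_{k-1}`. -/
abbrev gr (H : HTStructure) (k : ℤ) : Type :=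
  ↥(H.W k) ⧸ (H.W (k - 1)).submoduleOf (H.W k)

/-- A morphism of Hodge–Tate structures, i.e. of mixed `ℚ`-Hodge structures: a linear map
respecting both filtrations. -/
structure Hom (H H' : HTStructure) where
  toLin : H.V →ₗ[ℚ] H'.V
  map_W : ∀ k, ∀ x ∈ H.W k, toLin x ∈ H'.W k
  map_F : ∀ p, ∀ z ∈ H.F p, toLin.baseChange ℂ z ∈ H'.F p

/-- The map `gr^W_a H → gr^W_b H'` induced by a linear map `g` with `g (W_a) ⊆ W_b` and
`g (W_{a-1}) ⊆ W_{b-1}`. -/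
def grMap {H H' : HTStructure} (a b : ℤ) (g : H.V →ₗ[ℚ] H'.V)
    (h : ∀ x ∈ H.W a, g x ∈ H'.W b) (h' : ∀ x ∈ H.W (a - 1), g x ∈ H'.W (b - 1)) :
    H.gr a →ₗ[ℚ] H'.gr b :=
  Submodule.mapQ _ _ (g.restrict h) (fun x hx => h' x.1 hx)

lemma grMap_mk {H H' : HTStructure} (a b : ℤ) (g : H.V →ₗ[ℚ] H'.V)
    (h : ∀ x ∈ H.W a, g x ∈ H'.W b) (h' : ∀ x ∈ H.W (a - 1), g x ∈ H'.W (b - 1))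
    (x : H.W a) : grMap a b g h h' (Submodule.Quotient.mk x) =
      Submodule.Quotient.mk ⟨g x.1, h x.1 x.2⟩ := rfl

lemma gr_ext {H : HTStructure} {a : ℤ} {M : Type*} [AddCommGroup M] [Module ℚ M]
    {f g : H.gr a →ₗ[ℚ] M}
    (h : ∀ x : H.W a, f (Submodule.Quotient.mk x) = g (Submodule.Quotient.mk x)) : f = g :=
  LinearMap.ext fun x => Submodule.Quotient.induction_on _ x h

/-- The map induced by a morphism on `gr^W_k`. -/
def Hom.gr {H H' : HTStructure} (g : Hom H H') (k : ℤ) : H.gr k →ₗ[ℚ] H'.gr k :=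
  grMap k k g.toLin (g.map_W k) (g.map_W (k - 1))

lemma Hom.gr_mk {H H' : HTStructure} (g : Hom H H') (k : ℤ) (x : H.W k) :
    g.gr k (Submodule.Quotient.mk x) = Submodule.Quotient.mk ⟨g.toLin x.1, g.map_W k x.1 x.2⟩ :=
  rfl

/-- The identity `gr^W_a H = gr^W_b H` for `a = b`. -/
def grCast (H : HTStructure) {a b : ℤ} (h : a = b) : H.gr a →ₗ[ℚ] H.gr b :=
  grMap a b LinearMap.id (by subst h; exact fun _ hx => hx) (by subst h; exact fun _ hx => hx)

def Hom.id (H : HTStructure) : Hom H H where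
  toLin := LinearMap.id
  map_W _ _ hx := hx
  map_F p z hz := by simpa using hz

def Hom.comp {H H' H'' : HTStructure} (g : Hom H' H'') (f : Hom H H') : Hom H H'' where
  toLin := g.toLin ∘ₗ f.toLin
  map_W k x hx := g.map_W k _ (f.map_W k x hx)
  map_F p z hz := by
    rw [LinearMap.baseChange_comp]
    exact g.map_F p _ (f.map_F p z hz)

def Hom.smulId (H : HTStructure) (c : ℚ) : Hom H H where
  toLin := c • LinearMap.id
  map_W k x hx := (H.W k).smul_mem c hx
  map_F p z hz := by
    rw [LinearMap.baseChange_smul]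
    have : (c • (LinearMap.id : H.V →ₗ[ℚ] H.V).baseChange ℂ) z = (c : ℂ) • z := by
      simp [LinearMap.smul_apply]
      rw [← algebraMap_smul ℂ c z]; simp
    rw [this]
    exact (H.F p).smul_mem _ hz

lemma baseChange_mem {V V' : Type} [AddCommGroup V] [Module ℚ V] [AddCommGroup V'] [Module ℚ V']
    (g : V →ₗ[ℚ] V') (p : Submodule ℚ V) (q : Submodule ℚ V') (h : ∀ x ∈ p, g x ∈ q)
    (z : ℂ ⊗[ℚ] V) (hz : z ∈ p.baseChange ℂ) : g.baseChange ℂ z ∈ q.baseChange ℂ := by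
  rw [Submodule.baseChange_eq_span] at hz
  induction hz using Submodule.span_induction with
  | mem x hx =>
    obtain ⟨y, hy, rfl⟩ := hx
    exact Submodule.tmul_mem_baseChange_of_mem _ (h y hy)
  | zero => simp
  | add x y _ _ hx hy => rw [map_add]; exact add_mem hx hy
  | smul c x _ hx => rw [map_smul]; exact Submodule.smul_mem _ _ hx

lemma sum_decomp {V V' : Type} [AddCommGroup V] [Module ℚ V] [AddCommGroup V'] [Module ℚ V']
    (z : ℂ ⊗[ℚ] (V × V')) :
    (LinearMap.inl ℚ V V').baseChange ℂ ((LinearMap.fst ℚ V V').baseChange ℂ z) +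
      (LinearMap.inr ℚ V V').baseChange ℂ ((LinearMap.snd ℚ V V').baseChange ℂ z) = z := by
  induction z using TensorProduct.induction_on with
  | zero => simp
  | tmul c x => simp [← TensorProduct.tmul_add]
  | add x y hx hy =>
    conv_rhs => rw [← hx, ← hy]
    simp only [map_add]; abel

lemma baseChange_comp_eq {V V' V'' : Type} [AddCommGroup V] [Module ℚ V] [AddCommGroup V']
    [Module ℚ V'] [AddCommGroup V''] [Module ℚ V''] (g : V' →ₗ[ℚ] V'') (f : V →ₗ[ℚ] V')
    (h : V →ₗ[ℚ] V'') (e : g ∘ₗ f = h) (z : ℂ ⊗[ℚ] V) :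
    g.baseChange ℂ (f.baseChange ℂ z) = h.baseChange ℂ z := by
  rw [← e, LinearMap.baseChange_comp]; rfl

lemma fst_mem {V V' : Type} [AddCommGroup V] [Module ℚ V] [AddCommGroup V'] [Module ℚ V']
    (p : Submodule ℚ V) (q : Submodule ℚ V') (z : ℂ ⊗[ℚ] (V × V'))
    (hz : z ∈ (p.prod q).baseChange ℂ) :
    (LinearMap.fst ℚ V V').baseChange ℂ z ∈ p.baseChange ℂ :=
  baseChange_mem _ _ _ (fun _ hx => (Submodule.mem_prod.1 hx).1) z hz

lemma snd_mem {V V' : Type} [AddCommGroup V] [Module ℚ V] [AddCommGroup V'] [Module ℚ V']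
    (p : Submodule ℚ V) (q : Submodule ℚ V') (z : ℂ ⊗[ℚ] (V × V'))
    (hz : z ∈ (p.prod q).baseChange ℂ) :
    (LinearMap.snd ℚ V V').baseChange ℂ z ∈ q.baseChange ℂ :=
  baseChange_mem _ _ _ (fun _ hx => (Submodule.mem_prod.1 hx).2) z hz

lemma inl_add_inr_mem {V V' : Type} [AddCommGroup V] [Module ℚ V] [AddCommGroup V'] [Module ℚ V']
    (p : Submodule ℚ V) (q : Submodule ℚ V') (z : ℂ ⊗[ℚ] V) (z' : ℂ ⊗[ℚ] V')
    (hz : z ∈ p.baseChange ℂ) (hz' : z' ∈ q.baseChange ℂ) :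
    (LinearMap.inl ℚ V V').baseChange ℂ z + (LinearMap.inr ℚ V V').baseChange ℂ z' ∈
      (p.prod q).baseChange ℂ :=
  add_mem
    (baseChange_mem _ _ _ (fun _ hx => Submodule.mem_prod.2 ⟨hx, zero_mem _⟩) z hz)
    (baseChange_mem _ _ _ (fun _ hx => Submodule.mem_prod.2 ⟨zero_mem _, hx⟩) z' hz')

/-- The pure Hodge–Tate structure `ℚ(n)`, of weight `-2n` and type `(-n,-n)`; its underlying
space `(2πi)^n ℚ` is identified with `ℚ` through the generator `(2πi)^n`. -/
def tate (n : ℤ) : HTStructure where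
  V := ℚ
  W k := if -2 * n ≤ k then ⊤ else ⊥
  F p := if p ≤ -n then ⊤ else ⊥
  W_mono a b h := by
    dsimp only
    split_ifs <;> first | exact le_rfl | exact bot_le | exact le_top | (exfalso; omega)
  W_bot := ⟨-2 * n - 1, if_neg (by omega)⟩
  W_top := ⟨-2 * n, if_pos le_rfl⟩
  F_anti a b h := by
    dsimp only
    split_ifs <;> first | exact le_rfl | exact bot_le | exact le_top | (exfalso; omega)
  F_bot := ⟨-n + 1, if_neg (by omega)⟩
  F_top := ⟨-n, if_pos le_rfl⟩
  W_odd k := by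
    split_ifs <;> first | rfl | (exfalso; omega)
  F_gr_top k := by
    split_ifs <;> first | (exfalso; omega) | simp
  F_gr_bot k := by
    split_ifs <;> first | (exfalso; omega) | simp

lemma tate_W_top {n k : ℤ} (h : -2 * n ≤ k) : (tate n).W k = ⊤ := if_pos h

lemma tate_W_bot {n k : ℤ} (h : k < -2 * n) : (tate n).W k = ⊥ := if_neg (by omega)

/-- The class of the generator `1` in `gr^W_{-2n} ℚ(n)`. -/
def tateGen (n a : ℤ) (h : a = -2 * n) : (tate n).gr a :=
  Submodule.Quotient.mk ⟨(1 : ℚ), by rw [tate_W_top (by omega)]; trivial⟩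

/-- The canonical identification `gr^W_{-2n} ℚ(n) → ℚ`. -/
def tateVal (n a : ℤ) (h : a = -2 * n) : (tate n).gr a →ₗ[ℚ] ℚ :=
  Submodule.liftQ _ ((tate n).W a).subtype (by
    intro x hx
    have : (x : (tate n).V) ∈ (tate n).W (a - 1) := hx
    rw [tate_W_bot (by omega)] at this
    exact this)

lemma tateVal_gen (n a : ℤ) (h : a = -2 * n) : tateVal n a h (tateGen n a h) = 1 := rfl

lemma smul_tateGen (n a : ℤ) (h : a = -2 * n) (x : (tate n).gr a) :
    tateVal n a h x • tateGen n a h = x := by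
  induction x using Submodule.Quotient.induction_on with
  | H x =>
    refine congrArg Submodule.Quotient.mk (Subtype.ext ?_)
    exact mul_one (M := ℚ) x.1

/-- The direct sum of two Hodge–Tate structures. -/
def sum (H H' : HTStructure) : HTStructure where
  V := H.V × H'.V
  W k := (H.W k).prod (H'.W k)
  F p := (H.F p).comap ((LinearMap.fst ℚ H.V H'.V).baseChange ℂ) ⊓
    (H'.F p).comap ((LinearMap.snd ℚ H.V H'.V).baseChange ℂ)
  W_mono _ _ h := Submodule.prod_mono (H.W_mono h) (H'.W_mono h)
  W_bot := by
    obtain ⟨a, ha⟩ := H.W_bot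
    obtain ⟨b, hb⟩ := H'.W_bot
    refine ⟨min a b, ?_⟩
    rw [le_bot_iff.1 (ha ▸ H.W_mono (min_le_left a b) : H.W (min a b) ≤ ⊥),
      le_bot_iff.1 (hb ▸ H'.W_mono (min_le_right a b) : H'.W (min a b) ≤ ⊥), Submodule.prod_bot]
  W_top := by
    obtain ⟨a, ha⟩ := H.W_top
    obtain ⟨b, hb⟩ := H'.W_top
    refine ⟨max a b, ?_⟩
    rw [top_le_iff.1 (ha ▸ H.W_mono (le_max_left a b) : ⊤ ≤ H.W (max a b)),
      top_le_iff.1 (hb ▸ H'.W_mono (le_max_right a b) : ⊤ ≤ H'.W (max a b)), Submodule.prod_top]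
  F_anti _ _ h := inf_le_inf (Submodule.comap_mono (H.F_anti h)) (Submodule.comap_mono (H'.F_anti h))
  F_bot := by
    obtain ⟨a, ha⟩ := H.F_bot
    obtain ⟨b, hb⟩ := H'.F_bot
    refine ⟨max a b, ?_⟩
    rw [le_bot_iff.1 (ha ▸ H.F_anti (le_max_left a b) : H.F (max a b) ≤ ⊥),
      le_bot_iff.1 (hb ▸ H'.F_anti (le_max_right a b) : H'.F (max a b) ≤ ⊥), eq_bot_iff]
    rintro z ⟨h1, h2⟩
    have h1 : (LinearMap.fst ℚ H.V H'.V).baseChange ℂ z = 0 := h1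
    have h2 : (LinearMap.snd ℚ H.V H'.V).baseChange ℂ z = 0 := h2
    have := sum_decomp (V := H.V) (V' := H'.V) z
    rw [h1, h2, map_zero, map_zero, add_zero] at this
    exact this.symm
  F_top := by
    obtain ⟨a, ha⟩ := H.F_top
    obtain ⟨b, hb⟩ := H'.F_top
    refine ⟨min a b, ?_⟩
    rw [top_le_iff.1 (ha ▸ H.F_anti (min_le_left a b) : ⊤ ≤ H.F (min a b)),
      top_le_iff.1 (hb ▸ H'.F_anti (min_le_right a b) : ⊤ ≤ H'.F (min a b))]
    simp
  W_odd k := by rw [H.W_odd, H'.W_odd]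
  F_gr_top k := by
    intro z hz
    have h1 := H.F_gr_top k (fst_mem _ _ z hz)
    have h2 := H'.F_gr_top k (snd_mem _ _ z hz)
    obtain ⟨a, ⟨ha, ha'⟩, b, hb, hab⟩ := Submodule.mem_sup.1 h1
    obtain ⟨c, ⟨hc, hc'⟩, d, hd, hcd⟩ := Submodule.mem_sup.1 h2
    have hz' := sum_decomp z
    rw [← hab, ← hcd, map_add, map_add] at hz'
    refine Submodule.mem_sup.2 ⟨_, ⟨⟨?_, ?_⟩, ?_⟩, _, ?_, (?_ :
      ((LinearMap.inl ℚ H.V H'.V).baseChange ℂ a + (LinearMap.inr ℚ H.V H'.V).baseChange ℂ c) +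
      ((LinearMap.inl ℚ H.V H'.V).baseChange ℂ b + (LinearMap.inr ℚ H.V H'.V).baseChange ℂ d) = z)⟩
    · change (LinearMap.fst ℚ H.V H'.V).baseChange ℂ (_ + _) ∈ H.F k
      rw [map_add, baseChange_comp_eq _ _ _ (LinearMap.fst_comp_inl ℚ H.V H'.V),
        baseChange_comp_eq _ _ _ (LinearMap.fst_comp_inr ℚ H.V H'.V)]
      simpa using ha
    · change (LinearMap.snd ℚ H.V H'.V).baseChange ℂ (_ + _) ∈ H'.F k
      rw [map_add, baseChange_comp_eq _ _ _ (LinearMap.snd_comp_inl ℚ H.V H'.V),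
        baseChange_comp_eq _ _ _ (LinearMap.snd_comp_inr ℚ H.V H'.V)]
      simpa using hc
    · exact inl_add_inr_mem _ _ _ _ ha' hc'
    · exact inl_add_inr_mem _ _ _ _ hb hd
    · rw [← hz']; abel
  F_gr_bot k := by
    rintro z ⟨⟨h1, h2⟩, hz⟩
    have h1 := H.F_gr_bot k
      ⟨h1, fst_mem _ _ z hz⟩
    have h2 := H'.F_gr_bot k
      ⟨h2, snd_mem _ _ z hz⟩
    rw [← sum_decomp z]
    exact inl_add_inr_mem _ _ _ _ h1 h2

/-- The Tate twist `H(m) = H ⊗ ℚ(m)`, on the same underlying space. -/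
def twist (H : HTStructure) (m : ℤ) : HTStructure where
  V := H.V
  W k := H.W (k + 2 * m)
  F p := H.F (p + m)
  W_mono _ _ h := H.W_mono (by omega)
  W_bot := by
    obtain ⟨a, ha⟩ := H.W_bot
    exact ⟨a - 2 * m, by rw [sub_add_cancel, ha]⟩
  W_top := by
    obtain ⟨a, ha⟩ := H.W_top
    exact ⟨a - 2 * m, by rw [sub_add_cancel, ha]⟩
  F_anti _ _ h := H.F_anti (by omega)
  F_bot := by
    obtain ⟨a, ha⟩ := H.F_bot
    exact ⟨a - m, by rw [sub_add_cancel, ha]⟩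
  F_top := by
    obtain ⟨a, ha⟩ := H.F_top
    exact ⟨a - m, by rw [sub_add_cancel, ha]⟩
  W_odd k := by
    have := H.W_odd (k + m)
    rwa [show 2 * (k + m) + 1 = 2 * k + 1 + 2 * m by ring,
      show 2 * (k + m) = 2 * k + 2 * m by ring] at this
  F_gr_top k := by
    have := H.F_gr_top (k + m)
    rwa [show 2 * (k + m) - 1 = 2 * k - 1 + 2 * m by ring,
      show 2 * (k + m) = 2 * k + 2 * m by ring] at this
  F_gr_bot k := by
    have := H.F_gr_bot (k + m)
    rwa [show 2 * (k + m) - 1 = 2 * k - 1 + 2 * m by ring,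
      show 2 * (k + m) = 2 * k + 2 * m by ring,
      show k + m + 1 = k + 1 + m by ring] at this


lemma baseChange_fst_prod {V V' V'' : Type} [AddCommGroup V] [Module ℚ V] [AddCommGroup V']
    [Module ℚ V'] [AddCommGroup V''] [Module ℚ V''] (f : V →ₗ[ℚ] V') (g : V →ₗ[ℚ] V'')
    (z : ℂ ⊗[ℚ] V) :
    (LinearMap.fst ℚ V' V'').baseChange ℂ ((f.prod g).baseChange ℂ z) = f.baseChange ℂ z :=
  baseChange_comp_eq _ _ _ (LinearMap.fst_prod _ _) z

lemma baseChange_snd_prod {V V' V'' : Type} [AddCommGroup V] [Module ℚ V] [AddCommGroup V']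
    [Module ℚ V'] [AddCommGroup V''] [Module ℚ V''] (f : V →ₗ[ℚ] V') (g : V →ₗ[ℚ] V'')
    (z : ℂ ⊗[ℚ] V) :
    (LinearMap.snd ℚ V' V'').baseChange ℂ ((f.prod g).baseChange ℂ z) = g.baseChange ℂ z :=
  baseChange_comp_eq _ _ _ (LinearMap.snd_prod _ _) z

lemma baseChange_coprod {V V' V'' : Type} [AddCommGroup V] [Module ℚ V] [AddCommGroup V']
    [Module ℚ V'] [AddCommGroup V''] [Module ℚ V''] (f : V →ₗ[ℚ] V'') (g : V' →ₗ[ℚ] V'')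
    (z : ℂ ⊗[ℚ] (V × V')) :
    (f.coprod g).baseChange ℂ z = f.baseChange ℂ ((LinearMap.fst ℚ V V').baseChange ℂ z) +
      g.baseChange ℂ ((LinearMap.snd ℚ V V').baseChange ℂ z) := by
  rw [baseChange_comp_eq _ _ _ rfl, baseChange_comp_eq _ _ _ rfl,
    ← LinearMap.add_apply, ← LinearMap.baseChange_add]
  rfl

def Hom.zero (H H' : HTStructure) : Hom H H' where
  toLin := 0
  map_W _ _ _ := zero_mem _
  map_F p z _ := by simp

def Hom.fst (H H' : HTStructure) : Hom (H.sum H') H where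
  toLin := LinearMap.fst ℚ H.V H'.V
  map_W _ _ hx := (Submodule.mem_prod.1 hx).1
  map_F _ _ hz := hz.1

def Hom.snd (H H' : HTStructure) : Hom (H.sum H') H' where
  toLin := LinearMap.snd ℚ H.V H'.V
  map_W _ _ hx := (Submodule.mem_prod.1 hx).2
  map_F _ _ hz := hz.2

/-- The morphism to a direct sum with given components. -/
def Hom.pair {K H H' : HTStructure} (f : Hom K H) (g : Hom K H') : Hom K (H.sum H') where
  toLin := f.toLin.prod g.toLin
  map_W k x hx := Submodule.mem_prod.2 ⟨f.map_W k x hx, g.map_W k x hx⟩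
  map_F p z hz :=
    ⟨show (LinearMap.fst ℚ H.V H'.V).baseChange ℂ _ ∈ H.F p from
        Set.mem_of_eq_of_mem (baseChange_fst_prod f.toLin g.toLin z) (f.map_F p z hz),
      show (LinearMap.snd ℚ H.V H'.V).baseChange ℂ _ ∈ H'.F p from
        Set.mem_of_eq_of_mem (baseChange_snd_prod f.toLin g.toLin z) (g.map_F p z hz)⟩

/-- The morphism from a direct sum with given components. -/
def Hom.copair {K H H' : HTStructure} (f : Hom H K) (g : Hom H' K) : Hom (H.sum H') K where
  toLin := f.toLin.coprod g.toLin
  map_W k _ hx := add_mem (f.map_W k _ (Submodule.mem_prod.1 hx).1)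
    (g.map_W k _ (Submodule.mem_prod.1 hx).2)
  map_F p z hz :=
    Set.mem_of_eq_of_mem (baseChange_coprod f.toLin g.toLin z)
      (add_mem (f.map_F p _ hz.1) (g.map_F p _ hz.2))

def Hom.inl (H H' : HTStructure) : Hom H (H.sum H') := Hom.pair (Hom.id H) (Hom.zero H H')

def Hom.inr (H H' : HTStructure) : Hom H' (H.sum H') := Hom.pair (Hom.zero H' H) (Hom.id H')

/-- Twisting a morphism. -/
def Hom.twist {H H' : HTStructure} (g : Hom H H') (m : ℤ) : Hom (H.twist m) (H'.twist m) where
  toLin := g.toLin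
  map_W _ x hx := g.map_W _ x hx
  map_F _ z hz := g.map_F _ z hz

lemma Hom.gr_id (H : HTStructure) (k : ℤ) (x : H.gr k) : (Hom.id H).gr k x = x := by
  induction x using Submodule.Quotient.induction_on with | H x => rfl

lemma Hom.gr_zero (H H' : HTStructure) (k : ℤ) (x : H.gr k) : (Hom.zero H H').gr k x = 0 := by
  induction x using Submodule.Quotient.induction_on with | H x => rfl

lemma Hom.gr_smulId (H : HTStructure) (c : ℚ) (k : ℤ) (x : H.gr k) :
    (Hom.smulId H c).gr k x = c • x := by
  induction x using Submodule.Quotient.induction_on with | H x => rfl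

lemma Hom.gr_comp {H H' H'' : HTStructure} (g : Hom H' H'') (f : Hom H H') (k : ℤ) (x : H.gr k) :
    (g.comp f).gr k x = g.gr k (f.gr k x) := by
  induction x using Submodule.Quotient.induction_on with | H x => rfl

lemma Hom.gr_fst_pair {K H H' : HTStructure} (f : Hom K H) (g : Hom K H') (k : ℤ) (x : K.gr k) :
    (Hom.fst H H').gr k ((f.pair g).gr k x) = f.gr k x := by
  induction x using Submodule.Quotient.induction_on with | H x => rfl

lemma Hom.gr_snd_pair {K H H' : HTStructure} (f : Hom K H) (g : Hom K H') (k : ℤ) (x : K.gr k) :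
    (Hom.snd H H').gr k ((f.pair g).gr k x) = g.gr k x := by
  induction x using Submodule.Quotient.induction_on with | H x => rfl

lemma Hom.gr_copair {K H H' : HTStructure} (f : Hom H K) (g : Hom H' K) (k : ℤ)
    (x : (H.sum H').gr k) :
    (f.copair g).gr k x = f.gr k ((Hom.fst H H').gr k x) + g.gr k ((Hom.snd H H').gr k x) := by
  induction x using Submodule.Quotient.induction_on with | H x => rfl

lemma gr_sum_decomp {H H' : HTStructure} (k : ℤ) (x : (H.sum H').gr k) :
    (Hom.inl H H').gr k ((Hom.fst H H').gr k x) +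
      (Hom.inr H H').gr k ((Hom.snd H H').gr k x) = x := by
  induction x using Submodule.Quotient.induction_on with
  | H x =>
    refine congrArg Submodule.Quotient.mk (Subtype.ext ?_)
    exact Prod.ext (add_zero _) (zero_add _)

lemma gr_sum_ext {H H' : HTStructure} {k : ℤ} {x y : (H.sum H').gr k}
    (h1 : (Hom.fst H H').gr k x = (Hom.fst H H').gr k y)
    (h2 : (Hom.snd H H').gr k x = (Hom.snd H H').gr k y) : x = y := by
  rw [← gr_sum_decomp k x, ← gr_sum_decomp k y, h1, h2]

/-- The vector `v + v'` of `gr^W_k (H ⊕ H')`. -/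
def sumVec {H H' : HTStructure} {k : ℤ} (v : H.gr k) (v' : H'.gr k) : (H.sum H').gr k :=
  (Hom.inl H H').gr k v + (Hom.inr H H').gr k v'

/-- The covector `f + f'` on `gr^W_k (H ⊕ H')`. -/
def sumCov {H H' : HTStructure} {k : ℤ} (f : H.gr k →ₗ[ℚ] ℚ) (f' : H'.gr k →ₗ[ℚ] ℚ) :
    (H.sum H').gr k →ₗ[ℚ] ℚ :=
  f ∘ₗ (Hom.fst H H').gr k + f' ∘ₗ (Hom.snd H H').gr k

lemma fst_sumVec {H H' : HTStructure} {k : ℤ} (v : H.gr k) (v' : H'.gr k) :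
    (Hom.fst H H').gr k (sumVec v v') = v := by
  simp [sumVec, Hom.inl, Hom.inr, Hom.gr_fst_pair, Hom.gr_id, Hom.gr_zero]

lemma snd_sumVec {H H' : HTStructure} {k : ℤ} (v : H.gr k) (v' : H'.gr k) :
    (Hom.snd H H').gr k (sumVec v v') = v' := by
  simp [sumVec, Hom.inl, Hom.inr, Hom.gr_snd_pair, Hom.gr_id, Hom.gr_zero]

lemma fst_inl {H H' : HTStructure} {k : ℤ} (v : H.gr k) :
    (Hom.fst H H').gr k ((Hom.inl H H').gr k v) = v := by
  simp [Hom.inl, Hom.gr_fst_pair, Hom.gr_id]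

lemma snd_inl {H H' : HTStructure} {k : ℤ} (v : H.gr k) :
    (Hom.snd H H').gr k ((Hom.inl H H').gr k v) = 0 := by
  simp [Hom.inl, Hom.gr_snd_pair, Hom.gr_zero]

lemma fst_inr {H H' : HTStructure} {k : ℤ} (v : H'.gr k) :
    (Hom.fst H H').gr k ((Hom.inr H H').gr k v) = 0 := by
  simp [Hom.inr, Hom.gr_fst_pair, Hom.gr_zero]

lemma snd_inr {H H' : HTStructure} {k : ℤ} (v : H'.gr k) :
    (Hom.snd H H').gr k ((Hom.inr H H').gr k v) = v := by
  simp [Hom.inr, Hom.gr_snd_pair, Hom.gr_id]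

lemma sumCov_apply {H H' : HTStructure} {k : ℤ} (f : H.gr k →ₗ[ℚ] ℚ) (f' : H'.gr k →ₗ[ℚ] ℚ)
    (x : (H.sum H').gr k) :
    sumCov f f' x = f ((Hom.fst H H').gr k x) + f' ((Hom.snd H H').gr k x) := rfl

lemma sumVec_ne {H H' : HTStructure} {k : ℤ} {v : H.gr k} (v' : H'.gr k) (h : v ≠ 0) :
    sumVec v v' ≠ 0 := by
  intro e
  apply h
  rw [← fst_sumVec v v', e, map_zero]

lemma sumCov_ne {H H' : HTStructure} {k : ℤ} {f : H.gr k →ₗ[ℚ] ℚ} (f' : H'.gr k →ₗ[ℚ] ℚ)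
    (h : f ≠ 0) : sumCov f f' ≠ 0 := by
  intro e
  apply h
  ext1
  refine LinearMap.ext fun x => ?_
  have := LinearMap.congr_fun e ((Hom.inl H H').gr k (Submodule.Quotient.mk x))
  simpa [sumCov_apply, fst_inl, snd_inl] using this

lemma sumCov_ne' {H H' : HTStructure} {k : ℤ} (f : H.gr k →ₗ[ℚ] ℚ) {f' : H'.gr k →ₗ[ℚ] ℚ}
    (h : f' ≠ 0) : sumCov f f' ≠ 0 := by
  intro e
  apply h
  ext1
  refine LinearMap.ext fun x => ?_
  have := LinearMap.congr_fun e ((Hom.inr H H').gr k (Submodule.Quotient.mk x))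
  simpa [sumCov_apply, fst_inr, snd_inr] using this

lemma tateGen_ne (n a : ℤ) (h : a = -2 * n) : tateGen n a h ≠ 0 := by
  intro e
  have := tateVal_gen n a h
  rw [e, map_zero] at this
  exact zero_ne_one this

lemma tateVal_ne (n a : ℤ) (h : a = -2 * n) : tateVal n a h ≠ 0 := by
  intro e
  have := tateVal_gen n a h
  rw [e] at this
  exact zero_ne_one this

end HTStructure

open HTStructure

/-- An `n`-framed Hodge–Tate structure: a Hodge–Tate structure with a non-zero vector of
`gr^W_0` and a non-zero covector on `gr^W_{-2n}`. -/
structure FramedHT (n : ℕ) where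
  H : HTStructure
  v : H.gr 0
  f : H.gr (-2 * (n : ℤ)) →ₗ[ℚ] ℚ
  v_ne : v ≠ 0
  f_ne : f ≠ 0

/-- There is a morphism of Hodge–Tate structures `X.H → Y.H` preserving the framings. -/
def FramedHT.Rel {n : ℕ} (X Y : FramedHT n) : Prop :=
  ∃ g : Hom X.H Y.H, g.gr 0 X.v = Y.v ∧ Y.f ∘ₗ g.gr (-2 * (n : ℤ)) = X.f

/-- The set `ℋ_n` of equivalence classes of `n`-framed Hodge–Tate structures, for the
equivalence relation generated by the morphisms preserving framings. -/
def HTn (n : ℕ) : Type 1 := Quot (FramedHT.Rel (n := n))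

namespace HTn

variable {n : ℕ}

/-- The class `[H, v, f]`. -/
def mk (X : FramedHT n) : HTn n := Quot.mk _ X

/-- `ℚ(0) ⊕ ℚ(n)` with the obvious `n`-framing. -/
abbrev zeroF (n : ℕ) : FramedHT n where
  H := (tate 0).sum (tate n)
  v := sumVec (tateGen 0 0 rfl) 0
  f := sumCov 0 (tateVal n _ rfl)
  v_ne := sumVec_ne _ (tateGen_ne _ _ _)
  f_ne := sumCov_ne' _ (tateVal_ne _ _ _)

/-- The direct sum of framed structures, `(H ⊕ H', v + v', f + f')`. -/
abbrev addF (X Y : FramedHT n) : FramedHT n where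
  H := X.H.sum Y.H
  v := sumVec X.v Y.v
  f := sumCov X.f Y.f
  v_ne := sumVec_ne _ X.v_ne
  f_ne := sumCov_ne _ X.f_ne

instance : Zero (HTn n) := ⟨mk (zeroF n)⟩

lemma sound {X Y : FramedHT n} (g : Hom X.H Y.H) (hv : g.gr 0 X.v = Y.v)
    (hf : ∀ x, Y.f (g.gr _ x) = X.f x) : mk X = mk Y :=
  Quot.sound ⟨g, hv, LinearMap.ext hf⟩

instance : Add (HTn n) :=
  ⟨Quot.map₂ addF
    (fun X Y Y' ⟨g, hv, hf⟩ => by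
      refine ⟨(Hom.fst _ _).pair (g.comp (Hom.snd _ _)), ?_, ?_⟩
      · apply gr_sum_ext
        · rw [Hom.gr_fst_pair]; simp only [addF, fst_sumVec]
        · rw [Hom.gr_snd_pair, Hom.gr_comp]; simp only [addF, snd_sumVec, hv]
      · refine LinearMap.ext fun x => ?_
        simp only [addF, LinearMap.comp_apply, sumCov_apply, Hom.gr_fst_pair, Hom.gr_snd_pair,
          Hom.gr_comp, ← hf])
    (fun X X' Y ⟨g, hv, hf⟩ => by
      refine ⟨(g.comp (Hom.fst _ _)).pair (Hom.snd _ _), ?_, ?_⟩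
      · apply gr_sum_ext
        · rw [Hom.gr_fst_pair, Hom.gr_comp]; simp only [addF, fst_sumVec, hv]
        · rw [Hom.gr_snd_pair]; simp only [addF, snd_sumVec]
      · refine LinearMap.ext fun x => ?_
        simp only [addF, LinearMap.comp_apply, sumCov_apply, Hom.gr_fst_pair, Hom.gr_snd_pair,
          Hom.gr_comp, ← hf])⟩

lemma mk_add_mk (X Y : FramedHT n) : mk X + mk Y = mk (addF X Y) := rfl

lemma add_comm' (x y : HTn n) : x + y = y + x := by
  obtain ⟨X, rfl⟩ := Quot.exists_rep x
  obtain ⟨Y, rfl⟩ := Quot.exists_rep y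
  refine sound ((Hom.snd _ _).pair (Hom.fst _ _)) ?_ ?_
  · apply gr_sum_ext
    · rw [Hom.gr_fst_pair]; simp only [addF, fst_sumVec, snd_sumVec]
    · rw [Hom.gr_snd_pair]; simp only [addF, fst_sumVec, snd_sumVec]
  · intro x
    simp only [addF, sumCov_apply, Hom.gr_fst_pair, Hom.gr_snd_pair]
    exact add_comm _ _

lemma add_assoc' (x y z : HTn n) : x + y + z = x + (y + z) := by
  obtain ⟨X, rfl⟩ := Quot.exists_rep x
  obtain ⟨Y, rfl⟩ := Quot.exists_rep y
  obtain ⟨Z, rfl⟩ := Quot.exists_rep z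
  refine sound (((Hom.fst _ _).comp (Hom.fst _ _)).pair
    (((Hom.snd _ _).comp (Hom.fst _ _)).pair (Hom.snd _ _))) ?_ ?_
  · apply gr_sum_ext
    · rw [Hom.gr_fst_pair, Hom.gr_comp]; simp only [addF, fst_sumVec]
    · apply gr_sum_ext
      · rw [Hom.gr_snd_pair, Hom.gr_fst_pair, Hom.gr_comp]
        simp only [addF, fst_sumVec, snd_sumVec]
      · rw [Hom.gr_snd_pair, Hom.gr_snd_pair]
        simp only [addF, snd_sumVec]
  · intro x
    simp only [addF, sumCov_apply, Hom.gr_fst_pair, Hom.gr_snd_pair, Hom.gr_comp]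
    exact (add_assoc _ _ _).symm

lemma add_zero' (x : HTn n) : x + 0 = x := by
  obtain ⟨X, rfl⟩ := Quot.exists_rep x
  let M : FramedHT n :=
    { H := X.H.sum (tate n)
      v := sumVec X.v 0
      f := sumCov X.f (tateVal n _ rfl)
      v_ne := sumVec_ne _ X.v_ne
      f_ne := sumCov_ne _ X.f_ne }
  have h1 : mk (addF X (zeroF n)) = mk M := by
    refine sound ((Hom.fst _ _).pair ((Hom.snd _ _).comp (Hom.snd _ _))) ?_ ?_
    · apply gr_sum_ext
      · rw [Hom.gr_fst_pair]; simp only [addF, M, fst_sumVec]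
      · rw [Hom.gr_snd_pair, Hom.gr_comp]; simp only [addF, zeroF, M, snd_sumVec]
    · intro x
      simp only [addF, zeroF, M, sumCov_apply, Hom.gr_fst_pair, Hom.gr_snd_pair, Hom.gr_comp,
        LinearMap.zero_apply, zero_add]
  have h2 : mk X = mk M := by
    refine sound (Hom.inl _ _) ?_ ?_
    · apply gr_sum_ext
      · simp only [M, fst_inl, fst_sumVec]
      · simp only [M, snd_inl, snd_sumVec]
    · intro x
      simp only [M, sumCov_apply, fst_inl, snd_inl, map_zero, add_zero]
  exact h1.trans h2.symm

/-- The class `[H, v, f]`, extended by `0` to the case that `v` or `f` vanishes. -/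
def cls (H : HTStructure) (v : H.gr 0) (f : H.gr (-2 * (n : ℤ)) →ₗ[ℚ] ℚ) : HTn n :=
  open scoped Classical in if h : v ≠ 0 ∧ f ≠ 0 then mk ⟨H, v, f, h.1, h.2⟩ else 0

lemma cls_eq_mk (X : FramedHT n) : cls X.H X.v X.f = mk X := dif_pos ⟨X.v_ne, X.f_ne⟩

lemma cls_zero_right (H : HTStructure) (v : H.gr 0) :
    cls H v (0 : H.gr (-2 * (n : ℤ)) →ₗ[ℚ] ℚ) = 0 := dif_neg (fun h => h.2 rfl)

lemma cls_zero_left (H : HTStructure) (f : H.gr (-2 * (n : ℤ)) →ₗ[ℚ] ℚ) :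
    cls H 0 f = 0 := dif_neg (fun h => h.1 rfl)

lemma exists_cls (x : HTn n) :
    ∃ (H : HTStructure) (v : H.gr 0) (f : H.gr (-2 * (n : ℤ)) →ₗ[ℚ] ℚ), cls H v f = x := by
  obtain ⟨X, rfl⟩ := Quot.exists_rep x
  exact ⟨X.H, X.v, X.f, cls_eq_mk X⟩

/-- An auxiliary framed structure representing `cls H v f`. -/
abbrev augF (H : HTStructure) (v : H.gr 0) (f : H.gr (-2 * (n : ℤ)) →ₗ[ℚ] ℚ) : FramedHT n where
  H := (zeroF n).H.sum H
  v := sumVec (zeroF n).v v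
  f := sumCov (zeroF n).f f
  v_ne := sumVec_ne _ (zeroF n).v_ne
  f_ne := sumCov_ne _ (zeroF n).f_ne

lemma cls_eq_aug (H : HTStructure) (v : H.gr 0) (f : H.gr (-2 * (n : ℤ)) →ₗ[ℚ] ℚ) :
    cls H v f = mk (augF H v f) := by
  by_cases hv : v = 0
  · subst hv
    rw [cls_zero_left]
    refine sound (X := zeroF n) (Hom.inl _ _) ?_ ?_
    · apply gr_sum_ext
      · simp only [augF, fst_inl, fst_sumVec]
      · simp only [augF, snd_inl, snd_sumVec]
    · intro x
      simp only [augF, sumCov_apply, fst_inl, snd_inl, map_zero, add_zero]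
  by_cases hf : f = 0
  · subst hf
    rw [cls_zero_right]
    refine (sound (Y := zeroF n) (Hom.fst _ _) ?_ ?_).symm
    · simp only [augF, fst_sumVec]
    · intro x
      simp only [augF, sumCov_apply, LinearMap.zero_apply, add_zero]
  · have := add_zero' (mk ⟨H, v, f, hv, hf⟩)
    rw [add_comm'] at this
    rw [← cls_eq_mk ⟨H, v, f, hv, hf⟩] at this
    simp only at this
    rw [← this, cls_eq_mk ⟨H, v, f, hv, hf⟩]
    rfl

lemma cls_hom {H H' : HTStructure} (g : Hom H H') {v : H.gr 0} {v' : H'.gr 0}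
    {f : H.gr (-2 * (n : ℤ)) →ₗ[ℚ] ℚ} {f' : H'.gr (-2 * (n : ℤ)) →ₗ[ℚ] ℚ}
    (hv : g.gr 0 v = v') (hf : ∀ x, f' (g.gr _ x) = f x) : cls H v f = cls H' v' f' := by
  rw [cls_eq_aug, cls_eq_aug]
  refine sound ((Hom.fst _ _).pair (g.comp (Hom.snd _ _))) ?_ ?_
  · apply gr_sum_ext
    · rw [Hom.gr_fst_pair]; simp only [augF, fst_sumVec]
    · rw [Hom.gr_snd_pair, Hom.gr_comp]; simp only [augF, snd_sumVec, hv]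
  · intro x
    simp only [augF, sumCov_apply, Hom.gr_fst_pair, Hom.gr_snd_pair, Hom.gr_comp, hf]

lemma cls_add_cls {H H' : HTStructure} (v : H.gr 0) (v' : H'.gr 0)
    (f : H.gr (-2 * (n : ℤ)) →ₗ[ℚ] ℚ) (f' : H'.gr (-2 * (n : ℤ)) →ₗ[ℚ] ℚ) :
    cls H v f + cls H' v' f' = cls (H.sum H') (sumVec v v') (sumCov f f') := by
  have zero_add' : ∀ x : HTn n, 0 + x = x := fun x => by rw [add_comm', add_zero']
  by_cases hv : v = 0
  · subst hv
    rw [cls_zero_left, zero_add']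
    refine cls_hom (Hom.inr _ _) ?_ ?_
    · simp only [sumVec, map_zero, zero_add]
    · intro x; simp only [sumCov_apply, fst_inr, snd_inr, map_zero, zero_add]
  by_cases hf : f = 0
  · subst hf
    rw [cls_zero_right, zero_add']
    refine (cls_hom (Hom.snd _ _) ?_ ?_).symm
    · rw [snd_sumVec]
    · intro x; simp only [sumCov_apply, LinearMap.zero_apply, zero_add]
  by_cases hv' : v' = 0
  · subst hv'
    rw [cls_zero_left, add_zero']
    refine cls_hom (Hom.inl _ _) ?_ ?_
    · simp only [sumVec, map_zero, add_zero]
    · intro x; simp only [sumCov_apply, fst_inl, snd_inl, map_zero, add_zero]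
  by_cases hf' : f' = 0
  · subst hf'
    rw [cls_zero_right, add_zero']
    refine (cls_hom (Hom.fst _ _) ?_ ?_).symm
    · rw [fst_sumVec]
    · intro x; simp only [sumCov_apply, LinearMap.zero_apply, add_zero]
  · have h1 := cls_eq_mk (⟨H, v, f, hv, hf⟩ : FramedHT n)
    have h2 := cls_eq_mk (⟨H', v', f', hv', hf'⟩ : FramedHT n)
    have h3 := cls_eq_mk (addF (⟨H, v, f, hv, hf⟩ : FramedHT n) ⟨H', v', f', hv', hf'⟩)
    exact (congrArg₂ (· + ·) h1 h2).trans h3.symm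

lemma cls_add_right (H : HTStructure) (v : H.gr 0) (f f' : H.gr (-2 * (n : ℤ)) →ₗ[ℚ] ℚ) :
    cls H v (f + f') = cls H v f + cls H v f' := by
  rw [cls_add_cls]
  refine cls_hom ((Hom.id H).pair (Hom.id H)) ?_ ?_
  · apply gr_sum_ext
    · rw [Hom.gr_fst_pair, fst_sumVec, Hom.gr_id]
    · rw [Hom.gr_snd_pair, snd_sumVec, Hom.gr_id]
  · intro x
    simp only [sumCov_apply, Hom.gr_fst_pair, Hom.gr_snd_pair, Hom.gr_id, LinearMap.add_apply]

lemma cls_add_left (H : HTStructure) (v v' : H.gr 0) (f : H.gr (-2 * (n : ℤ)) →ₗ[ℚ] ℚ) :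
    cls H (v + v') f = cls H v f + cls H v' f := by
  rw [cls_add_cls]
  refine (cls_hom ((Hom.id H).copair (Hom.id H)) ?_ ?_).symm
  · rw [Hom.gr_copair, fst_sumVec, snd_sumVec, Hom.gr_id, Hom.gr_id]
  · intro x
    simp only [Hom.gr_copair, Hom.gr_id, map_add, sumCov_apply]

lemma cls_smul_left (H : HTStructure) (c : ℚ) (v : H.gr 0) (f : H.gr (-2 * (n : ℤ)) →ₗ[ℚ] ℚ) :
    cls H (c • v) f = cls H v (c • f) := by
  refine (cls_hom (Hom.smulId H c) ?_ ?_).symm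
  · rw [Hom.gr_smulId]
  · intro x; rw [Hom.gr_smulId, map_smul, LinearMap.smul_apply]

/-- Scalar multiplication `c [H, v, f] = [H, v, c f]`, which is to be read as `0` for `c = 0`. -/
instance : SMul ℚ (HTn n) :=
  ⟨fun c => Quot.lift (fun X => cls X.H X.v (c • X.f)) (fun X Y ⟨g, hv, hf⟩ =>
    cls_hom g hv (fun x => by rw [← hf]; rfl))⟩

lemma smul_mk (c : ℚ) (X : FramedHT n) : c • mk X = cls X.H X.v (c • X.f) := rfl

lemma smul_zero' (c : ℚ) : c • (0 : HTn n) = 0 := by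
  change cls (zeroF n).H (zeroF n).v (c • (zeroF n).f) = 0
  rw [← cls_zero_right (n := n) (tate 0) (tateGen 0 0 rfl)]
  refine (cls_hom (Hom.inl _ _) ?_ ?_).symm
  · simp only [sumVec, map_zero, add_zero]
  · intro x
    simp only [zeroF, LinearMap.smul_apply, sumCov_apply, LinearMap.zero_apply, snd_inl, map_zero,
      add_zero, smul_zero]

lemma smul_cls (c : ℚ) (H : HTStructure) (v : H.gr 0) (f : H.gr (-2 * (n : ℤ)) →ₗ[ℚ] ℚ) :
    c • cls H v f = cls H v (c • f) := by
  by_cases h : v ≠ 0 ∧ f ≠ 0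
  · rw [← smul_mk c ⟨H, v, f, h.1, h.2⟩, ← cls_eq_mk]
  · have : v = 0 ∨ f = 0 := by tauto
    rcases this with rfl | rfl
    · rw [cls_zero_left, cls_zero_left, smul_zero']
    · rw [smul_zero, cls_zero_right, smul_zero']

instance : Neg (HTn n) := ⟨fun x => (-1 : ℚ) • x⟩

instance : AddCommGroup (HTn n) where
  add_assoc := add_assoc'
  zero_add x := by rw [add_comm', add_zero']
  add_zero := add_zero'
  add_comm := add_comm'
  nsmul := nsmulRec
  zsmul := zsmulRec
  neg_add_cancel x := by
    obtain ⟨H, v, f, rfl⟩ := exists_cls x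
    change (-1 : ℚ) • cls H v f + cls H v f = (0 : HTn n)
    rw [smul_cls, ← cls_add_right, neg_one_smul, neg_add_cancel, cls_zero_right]

instance : Module ℚ (HTn n) where
  one_smul x := by
    obtain ⟨H, v, f, rfl⟩ := exists_cls x
    rw [smul_cls, one_smul]
  mul_smul a b x := by
    obtain ⟨H, v, f, rfl⟩ := exists_cls x
    rw [smul_cls, smul_cls, smul_cls, mul_smul]
  smul_zero := smul_zero'
  smul_add a x y := by
    obtain ⟨H, v, f, rfl⟩ := exists_cls x
    obtain ⟨H', v', f', rfl⟩ := exists_cls y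
    rw [cls_add_cls, smul_cls, smul_cls, smul_cls, cls_add_cls]
    congr 1
    refine LinearMap.ext fun x => ?_
    simp only [sumCov_apply, LinearMap.smul_apply, smul_add]
  add_smul a b x := by
    obtain ⟨H, v, f, rfl⟩ := exists_cls x
    rw [smul_cls, smul_cls, smul_cls, add_smul, cls_add_right]
  zero_smul x := by
    obtain ⟨H, v, f, rfl⟩ := exists_cls x
    rw [smul_cls, zero_smul, cls_zero_right]

/-- `[H, v, f]` as a bilinear function of `v` and `f`. -/
def clsL (H : HTStructure) :
    H.gr 0 →ₗ[ℚ] (H.gr (-2 * (n : ℤ)) →ₗ[ℚ] ℚ) →ₗ[ℚ] HTn n :=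
  LinearMap.mk₂ ℚ (cls H) (cls_add_left H)
    (fun c v f => by rw [cls_smul_left, smul_cls]) (cls_add_right H)
    (fun c v f => by rw [smul_cls])

end HTn

/-- Both sides compute the image of the graph of `g` in `P ⊗ Q`; for `g = id` this is the
independence of `∑ i, A (b i)^∨ ⊗ B (b i)` of the basis `b`. -/
lemma sum_coord_tmul {M M' P Q ι ι' : Type*} [AddCommGroup M] [Module ℚ M] [AddCommGroup M']
    [Module ℚ M'] [AddCommGroup P] [Module ℚ P] [AddCommGroup Q] [Module ℚ Q]
    [Fintype ι] [Fintype ι'] (b : Module.Basis ι ℚ M) (b' : Module.Basis ι' ℚ M')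
    (g : M →ₗ[ℚ] M') (A : (M →ₗ[ℚ] ℚ) →ₗ[ℚ] P) (B : M' →ₗ[ℚ] Q) :
    ∑ i, A (b.coord i) ⊗ₜ[ℚ] B (g (b i)) = ∑ j, A (b'.coord j ∘ₗ g) ⊗ₜ[ℚ] B (b' j) := by
  have h1 : ∀ i, g (b i) = ∑ j, b'.coord j (g (b i)) • b' j := fun i => (b'.sum_repr _).symm
  have h2 : ∀ j, b'.coord j ∘ₗ g = ∑ i, b'.coord j (g (b i)) • b.coord i := by
    intro j
    refine b.ext fun i => ?_
    classical
    simp [LinearMap.sum_apply, Finsupp.single_apply]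
  calc ∑ i, A (b.coord i) ⊗ₜ[ℚ] B (g (b i))
      = ∑ i, ∑ j, b'.coord j (g (b i)) • (A (b.coord i) ⊗ₜ[ℚ] B (b' j)) := by
        refine Finset.sum_congr rfl fun i _ => ?_
        conv_lhs => rw [h1 i]
        simp only [map_sum, map_smul, TensorProduct.tmul_sum, TensorProduct.tmul_smul]
    _ = ∑ j, ∑ i, b'.coord j (g (b i)) • (A (b.coord i) ⊗ₜ[ℚ] B (b' j)) := Finset.sum_comm
    _ = _ := by
        refine Finset.sum_congr rfl fun j _ => ?_
        rw [h2 j]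
        simp only [map_sum, map_smul, TensorProduct.sum_tmul, TensorProduct.smul_tmul']

namespace HTStructure

/-- The identity `gr^W_{b+2m} H = gr^W_b H(m)`. -/
def toTwist (H : HTStructure) (m : ℤ) {a b : ℤ} (h : a = b + 2 * m) :
    H.gr a →ₗ[ℚ] (H.twist m).gr b :=
  grMap (H' := H.twist m) a b (LinearMap.id : H.V →ₗ[ℚ] H.V)
    (fun x hx => show x ∈ H.W (b + 2 * m) from h ▸ hx)
    (fun x hx => show x ∈ H.W (b - 1 + 2 * m) from
      (show a - 1 = b - 1 + 2 * m by omega) ▸ hx)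

/-- The identity `gr^W_b H(m) = gr^W_{b+2m} H`. -/
def ofTwist (H : HTStructure) (m : ℤ) {a b : ℤ} (h : a = b + 2 * m) :
    (H.twist m).gr b →ₗ[ℚ] H.gr a :=
  grMap (H := H.twist m) b a (LinearMap.id : H.V →ₗ[ℚ] H.V)
    (fun x hx => show x ∈ H.W a from h ▸ hx)
    (fun x hx => show x ∈ H.W (a - 1) from
      (show a - 1 = b - 1 + 2 * m by omega) ▸ hx)

lemma toTwist_ofTwist (H : HTStructure) (m : ℤ) {a b : ℤ} (h : a = b + 2 * m)
    (x : (H.twist m).gr b) : H.toTwist m h (H.ofTwist m h x) = x := by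
  induction x using Submodule.Quotient.induction_on with | H x => rfl

lemma ofTwist_toTwist (H : HTStructure) (m : ℤ) {a b : ℤ} (h : a = b + 2 * m)
    (x : H.gr a) : H.ofTwist m h (H.toTwist m h x) = x := by
  induction x using Submodule.Quotient.induction_on with | H x => rfl

lemma Hom.twist_gr_toTwist {H H' : HTStructure} (g : Hom H H') (m : ℤ) {a b : ℤ}
    (h : a = b + 2 * m) (x : H.gr a) :
    (g.twist m).gr b (H.toTwist m h x) = H'.toTwist m h (g.gr a x) := by
  induction x using Submodule.Quotient.induction_on with | H x => rfl

lemma Hom.ofTwist_twist_gr {H H' : HTStructure} (g : Hom H H') (m : ℤ) {a b : ℤ}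
    (h : a = b + 2 * m) (x : (H.twist m).gr b) :
    H'.ofTwist m h ((g.twist m).gr b x) = g.gr a (H.ofTwist m h x) := by
  induction x using Submodule.Quotient.induction_on with | H x => rfl

/-- For `n = m + d`, `v` in `gr^W_{-2m} H` and a covector `f` on `gr^W_{-2n} H`, the class
`[H, v, f](-m) ∈ ℋ_d` of the Tate twist by `-m` of the `(m,n)`-framed structure `(H, v, f)`. -/
def shiftCls (H : HTStructure) (m n : ℤ) (d : ℕ) (h : m + d = n) :
    H.gr (-2 * m) →ₗ[ℚ] (H.gr (-2 * n) →ₗ[ℚ] ℚ) →ₗ[ℚ] HTn d :=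
  (HTn.clsL (H.twist (-m))).compl₁₂
    (H.toTwist (-m) (a := -2 * m) (b := 0) (by ring))
    (LinearMap.lcomp ℚ ℚ (H.ofTwist (-m) (a := -2 * n) (b := -2 * (d : ℤ)) (by rw [← h]; ring)))

lemma shiftCls_apply (H : HTStructure) (m n : ℤ) (d : ℕ) (h : m + d = n) (v : H.gr (-2 * m))
    (f : H.gr (-2 * n) →ₗ[ℚ] ℚ) :
    H.shiftCls m n d h v f = HTn.cls (H.twist (-m)) (H.toTwist (-m) (by ring) v)
      (f ∘ₗ H.ofTwist (-m) (by rw [← h]; ring)) := rfl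

lemma shiftCls_hom {H H' : HTStructure} (g : Hom H H') (m n : ℤ) (d : ℕ) (h : m + d = n)
    (v : H.gr (-2 * m)) (f : H'.gr (-2 * n) →ₗ[ℚ] ℚ) :
    H.shiftCls m n d h v (f ∘ₗ g.gr _) = H'.shiftCls m n d h (g.gr _ v) f := by
  rw [shiftCls_apply, shiftCls_apply]
  refine HTn.cls_hom (g.twist (-m)) ?_ ?_
  · rw [Hom.twist_gr_toTwist]
  · intro x
    simp only [LinearMap.comp_apply, Hom.ofTwist_twist_gr]

/-- `∑ i, [H, v, b_i^∨] ⊗ [H, b_i, f](-k)` for a basis `b` of `gr^W_{-2k} H`, as a bilinear function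
of `v` and `f`. -/
def comulL (H : HTStructure) (k l n : ℕ) (h : k + l = n) {ι : Type} [Fintype ι]
    (b : Module.Basis ι ℚ (H.gr (-2 * (k : ℤ)))) :
    H.gr 0 →ₗ[ℚ] (H.gr (-2 * (n : ℤ)) →ₗ[ℚ] ℚ) →ₗ[ℚ] HTn k ⊗[ℚ] HTn l :=
  LinearMap.mk₂ ℚ
    (fun v f => ∑ i, HTn.cls H v (b.coord i) ⊗ₜ[ℚ]
      H.shiftCls k n l (by exact_mod_cast h) (b i) f)
    (fun v v' f => by
      simp only [HTn.cls_add_left, TensorProduct.add_tmul, Finset.sum_add_distrib])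
    (fun c v f => by
      simp only [HTn.cls_smul_left, ← HTn.smul_cls, TensorProduct.smul_tmul', Finset.smul_sum])
    (fun v f f' => by
      simp only [map_add, TensorProduct.tmul_add, Finset.sum_add_distrib])
    (fun c v f => by
      simp only [map_smul, TensorProduct.tmul_smul, Finset.smul_sum])

lemma comulL_apply (H : HTStructure) (k l n : ℕ) (h : k + l = n) {ι : Type} [Fintype ι]
    (b : Module.Basis ι ℚ (H.gr (-2 * (k : ℤ)))) (v : H.gr 0)
    (f : H.gr (-2 * (n : ℤ)) →ₗ[ℚ] ℚ) :
    H.comulL k l n h b v f = ∑ i, HTn.cls H v (b.coord i) ⊗ₜ[ℚ]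
      H.shiftCls k n l (by exact_mod_cast h) (b i) f := rfl

lemma comulL_hom {H H' : HTStructure} (g : Hom H H') (k l n : ℕ) (h : k + l = n)
    {ι ι' : Type} [Fintype ι] [Fintype ι']
    (b : Module.Basis ι ℚ (H.gr (-2 * (k : ℤ)))) (b' : Module.Basis ι' ℚ (H'.gr (-2 * (k : ℤ))))
    (v : H.gr 0) (f : H'.gr (-2 * (n : ℤ)) →ₗ[ℚ] ℚ) :
    H.comulL k l n h b v (f ∘ₗ g.gr _) = H'.comulL k l n h b' (g.gr 0 v) f := by
  rw [comulL_apply, comulL_apply]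
  have key := sum_coord_tmul b b' (g.gr _) (HTn.clsL H v)
    ((H'.shiftCls k n l (by exact_mod_cast h)).flip f)
  simp only [LinearMap.flip_apply, ← shiftCls_hom] at key
  refine key.trans (Finset.sum_congr rfl fun j _ => ?_)
  congr 1
  exact HTn.cls_hom g rfl (fun _ => rfl)

/-- The pairing `f(v)` underlying the counit in degree `0`. -/
def counitL (H : HTStructure) :
    H.gr 0 →ₗ[ℚ] (H.gr (-2 * ((0 : ℕ) : ℤ)) →ₗ[ℚ] ℚ) →ₗ[ℚ] ℚ :=
  LinearMap.mk₂ ℚ (fun v f => f (H.grCast (by simp) v))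
    (fun v v' f => by simp) (fun c v f => by simp) (fun v f f' => rfl) (fun c v f => rfl)

lemma counitL_hom {H H' : HTStructure} (g : Hom H H') (v : H.gr 0)
    (f : H'.gr (-2 * ((0 : ℕ) : ℤ)) →ₗ[ℚ] ℚ) :
    H.counitL v (f ∘ₗ g.gr _) = H'.counitL (g.gr 0 v) f := by
  change f _ = f _
  congr 1
  induction v using Submodule.Quotient.induction_on with | H x => rfl

end HTStructure

namespace HTn

/-- A bilinear expression in the framing, compatible with all morphisms, descends to a linear map
on `ℋ_n`. -/
def lift {n : ℕ} {P : Type*} [AddCommGroup P] [Module ℚ P]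
    (T : ∀ H : HTStructure, H.gr 0 →ₗ[ℚ] (H.gr (-2 * (n : ℤ)) →ₗ[ℚ] ℚ) →ₗ[ℚ] P)
    (hT : ∀ (H H' : HTStructure) (g : Hom H H') (v : H.gr 0)
      (f : H'.gr (-2 * (n : ℤ)) →ₗ[ℚ] ℚ), T H v (f ∘ₗ g.gr _) = T H' (g.gr 0 v) f) :
    {φ : HTn n →ₗ[ℚ] P // ∀ (H : HTStructure) (v : H.gr 0) (f : H.gr (-2 * (n : ℤ)) →ₗ[ℚ] ℚ),
      φ (cls H v f) = T H v f} := by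
  let φ : HTn n → P := Quot.lift (fun X => T X.H X.v X.f)
    (fun X Y ⟨g, hv, hf⟩ => by
      rw [← hv, ← hT, hf])
  have h0 : φ 0 = 0 := by
    change T (zeroF n).H (sumVec _ _) (sumCov _ _) = 0
    rw [sumVec, map_zero, add_zero, ← hT]
    rw [show sumCov 0 (tateVal n _ rfl) ∘ₗ (Hom.inl (tate 0) (tate n)).gr (-2 * (n : ℤ)) = 0 from ?_,
      map_zero]
    refine LinearMap.ext fun x => ?_
    simp only [LinearMap.comp_apply, sumCov_apply, snd_inl, LinearMap.zero_apply, map_zero, add_zero]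
  have hcls : ∀ (H : HTStructure) (v : H.gr 0) (f : H.gr (-2 * (n : ℤ)) →ₗ[ℚ] ℚ),
      φ (cls H v f) = T H v f := by
    intro H v f
    by_cases h : v ≠ 0 ∧ f ≠ 0
    · exact congrArg φ (cls_eq_mk ⟨H, v, f, h.1, h.2⟩)
    · have : v = 0 ∨ f = 0 := by tauto
      rcases this with rfl | rfl
      · rw [cls_zero_left, h0, map_zero, LinearMap.zero_apply]
      · rw [cls_zero_right, h0, map_zero]
  refine ⟨{ toFun := φ, map_add' := ?_, map_smul' := ?_ }, hcls⟩
  · intro x y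
    obtain ⟨H, v, f, rfl⟩ := exists_cls x
    obtain ⟨H', v', f', rfl⟩ := exists_cls y
    rw [cls_add_cls, hcls, hcls, hcls, sumVec, map_add, LinearMap.add_apply, ← hT, ← hT]
    congr 2
    · refine LinearMap.ext fun x => ?_
      simp only [LinearMap.comp_apply, sumCov_apply, fst_inl, snd_inl, map_zero, add_zero]
    · refine LinearMap.ext fun x => ?_
      simp only [LinearMap.comp_apply, sumCov_apply, fst_inr, snd_inr, map_zero, zero_add]
  · intro c x
    obtain ⟨H, v, f, rfl⟩ := exists_cls x
    rw [smul_cls, hcls, hcls, map_smul, RingHom.id_apply]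

/-- The component `ν_{kl} : ℋ_n → ℋ_k ⊗ ℋ_l` (`n = k + l`) of the comultiplication,
`[H, v, f] ↦ ∑ i, [H, v, b_i^∨] ⊗ [H, b_i, f](-k)` for a basis `b` of `gr^W_{-2k} H`. -/
def comulComp (k l n : ℕ) (h : k + l = n) : HTn n →ₗ[ℚ] HTn k ⊗[ℚ] HTn l :=
  (lift (fun H => H.comulL k l n h (Module.finBasis ℚ (H.gr (-2 * (k : ℤ)))))
    (fun _ _ g v f => comulL_hom g k l n h _ _ v f)).1

lemma comulComp_cls (k l n : ℕ) (h : k + l = n) (H : HTStructure) {ι : Type} [Fintype ι]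
    (b : Module.Basis ι ℚ (H.gr (-2 * (k : ℤ)))) (v : H.gr 0)
    (f : H.gr (-2 * (n : ℤ)) →ₗ[ℚ] ℚ) :
    comulComp k l n h (cls H v f) = ∑ i, cls H v (b.coord i) ⊗ₜ[ℚ]
      H.shiftCls k n l (by exact_mod_cast h) (b i) f := by
  rw [comulComp, (lift _ _).2, ← comulL_apply H k l n h]
  have := comulL_hom (Hom.id H) k l n h (Module.finBasis ℚ (H.gr (-2 * (k : ℤ)))) b v f
  rw [Hom.gr_id] at this
  rw [← this]
  congr 1
  refine LinearMap.ext fun x => ?_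
  rw [LinearMap.comp_apply, Hom.gr_id]

/-- The counit in degree `0`, `[H, v, f] ↦ f(v)`. -/
def counit0 : HTn 0 →ₗ[ℚ] ℚ :=
  (lift counitL (fun _ _ g v f => counitL_hom g v f)).1

lemma counit0_cls (H : HTStructure) (v : H.gr 0) (f : H.gr (-2 * ((0 : ℕ) : ℤ)) →ₗ[ℚ] ℚ) :
    counit0 (cls H v f) = f (H.grCast (by simp) v) :=
  (lift counitL (fun _ _ g v f => counitL_hom g v f)).2 H v f

/-- The unit `1 = [ℚ(0), id, id] ∈ ℋ_0`. -/
def unit : HTn 0 := mk ⟨tate 0, tateGen 0 0 rfl, tateVal 0 _ rfl, tateGen_ne _ _ _, tateVal_ne _ _ _⟩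

lemma unit_eq : unit = cls (tate 0) (tateGen 0 0 rfl) (tateVal 0 _ rfl) :=
  (cls_eq_mk _).symm

lemma counit0_unit : counit0 unit = 1 := by
  rw [unit_eq, counit0_cls]; rfl

end HTn

/-- The underlying graded vector space `ℋ_• = ⨁ n, ℋ_n` of the Hodge–Tate Hopf algebra. -/
abbrev HTAlg : Type 1 := ⨁ n : ℕ, HTn n

namespace HTAlg

/-- The inclusion `ℋ_n → ℋ_•`. -/
abbrev incl (n : ℕ) : HTn n →ₗ[ℚ] HTAlg := DirectSum.lof ℚ ℕ HTn n

/-- The unit element of `ℋ_•`. -/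
def one : HTAlg := incl 0 HTn.unit

/-- The augmentation `ε : ℋ_• → ℚ`. -/
def counit : HTAlg →ₗ[ℚ] ℚ := HTn.counit0 ∘ₗ DirectSum.component ℚ ℕ HTn 0

/-- The comultiplication of `ℋ_•`, given on `ℋ_n` by `ν = ∑ ν_{kl}` over all `k + l = n`. -/
def comul : HTAlg →ₗ[ℚ] HTAlg ⊗[ℚ] HTAlg :=
  DirectSum.toModule ℚ ℕ _ fun n =>
    ∑ k : Fin (n + 1), TensorProduct.map (incl k) (incl (n - k)) ∘ₗ
      HTn.comulComp k (n - k) n (Nat.add_sub_cancel' (Nat.le_of_lt_succ k.2))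

lemma comul_incl (n : ℕ) (x : HTn n) :
    comul (incl n x) = ∑ k : Fin (n + 1), TensorProduct.map (incl k) (incl (n - k))
      (HTn.comulComp k (n - k) n (Nat.add_sub_cancel' (Nat.le_of_lt_succ k.2)) x) := by
  rw [comul, incl, DirectSum.toModule_lof, LinearMap.sum_apply]
  rfl

/-- The reduced comultiplication `ν̄ = ν - 1 ⊗ id - id ⊗ 1`; it is meant to be restricted
to positive degrees. -/
def redComul : HTAlg →ₗ[ℚ] HTAlg ⊗[ℚ] HTAlg :=
  comul - TensorProduct.mk ℚ HTAlg HTAlg one - (TensorProduct.mk ℚ HTAlg HTAlg).flip one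

/-- The subspace `Ker(ν̄|_{ℋ_n})` of `ℋ_n`. -/
def kerRedComul (n : ℕ) : Submodule ℚ (HTn n) := LinearMap.ker (redComul ∘ₗ incl n)

lemma mem_kerRedComul {n : ℕ} {x : HTn n} :
    x ∈ kerRedComul n ↔ comul (incl n x) = one ⊗ₜ incl n x + incl n x ⊗ₜ one := by
  rw [kerRedComul, LinearMap.mem_ker]
  change comul (incl n x) - one ⊗ₜ incl n x - incl n x ⊗ₜ one = 0 ↔ _
  rw [sub_sub, sub_eq_zero]

lemma counit_one : counit one = 1 := by
  change HTn.counit0 (DirectSum.component ℚ ℕ HTn 0 (incl 0 HTn.unit)) = 1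
  rw [DirectSum.component.lof_self, HTn.counit0_unit]

lemma counit_incl {n : ℕ} (hn : n ≠ 0) (x : HTn n) : counit (incl n x) = 0 := by
  change HTn.counit0 (DirectSum.component ℚ ℕ HTn 0 (incl n x)) = 0
  rw [DirectSum.component.of, dif_neg hn, map_zero]

end HTAlg

/-- A graded left comodule over the graded coalgebra `ℋ_•`. The coaction respects the degrees:
it maps degree `m` to the sum of the `ℋ_k ⊗ (degree m + k)`. -/
structure GrComod where
  V : Type
  [addCommGroup : AddCommGroup V]
  [module : Module ℚ V]
  gr : ℤ → Submodule ℚ V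
  gr_indep : iSupIndep gr
  gr_span : ⨆ m, gr m = ⊤
  coact : V →ₗ[ℚ] HTAlg ⊗[ℚ] V
  coact_gr : ∀ m, ∀ v ∈ gr m, coact v ∈
    ⨆ k : ℕ, LinearMap.range (TensorProduct.map (HTAlg.incl k) (gr (m + k)).subtype)
  counit_coact : ∀ v, TensorProduct.lid ℚ V (HTAlg.counit.rTensor V (coact v)) = v
  coassoc : ∀ v, TensorProduct.assoc ℚ HTAlg HTAlg V (HTAlg.comul.rTensor V (coact v)) =
    coact.lTensor HTAlg (coact v)

namespace GrComod

attribute [instance] addCommGroup module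

/-- A morphism of graded comodules. -/
structure Hom (M N : GrComod) where
  toLin : M.V →ₗ[ℚ] N.V
  map_gr : ∀ m, ∀ v ∈ M.gr m, toLin v ∈ N.gr m
  map_coact : ∀ v, N.coact (toLin v) = toLin.lTensor HTAlg (M.coact v)

def Hom.comp {M N P : GrComod} (g : Hom N P) (f : Hom M N) : Hom M P where
  toLin := g.toLin ∘ₗ f.toLin
  map_gr m v hv := g.map_gr m _ (f.map_gr m v hv)
  map_coact v := by
    rw [LinearMap.comp_apply, g.map_coact, f.map_coact, LinearMap.lTensor_comp_apply]

def Hom.id (M : GrComod) : Hom M M where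
  toLin := LinearMap.id
  map_gr _ _ hv := hv
  map_coact v := by simp

/-- An extension `0 → A → E → C → 0` of graded comodules. -/
structure Extension (C A : GrComod) where
  E : GrComod
  i : Hom A E
  p : Hom E C
  inj : Function.Injective i.toLin
  surj : Function.Surjective p.toLin
  exact : ∀ x, p.toLin x = 0 ↔ ∃ a, i.toLin a = x

/-- Isomorphism of extensions: an isomorphism of the middle terms inducing the identity on the
outer terms. -/
def Extension.Iso {C A : GrComod} (X Y : Extension C A) : Prop :=
  ∃ (g : Hom X.E Y.E) (h : Hom Y.E X.E),
    h.toLin ∘ₗ g.toLin = LinearMap.id ∧ g.toLin ∘ₗ h.toLin = LinearMap.id ∧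
    g.toLin ∘ₗ X.i.toLin = Y.i.toLin ∧ Y.p.toLin ∘ₗ g.toLin = X.p.toLin

instance Extension.setoid (C A : GrComod) : Setoid (Extension C A) where
  r := Extension.Iso
  iseqv :=
    { refl := fun X => ⟨Hom.id _, Hom.id _, rfl, rfl, rfl, rfl⟩
      symm := fun ⟨g, h, hg, gh, e1, e2⟩ => ⟨h, g, gh, hg,
        by rw [← e1, ← LinearMap.comp_assoc, hg, LinearMap.id_comp],
        by rw [← e2, LinearMap.comp_assoc, gh, LinearMap.comp_id]⟩
      trans := fun ⟨g, h, hg, gh, e1, e2⟩ ⟨g', h', hg', gh', e1', e2'⟩ =>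
        ⟨g'.comp g, h.comp h',
          LinearMap.ext fun x => by
            have a := LinearMap.congr_fun hg' (g.toLin x)
            have b := LinearMap.congr_fun hg x
            simp only [LinearMap.comp_apply, LinearMap.id_apply, Hom.comp] at a b ⊢
            rw [a, b],
          LinearMap.ext fun x => by
            have a := LinearMap.congr_fun gh (h'.toLin x)
            have b := LinearMap.congr_fun gh' x
            simp only [LinearMap.comp_apply, LinearMap.id_apply, Hom.comp] at a b ⊢
            rw [a, b],
          by rw [← e1', ← e1]; rfl,
          by rw [← e2, ← e2']; rfl⟩ }

/-- The Yoneda group `Ext^1(C, A)` of graded comodules, as a set. -/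
def Ext1 (C A : GrComod) : Type 1 := Quotient (Extension.setoid C A)

end GrComod

namespace HTStructure

/-- The basis of the one-dimensional space `gr^W_{-2n} ℚ(n)` given by its generator. -/
def tateBasis (n a : ℤ) (h : a = -2 * n) : Module.Basis Unit ℚ ((tate n).gr a) :=
  (Module.Basis.singleton Unit ℚ).map
    (LinearEquiv.ofLinearMap (LinearMap.toSpanSingleton ℚ _ (tateGen n a h)) (tateVal n a h)
      (LinearMap.ext fun x => smul_tateGen n a h x)
      (LinearMap.ext_ring (by simp [tateVal_gen])))

lemma tateBasis_apply (n a : ℤ) (h : a = -2 * n) : tateBasis n a h () = tateGen n a h := by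
  simp [tateBasis]

lemma tateBasis_coord (n a : ℤ) (h : a = -2 * n) :
    (tateBasis n a h).coord () = tateVal n a h := by
  refine (tateBasis n a h).ext fun i => ?_
  rw [tateBasis_apply, tateVal_gen, ← tateBasis_apply]
  simp

/-- The identity `ℚ(0) = ℚ(n)(-n)`. -/
def tateTwistHom (n : ℤ) : Hom (tate 0) ((tate n).twist (-n)) where
  toLin := (LinearMap.id : ℚ →ₗ[ℚ] ℚ)
  map_W k x hx := by
    change x ∈ (if -2 * n ≤ k + 2 * (-n) then (⊤ : Submodule ℚ ℚ) else ⊥)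
    have hx : x ∈ (if -2 * 0 ≤ k then (⊤ : Submodule ℚ ℚ) else ⊥) := hx
    split_ifs at hx ⊢ <;> first | exact hx | trivial | (exfalso; omega)
  map_F p z hz := by
    change LinearMap.baseChange ℂ (LinearMap.id : ℚ →ₗ[ℚ] ℚ) z ∈
      (if p + -n ≤ -n then (⊤ : Submodule ℂ (ℂ ⊗[ℚ] ℚ)) else ⊥)
    have hz : z ∈ (if p ≤ -0 then (⊤ : Submodule ℂ (ℂ ⊗[ℚ] ℚ)) else ⊥) := hz
    rw [LinearMap.baseChange_id]
    change z ∈ _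
    split_ifs at hz ⊢ <;> first | exact hz | trivial | (exfalso; omega)

lemma shiftCls_tate (n m m' : ℤ) (hm : m = n) (hm' : m' = n) (h : m + (0 : ℕ) = m') :
    (tate n).shiftCls m m' 0 h (tateGen n _ (by rw [hm])) (tateVal n _ (by rw [hm'])) =
      HTn.unit := by
  subst hm
  subst hm'
  rw [shiftCls_apply, HTn.unit_eq]
  refine (HTn.cls_hom (v := tateGen 0 0 rfl) (tateTwistHom m') rfl ?_).symm
  intro x
  induction x using Submodule.Quotient.induction_on with | H x => rfl

end HTStructure

namespace HTAlg

lemma comulComp_unit : HTn.comulComp 0 0 0 rfl HTn.unit = HTn.unit ⊗ₜ HTn.unit := by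
  conv_lhs => rw [HTn.unit_eq]
  rw [HTn.comulComp_cls 0 0 0 rfl (tate 0) (tateBasis 0 _ rfl)]
  rw [Fintype.sum_unique]
  congr 1
  · rw [HTn.unit_eq]
    exact congrArg _ (tateBasis_coord _ _ _)
  · refine Eq.trans ?_ (shiftCls_tate 0 _ _ rfl rfl rfl)
    congr 2
    exact tateBasis_apply _ _ _

lemma comul_one : comul one = one ⊗ₜ one := by
  rw [one, comul_incl]
  rw [Fin.sum_univ_one]
  change TensorProduct.map (incl 0) (incl 0) (HTn.comulComp 0 0 0 rfl HTn.unit) = _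
  rw [comulComp_unit]
  rfl

end HTAlg

namespace GrComod

open HTAlg

/-- The degree `m` part of `ℚ` placed in degree `n`. -/
def line (n m : ℤ) : Submodule ℚ ℚ := if m = n then ⊤ else ⊥

lemma line_self (n : ℤ) : line n n = ⊤ := if_pos rfl

lemma line_ne {n m : ℤ} (h : m ≠ n) : line n m = ⊥ := if_neg h

lemma line_indep (n : ℤ) : iSupIndep (line n) := by
  intro i
  by_cases h : i = n
  · have : (⨆ j, ⨆ (_ : j ≠ i), line n j) = ⊥ := by
      refine le_bot_iff.1 (iSup₂_le fun j hj => ?_)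
      rw [line_ne (by rwa [← h])]
    rw [this]
    exact disjoint_bot_right
  · rw [line_ne h]
    exact disjoint_bot_left

lemma line_prod_indep {n : ℤ} (hn : n ≠ 0) : iSupIndep fun m => (line 0 m).prod (line n m) := by
  intro i
  rw [Submodule.disjoint_def]
  rintro ⟨a, b⟩ ⟨ha, hb⟩ hx
  have e0 : i = 0 → a = 0 := by
    rintro rfl
    have : (⨆ j, ⨆ (_ : j ≠ 0), (line 0 j).prod (line n j)) ≤ (⊥ : Submodule ℚ ℚ).prod ⊤ := by
      refine iSup₂_le fun j hj => ?_
      rw [line_ne hj]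
      exact Submodule.prod_mono le_rfl le_top
    exact (this hx).1
  have e1 : i = n → b = 0 := by
    rintro rfl
    have : (⨆ j, ⨆ (_ : j ≠ i), (line 0 j).prod (line i j)) ≤ (⊤ : Submodule ℚ ℚ).prod ⊥ := by
      refine iSup₂_le fun j hj => ?_
      rw [line_ne hj]
      exact Submodule.prod_mono le_top le_rfl
    exact (this hx).2
  have f0 : i ≠ 0 → a = 0 := by
    intro h
    have ha : a ∈ line 0 i := ha
    rwa [line_ne h] at ha
  have f1 : i ≠ n → b = 0 := by
    intro h
    have hb : b ∈ line n i := hb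
    rwa [line_ne h] at hb
  exact Prod.ext (by by_cases h : i = 0 <;> tauto) (by by_cases h : i = n <;> tauto)

lemma line_prod_span (n : ℤ) : ⨆ m, (line 0 m).prod (line n m) = ⊤ := by
  rw [← top_le_iff]
  rintro ⟨a, b⟩ _
  have e : ((a, b) : ℚ × ℚ) = (a, 0) + (0, b) := by simp
  rw [e]
  refine add_mem (Submodule.mem_iSup_of_mem 0 (Submodule.mem_prod.2 ⟨?_, zero_mem _⟩))
    (Submodule.mem_iSup_of_mem n (Submodule.mem_prod.2 ⟨zero_mem _, ?_⟩))
  · rw [line_self]; trivial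
  · rw [line_self]; trivial

lemma incl_tmul_mem {V : Type} [AddCommGroup V] [Module ℚ V] (p : ℤ → Submodule ℚ V) {m r : ℤ}
    (k : ℕ) (h : m + k = r) (x : HTn k) {v : V} (hv : v ∈ p r) :
    incl k x ⊗ₜ[ℚ] v ∈
      ⨆ k : ℕ, LinearMap.range (TensorProduct.map (incl k) (p (m + k)).subtype) := by
  subst h
  exact Submodule.mem_iSup_of_mem k (LinearMap.mem_range.2 ⟨x ⊗ₜ ⟨v, hv⟩, rfl⟩)

/-- The trivial one-dimensional comodule `ℚ_(n)`, placed in degree `n`, with coaction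
`v ↦ 1 ⊗ v`. -/
def triv (n : ℤ) : GrComod where
  V := ℚ
  gr := line n
  gr_indep := line_indep n
  gr_span := top_le_iff.1 (le_iSup_of_le n (line_self n).ge)
  coact := TensorProduct.mk ℚ HTAlg ℚ one
  coact_gr m v hv :=
    incl_tmul_mem (line n) 0 (by simp) HTn.unit hv
  counit_coact v := by
    simp [counit_one]
  coassoc v := by
    simp [comul_one]

/-- For `γ ∈ Ker(ν̄|_{ℋ_n})`, a `1`-cocycle of the reduced cobar complex with coefficients in
`ℚ_(n)`, the comodule `ℚ e₀ ⊕ ℚ eₙ` with coaction `e₀ ↦ 1 ⊗ e₀ + γ ⊗ eₙ`, `eₙ ↦ 1 ⊗ eₙ`. -/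
def cobar (n : ℕ) (hn : 0 < n) (γ : HTn n) (hγ : γ ∈ kerRedComul n) : GrComod where
  V := ℚ × ℚ
  gr m := (line 0 m).prod (line n m)
  gr_indep := line_prod_indep (by omega)
  gr_span := line_prod_span n
  coact := TensorProduct.mk ℚ HTAlg (ℚ × ℚ) one +
    TensorProduct.mk ℚ HTAlg (ℚ × ℚ) (incl n γ) ∘ₗ LinearMap.inr ℚ ℚ ℚ ∘ₗ LinearMap.fst ℚ ℚ ℚ
  coact_gr m v hv := by
    refine add_mem (incl_tmul_mem (fun m => (line 0 m).prod (line n m)) 0 (by simp)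
      HTn.unit hv) ?_
    have hv1 : v.1 ∈ line 0 m := (Submodule.mem_prod.1 hv).1
    by_cases h : m = 0
    · subst h
      refine incl_tmul_mem (fun m => (line 0 m).prod (line n m)) n (zero_add _) γ
        (Submodule.mem_prod.2 ⟨zero_mem _, ?_⟩)
      rw [line_self]; trivial
    · rw [line_ne h, Submodule.mem_bot] at hv1
      have hz : ((0, 0) : ℚ × ℚ) = 0 := rfl
      simp [hv1, hz]
  counit_coact v := by
    simp [counit_one, counit_incl hn.ne']
  coassoc v := by
    have h := mem_kerRedComul.1 hγ
    have hz : ((0, 0) : ℚ × ℚ) = 0 := rfl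
    simp [comul_one, h, TensorProduct.add_tmul, hz]
    abel

/-- The extension `0 → ℚ_(n) → cobar γ → ℚ_(0) → 0` of graded comodules attached to the cocycle
`γ`. -/
def cobarExtension (n : ℕ) (hn : 0 < n) (γ : HTn n) (hγ : γ ∈ kerRedComul n) :
    Extension (triv 0) (triv n) where
  E := cobar n hn γ hγ
  i :=
    { toLin := LinearMap.inr ℚ ℚ ℚ
      map_gr := fun m v hv => ⟨zero_mem _, hv⟩
      map_coact := fun v => by
        change one ⊗ₜ[ℚ] ((0, v) : ℚ × ℚ) + incl n γ ⊗ₜ[ℚ] ((0, 0) : ℚ × ℚ) =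
          one ⊗ₜ[ℚ] ((0, v) : ℚ × ℚ)
        rw [show ((0, 0) : ℚ × ℚ) = 0 from rfl, TensorProduct.tmul_zero, add_zero] }
  p :=
    { toLin := LinearMap.fst ℚ ℚ ℚ
      map_gr := fun m v hv => hv.1
      map_coact := fun (v : ℚ × ℚ) => by
        change one ⊗ₜ[ℚ] v.1 = (LinearMap.fst ℚ ℚ ℚ).lTensor HTAlg
          (one ⊗ₜ[ℚ] v + incl n γ ⊗ₜ[ℚ] ((0, v.1) : ℚ × ℚ))
        simp }
  inj := show Function.Injective (LinearMap.inr ℚ ℚ ℚ) from LinearMap.inr_injective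
  surj := show Function.Surjective (LinearMap.fst ℚ ℚ ℚ) from LinearMap.fst_surjective
  exact x := by
    constructor
    · intro h
      exact ⟨x.2, Prod.ext h.symm rfl⟩
    · rintro ⟨a, rfl⟩
      rfl

end GrComod

namespace HTStructure

open HTAlg

/-- The matrix coefficient in `ℋ_•` of a vector `v` in `gr^W_{-2m} H` and a covector `f` on
`gr^W_{-2n} H`: the class of the framed structure `(H, v, f)(-m)` if `m ≤ n`, and `0` otherwise. -/
def coef (H : HTStructure) (m n : ℤ) :
    H.gr (-2 * m) →ₗ[ℚ] (H.gr (-2 * n) →ₗ[ℚ] ℚ) →ₗ[ℚ] HTAlg :=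
  if h : m ≤ n then (H.shiftCls m n (n - m).toNat (by omega)).compr₂ (incl (n - m).toNat) else 0

lemma coef_eq (H : HTStructure) (m n : ℤ) (d : ℕ) (h : m + d = n) (v : H.gr (-2 * m))
    (f : H.gr (-2 * n) →ₗ[ℚ] ℚ) : H.coef m n v f = incl d (H.shiftCls m n d h v f) := by
  obtain rfl : d = (n - m).toNat := by omega
  rw [coef, dif_pos (by omega)]
  rfl

lemma coef_lt (H : HTStructure) (m n : ℤ) (h : n < m) : H.coef m n = 0 := dif_neg (by omega)

lemma coef_hom {H H' : HTStructure} (g : Hom H H') (m n : ℤ) (v : H.gr (-2 * m))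
    (f : H'.gr (-2 * n) →ₗ[ℚ] ℚ) : H.coef m n v (f ∘ₗ g.gr _) = H'.coef m n (g.gr _ v) f := by
  by_cases h : m ≤ n
  · obtain ⟨d, hd⟩ := Int.le.dest h
    rw [coef_eq H m n d hd, coef_eq H' m n d hd, shiftCls_hom]
  · rw [coef_lt _ _ _ (by omega), coef_lt _ _ _ (by omega)]; rfl

lemma counit_coef_self (H : HTStructure) (m : ℤ) (v : H.gr (-2 * m))
    (f : H.gr (-2 * m) →ₗ[ℚ] ℚ) : counit (H.coef m m v f) = f v := by
  rw [coef_eq H m m 0 (by simp), shiftCls_apply]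
  change HTn.counit0 (DirectSum.component ℚ ℕ HTn 0 (incl 0 _)) = _
  rw [DirectSum.component.lof_self, HTn.counit0_cls]
  rw [LinearMap.comp_apply]
  congr 1
  induction v using Submodule.Quotient.induction_on with | H x => rfl

lemma counit_coef_ne (H : HTStructure) {m n : ℤ} (h : m ≠ n) (v : H.gr (-2 * m))
    (f : H.gr (-2 * n) →ₗ[ℚ] ℚ) : counit (H.coef m n v f) = 0 := by
  by_cases h' : m ≤ n
  · obtain ⟨d, hd⟩ := Int.le.dest h'
    rw [coef_eq H m n d hd, counit_incl (by omega)]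
  · rw [coef_lt _ _ _ (by omega)]; simp

lemma gr_eq_zero_of_bot {H : HTStructure} {k : ℤ} (h : H.W k = ⊥) (x : H.gr k) : x = 0 := by
  induction x using Submodule.Quotient.induction_on with
  | H x =>
    have : x = 0 := Subtype.ext (by simpa [h] using x.2)
    rw [this]; rfl

lemma gr_eq_zero_of_top {H : HTStructure} {k : ℤ} (h : H.W (k - 1) = ⊤) (x : H.gr k) : x = 0 := by
  induction x using Submodule.Quotient.induction_on with
  | H x =>
    rw [Submodule.Quotient.mk_eq_zero]
    change x.1 ∈ H.W (k - 1)
    rw [h]; trivial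

lemma finite_weights (H : HTStructure) : {n : ℤ | ∃ x : H.gr (-2 * n), x ≠ 0}.Finite := by
  obtain ⟨a, ha⟩ := H.W_bot
  obtain ⟨b, hb⟩ := H.W_top
  refine (Set.finite_Icc (-|b| - 1) (|a|)).subset ?_
  rintro n ⟨x, hx⟩
  have h1 : a < -2 * n := by
    by_contra hc
    exact hx (gr_eq_zero_of_bot (le_bot_iff.1 (ha ▸ H.W_mono (by omega : -2 * n ≤ a))) x)
  have h2 : -2 * n - 1 < b := by
    by_contra hc
    exact hx (gr_eq_zero_of_top (top_le_iff.1 (hb ▸ H.W_mono (by omega : b ≤ -2 * n - 1))) x)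
  have := neg_abs_le a
  have := le_abs_self a
  have := neg_abs_le b
  have := le_abs_self b
  have := abs_nonneg a
  have := abs_nonneg b
  constructor <;> omega

/-- The finite set of all `n` with `gr^W_{-2n} H ≠ 0`. -/
def weights (H : HTStructure) : Finset ℤ := H.finite_weights.toFinset

lemma gr_eq_zero {H : HTStructure} {n : ℤ} (h : n ∉ H.weights) (x : H.gr (-2 * n)) : x = 0 := by
  by_contra hx
  exact h (H.finite_weights.mem_toFinset.2 ⟨x, hx⟩)

/-- The chosen basis of `gr^W_{-2n} H`. -/
abbrev grBasis (H : HTStructure) (n : ℤ) := Module.finBasis ℚ (H.gr (-2 * n))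

/-- The vector space `ω(H) = ⨁ n, gr^W_{-2n} H`, where `gr^W_{-2n} H` is identified with
`Hom(ℚ(n), gr^W_{-2n} H)`. -/
def omegaV (H : HTStructure) : Type := ⨁ n : ℤ, H.gr (-2 * n)

instance (H : HTStructure) : AddCommGroup H.omegaV :=
  inferInstanceAs (AddCommGroup (⨁ n : ℤ, H.gr (-2 * n)))

instance (H : HTStructure) : Module ℚ H.omegaV :=
  inferInstanceAs (Module ℚ (⨁ n : ℤ, H.gr (-2 * n)))

/-- The inclusion `gr^W_{-2n} H → ω(H)`. -/
def omegaIncl (H : HTStructure) (n : ℤ) : H.gr (-2 * n) →ₗ[ℚ] H.omegaV :=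
  DirectSum.lof ℚ ℤ (fun n => H.gr (-2 * n)) n

/-- The projection `ω(H) → gr^W_{-2n} H`. -/
def omegaProj (H : HTStructure) (n : ℤ) : H.omegaV →ₗ[ℚ] H.gr (-2 * n) :=
  DirectSum.component ℚ ℤ (fun n => H.gr (-2 * n)) n

/-- The linear map out of `ω(H)` given by its restrictions to the `gr^W_{-2n} H`. -/
def omegaDesc (H : HTStructure) {M : Type*} [AddCommGroup M] [Module ℚ M]
    (f : ∀ n : ℤ, H.gr (-2 * n) →ₗ[ℚ] M) : H.omegaV →ₗ[ℚ] M :=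
  DirectSum.toModule ℚ ℤ M f

lemma omegaProj_incl (H : HTStructure) (n : ℤ) (v : H.gr (-2 * n)) :
    H.omegaProj n (H.omegaIncl n v) = v :=
  DirectSum.component.lof_self (R := ℚ) (M := fun n => H.gr (-2 * n)) n v

lemma omegaProj_incl_ne (H : HTStructure) {m n : ℤ} (h : m ≠ n) (v : H.gr (-2 * m)) :
    H.omegaProj n (H.omegaIncl m v) = 0 :=
  (DirectSum.component.of (R := ℚ) (M := fun n => H.gr (-2 * n)) n m v).trans (dif_neg h)

lemma omegaDesc_incl (H : HTStructure) {M : Type*} [AddCommGroup M] [Module ℚ M]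
    (f : ∀ n : ℤ, H.gr (-2 * n) →ₗ[ℚ] M) (n : ℤ) (v : H.gr (-2 * n)) :
    H.omegaDesc f (H.omegaIncl n v) = f n v :=
  DirectSum.toModule_lof (φ := f) ℚ n v

lemma omegaV_ext {H : HTStructure} {M : Type*} [AddCommGroup M] [Module ℚ M]
    {f g : H.omegaV →ₗ[ℚ] M} (h : ∀ m (v : H.gr (-2 * m)),
      f (H.omegaIncl m v) = g (H.omegaIncl m v)) (x : H.omegaV) : f x = g x :=
  LinearMap.congr_fun (DirectSum.linearMap_ext ℚ fun m => LinearMap.ext fun v => h m v :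
    (show (⨁ n : ℤ, H.gr (-2 * n)) →ₗ[ℚ] M from f) = g) x

lemma omegaV_induction {H : HTStructure} {P : H.omegaV → Prop} (x : H.omegaV) (h0 : P 0)
    (h1 : ∀ m v, P (H.omegaIncl m v)) (h2 : ∀ x y, P x → P y → P (x + y)) : P x :=
  DirectSum.induction_on (motive := P) x h0 (fun m v => h1 m v) h2

/-- `v ↦ ∑ i, [H, v, b_i^∨](-m) ⊗ b_i` for a basis `b` of `gr^W_{-2n} H`. -/
def coactTerm (H : HTStructure) (m n : ℤ) : H.gr (-2 * m) →ₗ[ℚ] HTAlg ⊗[ℚ] H.omegaV :=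
  ∑ i, (TensorProduct.mk ℚ HTAlg H.omegaV).flip (H.omegaIncl n (H.grBasis n i)) ∘ₗ
    (H.coef m n).flip ((H.grBasis n).coord i)

lemma coactTerm_apply (H : HTStructure) (m n : ℤ) (v : H.gr (-2 * m)) :
    H.coactTerm m n v = ∑ i, H.coef m n v ((H.grBasis n).coord i) ⊗ₜ[ℚ]
      H.omegaIncl n (H.grBasis n i) := by
  rw [coactTerm, LinearMap.sum_apply]
  rfl

/-- The coaction of `ℋ_•` on `ω(H)`, with matrix coefficients `coef`. -/
def omegaCoact (H : HTStructure) : H.omegaV →ₗ[ℚ] HTAlg ⊗[ℚ] H.omegaV :=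
  H.omegaDesc fun m => ∑ n ∈ H.weights, H.coactTerm m n

lemma omegaCoact_incl (H : HTStructure) (m : ℤ) (v : H.gr (-2 * m)) :
    H.omegaCoact (H.omegaIncl m v) = ∑ n ∈ H.weights, H.coactTerm m n v := by
  rw [omegaCoact, omegaDesc_incl, LinearMap.sum_apply]

lemma coactTerm_zero {H : HTStructure} {n : ℤ} (h : n ∉ H.weights) (m : ℤ)
    (v : H.gr (-2 * m)) : H.coactTerm m n v = 0 := by
  rw [coactTerm_apply]
  refine Finset.sum_eq_zero fun i _ => ?_
  rw [gr_eq_zero h (H.grBasis n i), map_zero, TensorProduct.tmul_zero]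

lemma omegaCoact_incl' (H : HTStructure) (m : ℤ) (v : H.gr (-2 * m)) (S : Finset ℤ)
    (hS : H.weights ⊆ S) :
    H.omegaCoact (H.omegaIncl m v) = ∑ n ∈ S, H.coactTerm m n v := by
  rw [omegaCoact_incl]
  exact Finset.sum_subset hS fun n _ hn => coactTerm_zero hn m v

/-- The identity `H(-m)(-k) = H(-r)` for `r = m + k`. -/
def twistTwistHom (H : HTStructure) (m k r : ℤ) (h : m + k = r) :
    Hom ((H.twist (-m)).twist (-k)) (H.twist (-r)) where
  toLin := (LinearMap.id : H.V →ₗ[ℚ] H.V)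
  map_W j x hx := by
    subst h
    change x ∈ H.W (j + 2 * -(m + k))
    have hx : x ∈ H.W (j + 2 * -k + 2 * -m) := hx
    rwa [show j + 2 * -(m + k) = j + 2 * -k + 2 * -m by ring]
  map_F p z hz := by
    subst h
    change LinearMap.baseChange ℂ (LinearMap.id : H.V →ₗ[ℚ] H.V) z ∈ H.F (p + -(m + k))
    have hz : z ∈ H.F (p + -k + -m) := hz
    rw [LinearMap.baseChange_id, show p + -(m + k) = p + -k + -m by ring]
    exact hz

lemma shiftCls_twist (H : HTStructure) (m r n : ℤ) (k d l : ℕ) (hk : m + k = r) (hd : m + d = n)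
    (hl : r + l = n) (hkl : (k : ℤ) + l = d) (x : H.gr (-2 * r)) (f : H.gr (-2 * n) →ₗ[ℚ] ℚ) :
    (H.twist (-m)).shiftCls k d l hkl (H.toTwist (-m) (by rw [← hk]; ring) x)
      (f ∘ₗ H.ofTwist (-m) (by rw [← hd]; ring)) = H.shiftCls r n l hl x f := by
  rw [shiftCls_apply, shiftCls_apply]
  refine HTn.cls_hom (H.twistTwistHom m k r hk) ?_ ?_
  · induction x using Submodule.Quotient.induction_on with | H x => rfl
  · intro y
    induction y using Submodule.Quotient.induction_on with | H y => rfl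

/-- The basis of `gr^W_{-2k} H(-m)` corresponding to the basis of `gr^W_{-2(m+k)} H`. -/
def twistBasis (H : HTStructure) (m r : ℤ) (k : ℕ) (hk : m + k = r) :
    Module.Basis (Fin (Module.finrank ℚ (H.gr (-2 * r)))) ℚ ((H.twist (-m)).gr (-2 * (k : ℤ))) :=
  (H.grBasis r).map (LinearEquiv.ofLinearMap
    (H.toTwist (-m) (a := -2 * r) (b := -2 * (k : ℤ)) (by rw [← hk]; ring))
    (H.ofTwist (-m) (by rw [← hk]; ring))
    (LinearMap.ext fun x => toTwist_ofTwist H _ _ x)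
    (LinearMap.ext fun x => ofTwist_toTwist H _ _ x))

lemma comul_coef (H : HTStructure) (m n : ℤ) (v : H.gr (-2 * m)) (f : H.gr (-2 * n) →ₗ[ℚ] ℚ) :
    comul (H.coef m n v f) = ∑ r ∈ H.weights, ∑ i,
      H.coef m r v ((H.grBasis r).coord i) ⊗ₜ[ℚ] H.coef r n (H.grBasis r i) f := by
  set T : ℤ → HTAlg ⊗[ℚ] HTAlg := fun r => ∑ i,
      H.coef m r v ((H.grBasis r).coord i) ⊗ₜ[ℚ] H.coef r n (H.grBasis r i) f with hT
  have T0 : ∀ r, r ∉ H.weights → T r = 0 := fun r hr =>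
    Finset.sum_eq_zero fun i _ => by
      rw [gr_eq_zero hr (H.grBasis r i), map_zero, LinearMap.zero_apply, TensorProduct.tmul_zero]
  have T1 : ∀ r, r < m → T r = 0 := fun r hr =>
    Finset.sum_eq_zero fun i _ => by
      rw [coef_lt H m r hr, LinearMap.zero_apply, LinearMap.zero_apply, TensorProduct.zero_tmul]
  have T2 : ∀ r, n < r → T r = 0 := fun r hr =>
    Finset.sum_eq_zero fun i _ => by
      rw [coef_lt H r n hr, LinearMap.zero_apply, LinearMap.zero_apply, TensorProduct.tmul_zero]
  change _ = ∑ r ∈ H.weights, T r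
  by_cases h : m ≤ n
  · obtain ⟨d, hd⟩ := Int.le.dest h
    have step : ∀ k : Fin (d + 1), TensorProduct.map (incl k) (incl (d - k))
        (HTn.comulComp k (d - k) d (Nat.add_sub_cancel' (Nat.le_of_lt_succ k.2))
          (H.shiftCls m n d hd v f)) = T (m + (k : ℕ)) := by
      intro k
      have hk : (k : ℕ) ≤ d := Nat.le_of_lt_succ k.2
      rw [shiftCls_apply, HTn.comulComp_cls k (d - k) d (Nat.add_sub_cancel' hk) (H.twist (-m))
        (H.twistBasis m (m + (k : ℕ)) k rfl), map_sum]
      refine Finset.sum_congr rfl fun i _ => ?_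
      rw [TensorProduct.map_tmul, coef_eq H m (m + (k : ℕ)) k rfl,
        coef_eq H (m + (k : ℕ)) n (d - k) (by omega)]
      congr 2
      rw [← H.shiftCls_twist m (m + (k : ℕ)) n k d (d - k) rfl hd (by omega) (by omega)]
      rfl
    rw [coef_eq H m n d hd, comul_incl, Finset.sum_congr rfl fun k _ => step k]
    have inj : Function.Injective fun k : Fin (d + 1) => m + ((k : ℕ) : ℤ) := by
      intro a b hab
      have : m + ((a : ℕ) : ℤ) = m + ((b : ℕ) : ℤ) := hab
      exact Fin.ext (by omega)
    rw [← Finset.sum_image (f := T) (g := fun k : Fin (d + 1) => m + ((k : ℕ) : ℤ))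
      (fun a _ b _ hab => inj hab)]
    refine Eq.trans ?_ (Finset.sum_subset (Finset.subset_union_left (s₁ := H.weights)
      (s₂ := Finset.univ.image fun k : Fin (d + 1) => m + ((k : ℕ) : ℤ)))
      (fun r _ hr => T0 r hr)).symm
    refine Finset.sum_subset Finset.subset_union_right fun r _ hr => ?_
    by_cases h1 : r < m
    · exact T1 r h1
    by_cases h2 : n < r
    · exact T2 r h2
    · exfalso
      refine hr (Finset.mem_image.2 ⟨⟨(r - m).toNat, by omega⟩, Finset.mem_univ _, ?_⟩)
      simp only
      omega
  · rw [coef_lt H m n (by omega)]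
    simp only [LinearMap.zero_apply, map_zero]
    symm
    refine Finset.sum_eq_zero fun r _ => ?_
    by_cases h1 : r < m
    · exact T1 r h1
    · exact T2 r (by omega)

lemma sum_four {M : Type*} [AddCommMonoid M] (S : Finset ℤ) (d : ℤ → ℕ)
    (G : ∀ n, Fin (d n) → ∀ r, Fin (d r) → M) :
    ∑ n ∈ S, ∑ j, ∑ r ∈ S, ∑ i, G n j r i = ∑ r ∈ S, ∑ i, ∑ n ∈ S, ∑ j, G n j r i := by
  have h1 : ∀ n ∈ S, ∑ j, ∑ r ∈ S, ∑ i, G n j r i = ∑ r ∈ S, ∑ j, ∑ i, G n j r i :=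
    fun n _ => Finset.sum_comm
  rw [Finset.sum_congr rfl h1, Finset.sum_comm]
  refine Finset.sum_congr rfl fun r _ => ?_
  rw [Finset.sum_comm (s := Finset.univ) (t := S)]
  exact Finset.sum_congr rfl fun n _ => Finset.sum_comm

lemma omegaCoact_coassoc_incl (H : HTStructure) (m : ℤ) (v : H.gr (-2 * m)) :
    TensorProduct.assoc ℚ HTAlg HTAlg H.omegaV
      (comul.rTensor H.omegaV (H.omegaCoact (H.omegaIncl m v))) =
      H.omegaCoact.lTensor HTAlg (H.omegaCoact (H.omegaIncl m v)) := by
  have h1 : TensorProduct.assoc ℚ HTAlg HTAlg H.omegaV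
      (comul.rTensor H.omegaV (H.omegaCoact (H.omegaIncl m v))) =
      ∑ n ∈ H.weights, ∑ j, ∑ r ∈ H.weights, ∑ i,
        H.coef m r v ((H.grBasis r).coord i) ⊗ₜ[ℚ]
          (H.coef r n (H.grBasis r i) ((H.grBasis n).coord j) ⊗ₜ[ℚ]
            H.omegaIncl n (H.grBasis n j)) := by
    rw [omegaCoact_incl]
    simp only [coactTerm_apply, map_sum, LinearMap.rTensor_tmul]
    refine Finset.sum_congr rfl fun n _ => Finset.sum_congr rfl fun j _ => ?_
    rw [comul_coef]
    simp only [TensorProduct.sum_tmul, map_sum, TensorProduct.assoc_tmul]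
  have h2 : H.omegaCoact.lTensor HTAlg (H.omegaCoact (H.omegaIncl m v)) =
      ∑ r ∈ H.weights, ∑ i, ∑ n ∈ H.weights, ∑ j,
        H.coef m r v ((H.grBasis r).coord i) ⊗ₜ[ℚ]
          (H.coef r n (H.grBasis r i) ((H.grBasis n).coord j) ⊗ₜ[ℚ]
            H.omegaIncl n (H.grBasis n j)) := by
    rw [omegaCoact_incl]
    simp only [coactTerm_apply, map_sum, LinearMap.lTensor_tmul]
    refine Finset.sum_congr rfl fun n _ => Finset.sum_congr rfl fun j _ => ?_
    rw [omegaCoact_incl]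
    simp only [coactTerm_apply, TensorProduct.tmul_sum]
  rw [h1, h2]
  exact sum_four H.weights (fun n => Module.finrank ℚ (H.gr (-2 * n))) _

lemma omegaCoact_coassoc (H : HTStructure) (x : H.omegaV) :
    TensorProduct.assoc ℚ HTAlg HTAlg H.omegaV (comul.rTensor H.omegaV (H.omegaCoact x)) =
      H.omegaCoact.lTensor HTAlg (H.omegaCoact x) := by
  induction x using omegaV_induction with
  | h0 => simp only [map_zero]
  | h1 m v => exact H.omegaCoact_coassoc_incl m v
  | h2 x y hx hy => simp only [map_add, hx, hy]

/-- The graded `ℋ_•`-comodule `ω(H)` of a Hodge–Tate structure `H`. -/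
def omega (H : HTStructure) : GrComod where
  V := H.omegaV
  gr m := LinearMap.range (H.omegaIncl m)
  gr_indep m := by
    rw [Submodule.disjoint_def]
    rintro _ ⟨v, rfl⟩ hx
    have : (⨆ j, ⨆ (_ : j ≠ m), LinearMap.range (H.omegaIncl j)) ≤
        LinearMap.ker (H.omegaProj m) := by
      refine iSup₂_le fun j hj => ?_
      rintro _ ⟨w, rfl⟩
      rw [LinearMap.mem_ker, omegaProj_incl_ne H hj]
    have := this hx
    rw [LinearMap.mem_ker, omegaProj_incl] at this
    rw [this, map_zero]
  gr_span := by
    rw [← top_le_iff]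
    rintro x _
    induction x using omegaV_induction with
    | h0 => exact zero_mem _
    | h1 m v => exact Submodule.mem_iSup_of_mem m ⟨v, rfl⟩
    | h2 x y hx hy => exact add_mem (hx trivial) (hy trivial)
  coact := H.omegaCoact
  coact_gr m := by
    rintro _ ⟨v, rfl⟩
    rw [omegaCoact_incl]
    refine sum_mem fun n _ => ?_
    rw [coactTerm_apply]
    refine sum_mem fun i _ => ?_
    by_cases h : m ≤ n
    · obtain ⟨d, hd⟩ := Int.le.dest h
      rw [coef_eq H m n d hd]
      exact GrComod.incl_tmul_mem (fun m => LinearMap.range (H.omegaIncl m)) d hd _ ⟨_, rfl⟩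
    · rw [coef_lt H m n (by omega), LinearMap.zero_apply, LinearMap.zero_apply,
        TensorProduct.zero_tmul]
      exact zero_mem _
  counit_coact := by
    refine omegaV_ext (H := H) (f := (TensorProduct.lid ℚ H.omegaV).toLinearMap ∘ₗ
      counit.rTensor H.omegaV ∘ₗ H.omegaCoact) (g := LinearMap.id) fun m v => ?_
    change TensorProduct.lid ℚ H.omegaV (counit.rTensor H.omegaV (H.omegaCoact _)) = _
    rw [omegaCoact_incl, map_sum, map_sum, LinearMap.id_apply]
    simp only [coactTerm_apply, map_sum, LinearMap.rTensor_tmul, TensorProduct.lid_tmul]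
    rw [Finset.sum_eq_single m]
    · simp only [counit_coef_self, ← map_smul, ← map_sum]
      congr 1
      exact (H.grBasis m).sum_repr v
    · intro n _ hn
      refine Finset.sum_eq_zero fun i _ => ?_
      rw [counit_coef_ne H (Ne.symm hn), zero_smul]
    · intro hm
      refine Finset.sum_eq_zero fun i _ => ?_
      rw [gr_eq_zero hm (H.grBasis m i), map_zero, smul_zero]
  coassoc := H.omegaCoact_coassoc

/-- The linear map `ω(H) → ω(H')` induced by a morphism. -/
def Hom.omegaLin {H H' : HTStructure} (g : Hom H H') : H.omegaV →ₗ[ℚ] H'.omegaV :=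
  H.omegaDesc fun n => H'.omegaIncl n ∘ₗ g.gr (-2 * n)

lemma Hom.omegaLin_incl {H H' : HTStructure} (g : Hom H H') (m : ℤ) (v : H.gr (-2 * m)) :
    g.omegaLin (H.omegaIncl m v) = H'.omegaIncl m (g.gr _ v) := by
  rw [Hom.omegaLin, omegaDesc_incl]; rfl

lemma Hom.omegaProj_lin {H H' : HTStructure} (g : Hom H H') (m : ℤ) (x : H.omegaV) :
    H'.omegaProj m (g.omegaLin x) = g.gr _ (H.omegaProj m x) := by
  refine omegaV_ext (f := H'.omegaProj m ∘ₗ g.omegaLin) (g := g.gr _ ∘ₗ H.omegaProj m)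
    (fun n v => ?_) x
  rw [LinearMap.comp_apply, LinearMap.comp_apply, g.omegaLin_incl]
  by_cases h : n = m
  · subst h
    rw [omegaProj_incl, omegaProj_incl]
  · rw [omegaProj_incl_ne _ h, omegaProj_incl_ne _ h, map_zero]

lemma Hom.omegaCoact_lin {H H' : HTStructure} (g : Hom H H') (x : H.omegaV) :
    H'.omegaCoact (g.omegaLin x) = g.omegaLin.lTensor HTAlg (H.omegaCoact x) := by
  refine omegaV_ext (f := H'.omegaCoact ∘ₗ g.omegaLin)
    (g := g.omegaLin.lTensor HTAlg ∘ₗ H.omegaCoact) (fun m v => ?_) x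
  rw [LinearMap.comp_apply, LinearMap.comp_apply, g.omegaLin_incl,
    omegaCoact_incl' H m v (H.weights ∪ H'.weights) Finset.subset_union_left,
    omegaCoact_incl' H' m _ (H.weights ∪ H'.weights) Finset.subset_union_right, map_sum]
  refine Finset.sum_congr rfl fun n _ => ?_
  rw [coactTerm_apply, coactTerm_apply, map_sum]
  have key := sum_coord_tmul (H.grBasis n) (H'.grBasis n) (g.gr _) (H.coef m n v)
    (H'.omegaIncl n)
  simp only [coef_hom] at key
  rw [← key]
  refine Finset.sum_congr rfl fun i _ => ?_
  rw [LinearMap.lTensor_tmul, g.omegaLin_incl]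

/-- The functor `ω` on morphisms. -/
def Hom.omega {H H' : HTStructure} (g : Hom H H') : GrComod.Hom H.omega H'.omega where
  toLin := g.omegaLin
  map_gr m := by
    rintro _ ⟨v, rfl⟩
    exact ⟨g.gr _ v, (g.omegaLin_incl m v).symm⟩
  map_coact := g.omegaCoact_lin

end HTStructure

namespace HTStructure

open HTAlg

/-- An extension `0 → A → E → C → 0` of Hodge–Tate structures. -/
structure Extension (C A : HTStructure) where
  E : HTStructure
  i : Hom A E
  p : Hom E C
  inj : Function.Injective i.toLin
  surj : Function.Surjective p.toLin
  exact : ∀ x, p.toLin x = 0 ↔ ∃ a, i.toLin a = x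

/-- Isomorphism of extensions: an isomorphism of the middle terms inducing the identity on the
outer terms. -/
def Extension.Iso {C A : HTStructure} (X Y : Extension C A) : Prop :=
  ∃ (g : Hom X.E Y.E) (h : Hom Y.E X.E),
    h.toLin ∘ₗ g.toLin = LinearMap.id ∧ g.toLin ∘ₗ h.toLin = LinearMap.id ∧
    g.toLin ∘ₗ X.i.toLin = Y.i.toLin ∧ Y.p.toLin ∘ₗ g.toLin = X.p.toLin

instance Extension.setoid (C A : HTStructure) : Setoid (Extension C A) where
  r := Extension.Iso
  iseqv :=
    { refl := fun X => ⟨Hom.id _, Hom.id _, rfl, rfl, rfl, rfl⟩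
      symm := fun ⟨g, h, hg, gh, e1, e2⟩ => ⟨h, g, gh, hg,
        by rw [← e1, ← LinearMap.comp_assoc, hg, LinearMap.id_comp],
        by rw [← e2, LinearMap.comp_assoc, gh, LinearMap.comp_id]⟩
      trans := fun ⟨g, h, hg, gh, e1, e2⟩ ⟨g', h', hg', gh', e1', e2'⟩ =>
        ⟨g'.comp g, h.comp h',
          LinearMap.ext fun x => by
            have a := LinearMap.congr_fun hg' (g.toLin x)
            have b := LinearMap.congr_fun hg x
            simp only [LinearMap.comp_apply, LinearMap.id_apply, Hom.comp] at a b ⊢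
            rw [a, b],
          LinearMap.ext fun x => by
            have a := LinearMap.congr_fun gh (h'.toLin x)
            have b := LinearMap.congr_fun gh' x
            simp only [LinearMap.comp_apply, LinearMap.id_apply, Hom.comp] at a b ⊢
            rw [a, b],
          by rw [← e1', ← e1]; rfl,
          by rw [← e2, ← e2']; rfl⟩ }

/-- The Yoneda group `Ext^1(C, A)` of Hodge–Tate structures, as a set. -/
def Ext1 (C A : HTStructure) : Type 1 := Quotient (Extension.setoid C A)

lemma one_tmul_eq_zero {V : Type} [AddCommGroup V] [Module ℚ V] {x : V}
    (h : (1 : ℂ) ⊗ₜ[ℚ] x = 0) : x = 0 :=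
  Module.FaithfullyFlat.tensorProduct_mk_injective (A := ℚ) (B := ℂ) V (by simpa using h)

lemma tate_F_bot {n p : ℤ} (h : -n < p) : (tate n).F p = ⊥ := if_neg (by omega)

lemma F_inf_W (H : HTStructure) (j : ℤ) : F H (j + 1) ⊓ (H.W (2 * j)).baseChange ℂ = ⊥ := by
  obtain ⟨k, hk⟩ := H.W_bot
  have base : ∀ j : ℤ, 2 * j ≤ k → F H (j + 1) ⊓ (H.W (2 * j)).baseChange ℂ = ⊥ := by
    intro j hj
    rw [le_bot_iff.1 (hk ▸ H.W_mono hj : H.W (2 * j) ≤ ⊥)]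
    simp
  by_cases hj : -|k| ≤ j
  · induction j, hj using Int.leInduction with
    | base =>
      refine base _ ?_
      have := neg_abs_le k
      have := abs_nonneg k
      omega
    | succ j _ ih =>
      rw [← le_bot_iff, ← ih]
      refine le_inf (inf_le_left.trans (H.F_anti (by omega))) ?_
      have := H.F_gr_bot (j + 1)
      rwa [show 2 * (j + 1) - 1 = 2 * j + 1 by ring, H.W_odd] at this
  · refine base j ?_
    have := neg_abs_le k
    have := abs_nonneg k
    omega

lemma F_sup_W (H : HTStructure) (j : ℤ) :
    F H j ⊔ (H.W (2 * (j - 1))).baseChange ℂ = ⊤ := by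
  obtain ⟨k, hk⟩ := H.W_top
  have base : ∀ j : ℤ, k ≤ 2 * (j - 1) → F H j ⊔ (H.W (2 * (j - 1))).baseChange ℂ = ⊤ := by
    intro j hj
    rw [top_le_iff.1 (hk ▸ H.W_mono hj : ⊤ ≤ H.W (2 * (j - 1)))]
    simp
  have := le_abs_self k
  have := abs_nonneg k
  by_cases hj : j ≤ |k| + 1
  · induction j, hj using Int.leInductionDown with
    | base => exact base _ (by omega)
    | pred j _ ih =>
      rw [← top_le_iff, ← ih]
      refine sup_le (le_sup_of_le_left (H.F_anti (by omega))) ?_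
      refine (H.F_gr_top (j - 1)).trans
        (sup_le (le_sup_of_le_left inf_le_left) (le_sup_of_le_right ?_))
      rw [show 2 * (j - 1) - 1 = 2 * (j - 1 - 1) + 1 by ring, H.W_odd]
  · exact base j (by omega)

namespace Extension

variable {n : ℤ} (X : Extension (tate 0) (tate n))

lemma strict_i {k : ℤ} {y : (tate n).V} (h : X.i.toLin y ∈ X.E.W k) : y ∈ (tate n).W k := by
  by_cases hk : -2 * n ≤ k
  · rw [tate_W_top hk]; trivial
  have hW : X.i.toLin y ∈ X.E.W (2 * (-n - 1)) := by
    rw [← X.E.W_odd]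
    exact X.E.W_mono (by omega) h
  have hF : (1 : ℂ) ⊗ₜ[ℚ] X.i.toLin y ∈ X.E.F (-n - 1 + 1) := by
    refine X.i.map_F (-n - 1 + 1) ((1 : ℂ) ⊗ₜ[ℚ] y) ?_
    have : (tate n).F (-n - 1 + 1) = ⊤ := if_pos (by omega)
    rw [this]; trivial
  have h0 := (X.E.F_inf_W (-n - 1)).le ⟨hF, Submodule.tmul_mem_baseChange_of_mem _ hW⟩
  have h1 : X.i.toLin y = 0 := one_tmul_eq_zero h0
  have h2 : y = 0 := X.inj (h1.trans (map_zero _).symm)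
  rw [h2]; exact zero_mem _

lemma strict_p {k : ℤ} {q : (tate 0).V} (h : q ∈ (tate 0).W k) :
    ∃ x ∈ X.E.W k, X.p.toLin x = q := by
  by_cases hk : 0 ≤ k
  swap
  · rw [tate_W_bot (by omega)] at h
    exact ⟨0, zero_mem _, by rw [map_zero]; exact h.symm⟩
  have key : ((X.E.W 0).map X.p.toLin : Submodule ℚ ℚ) = ⊤ := by
    rcases eq_bot_or_eq_top (α := Ideal ℚ) ((X.E.W 0).map X.p.toLin : Submodule ℚ ℚ) with hb | ht
    · exfalso
      have h1 : ∀ z : ℂ ⊗[ℚ] X.E.V, X.p.toLin.baseChange ℂ z = 0 := by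
        intro z
        have hz : z ∈ F X.E 1 ⊔ (X.E.W (2 * (1 - 1))).baseChange ℂ := by
          rw [X.E.F_sup_W 1]; trivial
        obtain ⟨a, ha, b, hb', rfl⟩ := Submodule.mem_sup.1 hz
        have e1 : X.p.toLin.baseChange ℂ a = 0 := by
          have := X.p.map_F 1 a ha
          have hF : (tate 0).F 1 = ⊥ := tate_F_bot (by norm_num)
          rwa [hF] at this
        have e2 : X.p.toLin.baseChange ℂ b ∈ (⊥ : Submodule ℚ (tate 0).V).baseChange ℂ :=
          baseChange_mem _ _ _ (fun x hx => hb.le ⟨x, hx, rfl⟩) b hb'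
        rw [Submodule.baseChange_bot] at e2
        rw [map_add, e1, (Submodule.mem_bot ℂ).1 e2, add_zero]
      obtain ⟨x, hx⟩ := X.surj (1 : ℚ)
      have := h1 ((1 : ℂ) ⊗ₜ x)
      rw [LinearMap.baseChange_tmul, hx] at this
      exact one_ne_zero (α := ℚ) (one_tmul_eq_zero (V := ℚ) this)
    · exact ht
  have : q ∈ ((X.E.W 0).map X.p.toLin : Submodule ℚ ℚ) := by rw [key]; trivial
  obtain ⟨x, hx, e⟩ := this
  exact ⟨x, X.E.W_mono hk hx, e⟩

lemma gr_inj (k : ℤ) : Function.Injective (X.i.gr k) := by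
  rw [← LinearMap.ker_eq_bot, LinearMap.ker_eq_bot']
  intro y hy
  induction y using Submodule.Quotient.induction_on with
  | H y =>
    rw [Hom.gr_mk, Submodule.Quotient.mk_eq_zero] at hy
    rw [Submodule.Quotient.mk_eq_zero]
    exact X.strict_i (k := k - 1) hy

lemma gr_surj (k : ℤ) : Function.Surjective (X.p.gr k) := by
  intro q
  induction q using Submodule.Quotient.induction_on with
  | H q =>
    obtain ⟨x, hx, e⟩ := X.strict_p q.2
    exact ⟨Submodule.Quotient.mk ⟨x, hx⟩, congrArg Submodule.Quotient.mk (Subtype.ext e)⟩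

lemma gr_exact (k : ℤ) (x : X.E.gr k) : X.p.gr k x = 0 ↔ ∃ a, X.i.gr k a = x := by
  constructor
  · induction x using Submodule.Quotient.induction_on with
    | H x =>
      intro hx
      rw [Hom.gr_mk, Submodule.Quotient.mk_eq_zero] at hx
      obtain ⟨x', hx', e⟩ := X.strict_p (k := k - 1) hx
      obtain ⟨y, hy⟩ := (X.exact (x.1 - x')).1 (by rw [map_sub, e]; exact sub_self _)
      have hyk : y ∈ (tate n).W k := by
        apply X.strict_i
        rw [hy]
        exact sub_mem x.2 (X.E.W_mono (by omega) hx')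
      refine ⟨Submodule.Quotient.mk ⟨y, hyk⟩, ?_⟩
      rw [Hom.gr_mk, Submodule.Quotient.eq]
      change X.i.toLin y - x.1 ∈ X.E.W (k - 1)
      rw [hy, sub_sub_cancel_left]
      exact neg_mem hx'
  · rintro ⟨a, rfl⟩
    induction a using Submodule.Quotient.induction_on with
    | H a =>
      rw [Hom.gr_mk, Hom.gr_mk, Submodule.Quotient.mk_eq_zero]
      change X.p.toLin (X.i.toLin a.1) ∈ (tate 0).W (k - 1)
      rw [(X.exact _).2 ⟨a.1, rfl⟩]
      exact zero_mem _

end Extension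

lemma tate_gr_eq_zero {n k : ℤ} (h : k ≠ -2 * n) (x : (tate n).gr k) : x = 0 := by
  rcases lt_or_gt_of_ne h with h | h
  · exact gr_eq_zero_of_bot (tate_W_bot h) x
  · exact gr_eq_zero_of_top (tate_W_top (by omega)) x

namespace Extension

lemma gr_zero_bijective {n : ℤ} (hn : 0 < n) (X : Extension (tate 0) (tate n)) :
    Function.Bijective (X.p.gr 0) := by
  refine ⟨?_, X.gr_surj 0⟩
  rw [← LinearMap.ker_eq_bot, LinearMap.ker_eq_bot']
  intro x hx
  obtain ⟨a, rfl⟩ := (X.gr_exact 0 x).1 hx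
  rw [tate_gr_eq_zero (by omega) a, map_zero]

lemma gr_bijective {n : ℤ} (hn : 0 < n) (X : Extension (tate 0) (tate n)) :
    Function.Bijective (X.i.gr (-2 * n)) :=
  ⟨X.gr_inj _, fun x => (X.gr_exact _ x).1 (tate_gr_eq_zero (by omega) _)⟩

/-- The vector of `gr^W_0 E = gr^W_0 ℚ(0)` corresponding to the generator `1`. -/
def vec {n : ℤ} (hn : 0 < n) (X : Extension (tate 0) (tate n)) : X.E.gr 0 :=
  (LinearEquiv.ofBijective (X.p.gr 0) (X.gr_zero_bijective hn)).symm (tateGen 0 0 rfl)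

/-- The covector on `gr^W_{-2n} E = gr^W_{-2n} ℚ(n) = ℚ` given by the identity of `ℚ`. -/
def cov {n : ℤ} (hn : 0 < n) (X : Extension (tate 0) (tate n)) : X.E.gr (-2 * n) →ₗ[ℚ] ℚ :=
  tateVal n _ rfl ∘ₗ
    (LinearEquiv.ofBijective (X.i.gr (-2 * n)) (X.gr_bijective hn)).symm.toLinearMap

lemma p_vec {n : ℤ} (hn : 0 < n) (X : Extension (tate 0) (tate n)) :
    X.p.gr 0 (X.vec hn) = tateGen 0 0 rfl :=
  (LinearEquiv.ofBijective (X.p.gr 0) (X.gr_zero_bijective hn)).apply_symm_apply _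

lemma cov_i {n : ℤ} (hn : 0 < n) (X : Extension (tate 0) (tate n)) (y : (tate n).gr (-2 * n)) :
    X.cov hn (X.i.gr _ y) = tateVal n _ rfl y :=
  congrArg (tateVal n _ rfl)
    ((LinearEquiv.ofBijective (X.i.gr (-2 * n)) (X.gr_bijective hn)).symm_apply_apply y)

/-- The framed Hodge–Tate structure given by an extension of `ℚ(0)` by `ℚ(n)`. -/
def framed (n : ℕ) (hn : 0 < n) (X : Extension (tate 0) (tate n)) : FramedHT n where
  H := X.E
  v := X.vec (by omega)
  f := X.cov (by omega)
  v_ne h := by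
    have := X.p_vec (by omega)
    rw [h, map_zero] at this
    exact tateGen_ne _ _ _ this.symm
  f_ne h := by
    refine tateVal_ne n _ rfl (LinearMap.ext fun y => ?_)
    rw [← X.cov_i (by omega), h]; rfl

end Extension

/-- The map `ι_n : Ext^1(ℚ(0), ℚ(n)) → ℋ_n` sending an extension `E` to its class with the
framing given by `gr^W_0 E = ℚ(0)` and `gr^W_{-2n} E = ℚ(n)`. -/
def iota (n : ℕ) (hn : 0 < n) : Ext1 (tate 0) (tate n) → HTn n :=
  Quotient.lift (fun X => HTn.mk (X.framed n hn)) (by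
    rintro X Y ⟨g, h, hg, gh, e1, e2⟩
    refine HTn.sound g ?_ ?_
    · refine (Y.gr_zero_bijective (by omega)).1 ?_
      have hn' : (0 : ℤ) < n := by omega
      change Y.p.gr 0 (g.gr 0 (X.vec hn')) = Y.p.gr 0 (Y.vec hn')
      rw [Y.p_vec, ← X.p_vec hn']
      generalize X.vec hn' = x
      induction x using Submodule.Quotient.induction_on with
      | H x =>
        exact congrArg Submodule.Quotient.mk (Subtype.ext (LinearMap.congr_fun e2 x.1))
    · intro x
      obtain ⟨y, rfl⟩ := (X.gr_bijective (by omega)).2 x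
      have hn' : (0 : ℤ) < n := by omega
      change Y.cov hn' (g.gr _ (X.i.gr _ y)) = X.cov hn' (X.i.gr _ y)
      rw [X.cov_i, ← Y.cov_i hn']
      congr 1
      induction y using Submodule.Quotient.induction_on with
      | H y =>
        exact congrArg Submodule.Quotient.mk (Subtype.ext (LinearMap.congr_fun e1 y.1)))

lemma coef_tate (n : ℤ) :
    (tate n).coef n n (tateGen n _ rfl) (tateVal n _ rfl) = one := by
  rw [coef_eq _ n n 0 (by simp), shiftCls_tate n n n rfl rfl (by simp)]
  rfl

lemma omegaCoact_tate (n : ℤ) (x : (tate n).omegaV) :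
    (tate n).omegaCoact x = one ⊗ₜ x := by
  refine omegaV_ext (g := TensorProduct.mk ℚ HTAlg _ one) (fun m v => ?_) x
  by_cases hm : m = n
  swap
  · rw [tate_gr_eq_zero (by omega) v]
    simp only [map_zero]
  subst hm
  rw [omegaCoact_incl' _ m v ((tate m).weights ∪ {m}) Finset.subset_union_left,
    Finset.sum_eq_single m]
  · rw [coactTerm_apply]
    have key := sum_coord_tmul ((tate m).grBasis m) (tateBasis m _ rfl) LinearMap.id
      ((tate m).coef m m v) ((tate m).omegaIncl m)
    refine key.trans ((Fintype.sum_unique _).trans ?_)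
    change (tate m).coef m m v ((tateBasis m _ rfl).coord ()) ⊗ₜ
      (tate m).omegaIncl m (tateBasis m _ rfl ()) = _
    rw [tateBasis_apply, tateBasis_coord, ← smul_tateGen m _ rfl v, map_smul, LinearMap.smul_apply,
      coef_tate, map_smul, TensorProduct.smul_tmul]
    rfl
  · intro r _ hr
    rw [coactTerm_apply]
    refine Finset.sum_eq_zero fun i _ => ?_
    rw [tate_gr_eq_zero (by omega) ((tate m).grBasis r i), map_zero, TensorProduct.tmul_zero]
  · intro h
    exact absurd (Finset.mem_union_right _ (Finset.mem_singleton_self m)) h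

/-- The linear map `ℚ → ω(ℚ(n))` given by the generator of `ω(ℚ(n))`. -/
def tateOmegaLin (n : ℤ) : ℚ →ₗ[ℚ] (tate n).omegaV :=
  LinearMap.toSpanSingleton ℚ _ ((tate n).omegaIncl n (tateGen n _ rfl))

/-- The inverse linear map `ω(ℚ(n)) → ℚ`. -/
def omegaTateLin (n : ℤ) : (tate n).omegaV →ₗ[ℚ] ℚ :=
  tateVal n _ rfl ∘ₗ (tate n).omegaProj n

lemma omegaTateLin_tateOmegaLin (n : ℤ) (q : ℚ) : omegaTateLin n (tateOmegaLin n q) = q := by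
  change omegaTateLin n (q • (tate n).omegaIncl n (tateGen n _ rfl)) = q
  rw [map_smul]
  change q • tateVal n _ rfl ((tate n).omegaProj n ((tate n).omegaIncl n (tateGen n _ rfl))) = q
  rw [omegaProj_incl, tateVal_gen, smul_eq_mul, mul_one]

lemma tateOmegaLin_omegaTateLin (n : ℤ) (x : (tate n).omegaV) :
    tateOmegaLin n (omegaTateLin n x) = x := by
  refine omegaV_ext (f := tateOmegaLin n ∘ₗ omegaTateLin n) (g := LinearMap.id) (fun m v => ?_) x
  by_cases hm : m = n
  swap
  · rw [tate_gr_eq_zero (by omega) v]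
    simp only [map_zero]
  subst hm
  change tateVal m _ rfl ((tate m).omegaProj m ((tate m).omegaIncl m v)) •
    (tate m).omegaIncl m (tateGen m _ rfl) = (tate m).omegaIncl m v
  rw [omegaProj_incl, ← map_smul, smul_tateGen]

/-- The isomorphism `ℚ_(n) → ω(ℚ(n))` of graded comodules given by the generator. -/
def tateOmega (n : ℤ) : GrComod.Hom (GrComod.triv n) (tate n).omega where
  toLin := tateOmegaLin n
  map_gr m v hv := by
    by_cases hm : m = n
    · subst hm
      exact ⟨(show ℚ from v) • tateGen m _ rfl, map_smul ((tate m).omegaIncl m) _ _⟩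
    · have hv : v = (0 : ℚ) := (Submodule.mem_bot ℚ).1 ((GrComod.line_ne hm).le hv)
      subst hv
      exact ⟨0, (map_zero _).trans (map_zero (tateOmegaLin n)).symm⟩
  map_coact v := omegaCoact_tate n (tateOmegaLin n v)

/-- The inverse isomorphism `ω(ℚ(n)) → ℚ_(n)`. -/
def omegaTate (n : ℤ) : GrComod.Hom (tate n).omega (GrComod.triv n) where
  toLin := omegaTateLin n
  map_gr m := by
    rintro _ ⟨v, rfl⟩
    by_cases hm : m = n
    · subst hm
      change _ ∈ GrComod.line m m
      rw [GrComod.line_self]; trivial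
    · change tateVal n _ rfl ((tate n).omegaProj n ((tate n).omegaIncl m v)) ∈ GrComod.line n m
      rw [omegaProj_incl_ne _ hm, map_zero]
      exact zero_mem _
  map_coact x := (congrArg ((omegaTateLin n).lTensor HTAlg) (omegaCoact_tate n x)).symm

lemma omegaV_proj_ext {H : HTStructure} {x y : H.omegaV}
    (h : ∀ m, H.omegaProj m x = H.omegaProj m y) : x = y :=
  DirectSum.ext_component ℚ h

lemma Extension.omega_inj {n : ℤ} (X : Extension (tate 0) (tate n)) :
    Function.Injective X.i.omegaLin := fun x y h =>
  omegaV_proj_ext fun m => X.gr_inj _ (by rw [← Hom.omegaProj_lin, h, Hom.omegaProj_lin])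

lemma Extension.omega_surj {n : ℤ} (X : Extension (tate 0) (tate n)) :
    Function.Surjective X.p.omegaLin := by
  intro x
  induction x using omegaV_induction with
  | h0 => exact ⟨0, map_zero _⟩
  | h1 m v =>
    obtain ⟨w, rfl⟩ := X.gr_surj _ v
    exact ⟨X.E.omegaIncl m w, X.p.omegaLin_incl m w⟩
  | h2 x y hx hy =>
    obtain ⟨a, rfl⟩ := hx
    obtain ⟨b, rfl⟩ := hy
    exact ⟨a + b, map_add _ _ _⟩

lemma omegaV_sum (H : HTStructure) (x : H.omegaV) :
    ∃ S : Finset ℤ, ∀ T : Finset ℤ, S ⊆ T → ∑ m ∈ T, H.omegaIncl m (H.omegaProj m x) = x := by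
  induction x using omegaV_induction with
  | h0 => exact ⟨∅, fun T _ => Finset.sum_eq_zero fun m _ => by rw [map_zero, map_zero]⟩
  | h1 r v =>
    refine ⟨{r}, fun T hT => ?_⟩
    rw [Finset.sum_eq_single_of_mem r (hT (Finset.mem_singleton_self r)), omegaProj_incl]
    intro m _ hm
    rw [omegaProj_incl_ne H (Ne.symm hm), map_zero]
  | h2 x y hx hy =>
    obtain ⟨S, hS⟩ := hx
    obtain ⟨S', hS'⟩ := hy
    refine ⟨S ∪ S', fun T hT => ?_⟩
    simp only [map_add, Finset.sum_add_distrib]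
    rw [hS T (Finset.union_subset_left hT), hS' T (Finset.union_subset_right hT)]

lemma Extension.omega_exact {n : ℤ} (X : Extension (tate 0) (tate n)) (x : X.E.omegaV) :
    X.p.omegaLin x = 0 ↔ ∃ a, X.i.omegaLin a = x := by
  constructor
  · intro hx
    have h : ∀ m, ∃ a, X.i.gr _ a = X.E.omegaProj m x := fun m => by
      rw [← X.gr_exact, ← Hom.omegaProj_lin, hx, map_zero]
    choose a ha using h
    obtain ⟨S, hS⟩ := X.E.omegaV_sum x
    refine ⟨∑ m ∈ S, (tate n).omegaIncl m (a m), ?_⟩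
    rw [map_sum]
    refine Eq.trans (Finset.sum_congr rfl fun m _ => ?_) (hS S subset_rfl)
    rw [X.i.omegaLin_incl, ha]
  · rintro ⟨a, rfl⟩
    refine omegaV_proj_ext fun m => ?_
    rw [Hom.omegaProj_lin, Hom.omegaProj_lin, map_zero, X.gr_exact]
    exact ⟨_, rfl⟩

lemma tateOmegaLin_injective (n : ℤ) : Function.Injective (tateOmegaLin n) :=
  Function.LeftInverse.injective (omegaTateLin_tateOmegaLin n)

lemma omegaTateLin_surjective (n : ℤ) : Function.Surjective (omegaTateLin n) :=
  Function.LeftInverse.surjective (omegaTateLin_tateOmegaLin n)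

lemma Extension.omega_exact' {n : ℤ} (X : Extension (tate 0) (tate n)) (x : X.E.omegaV) :
    omegaTateLin 0 (X.p.omegaLin x) = 0 ↔ ∃ a : ℚ, X.i.omegaLin (tateOmegaLin n a) = x := by
  have h1 : omegaTateLin 0 (X.p.omegaLin x) = 0 ↔ X.p.omegaLin x = 0 :=
    ⟨fun h => by rw [← tateOmegaLin_omegaTateLin 0 (X.p.omegaLin x), h, map_zero],
      fun h => by rw [h, map_zero]⟩
  rw [h1, X.omega_exact]
  constructor
  · rintro ⟨a, rfl⟩
    exact ⟨omegaTateLin n a, by rw [tateOmegaLin_omegaTateLin]⟩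
  · rintro ⟨a, rfl⟩
    exact ⟨_, rfl⟩

/-- The extension `0 → ℚ_(n) → ω(E) → ℚ_(0) → 0` of graded comodules obtained by applying `ω` to an
extension of Hodge–Tate structures. -/
def Extension.omega {n : ℤ} (X : Extension (tate 0) (tate n)) :
    GrComod.Extension (GrComod.triv 0) (GrComod.triv n) where
  E := X.E.omega
  i := X.i.omega.comp (tateOmega n)
  p := (omegaTate 0).comp X.p.omega
  inj := X.omega_inj.comp (tateOmegaLin_injective n)
  surj := (omegaTateLin_surjective 0).comp X.omega_surj
  exact := X.omega_exact'

lemma Hom.omegaLin_comp_eq {H H' H'' : HTStructure} (g : Hom H' H'') (f : Hom H H')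
    (e : Hom H H'') (h : g.toLin ∘ₗ f.toLin = e.toLin) :
    g.omegaLin ∘ₗ f.omegaLin = e.omegaLin := by
  refine LinearMap.ext fun x => omegaV_ext (fun m v => ?_) x
  rw [LinearMap.comp_apply, f.omegaLin_incl, g.omegaLin_incl, e.omegaLin_incl]
  congr 1
  induction v using Submodule.Quotient.induction_on with
  | H x => exact congrArg Submodule.Quotient.mk (Subtype.ext (LinearMap.congr_fun h x.1))

lemma Hom.omegaLin_id (H : HTStructure) : (Hom.id H).omegaLin = LinearMap.id := by
  refine LinearMap.ext fun x => omegaV_ext (fun m v => ?_) x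
  rw [Hom.omegaLin_incl, Hom.gr_id, LinearMap.id_apply]

/-- The map `Ext^1(ℚ(0), ℚ(n)) → Ext^1(ℚ_(0), ℚ_(n))` from Hodge–Tate structures to graded
comodules induced by the functor `ω`. -/
def omegaExt (n : ℤ) :
    Ext1 (tate 0) (tate n) → GrComod.Ext1 (GrComod.triv 0) (GrComod.triv n) :=
  Quotient.map Extension.omega (by
    rintro X Y ⟨g, h, hg, gh, e1, e2⟩
    refine ⟨g.omega, h.omega, ?_, ?_, ?_, ?_⟩
    · exact (Hom.omegaLin_comp_eq h g (Hom.id _) hg).trans (Hom.omegaLin_id _)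
    · exact (Hom.omegaLin_comp_eq g h (Hom.id _) gh).trans (Hom.omegaLin_id _)
    · change g.omegaLin ∘ₗ (X.i.omegaLin ∘ₗ tateOmegaLin n) = Y.i.omegaLin ∘ₗ tateOmegaLin n
      rw [← Hom.omegaLin_comp_eq g X.i Y.i e1]; rfl
    · change (omegaTateLin 0 ∘ₗ Y.p.omegaLin) ∘ₗ g.omegaLin = omegaTateLin 0 ∘ₗ X.p.omegaLin
      rw [← Hom.omegaLin_comp_eq Y.p g X.p e2]; rfl)

end HTStructure

/-- The class in `Ext^1(ℚ_(0), ℚ_(n))`, for graded comodules, of the extension attached to a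
cocycle `γ ∈ Ker(ν̄|_{ℋ_n})` of the reduced cobar complex. -/
def GrComod.cobarClass (n : ℕ) (hn : 0 < n) (γ : HTAlg.kerRedComul n) :
    GrComod.Ext1 (GrComod.triv 0) (GrComod.triv n) :=
  Quotient.mk _ (GrComod.cobarExtension n hn γ.1 γ.2)

end

/-! Over `ℂ` a Hodge–Tate structure splits, for every `j`, as `W_{2j} ⊕ F^{j+1}` (`F_sup_W`,
`F_inf_W`). A rational subspace stable under the projections to `W_{2j}` (`IsSub`) inherits a
Hodge–Tate structure. Such subspaces are closed under sums, intersections, images and preimages, and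
are strict for `W` (`IsSub.sup_inf_W`, `IsSub.map_inf_W`), because morphisms commute with the
projections. This replaces the formalism of abelian categories; no quotient object is built.

The equivalence relation on framed structures is controlled by one invariant: if `[H, v, f] = 0`,
then some subobject contains `v` in its `gr^W_0` and is killed by `f` (`separated_of_cls_eq_zero`).
Having such a subobject is invariant under morphisms of framed structures and holds for `ℚ(0) ⊕
ℚ(n)`.

Injectivity of `ι_n`: if `X` and `Y` have the same class, a subobject `S` of `X ⊕ Y` separates the
difference framing. It contains a lift of the common generator of weight `0`, and its part in
`W_{-2}` lies in the diagonal copy of `ℚ(n)`. Projecting the lift to `W_{-2}` along `F^0` then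
yields the same complex number for `X` and `Y`. That number is minus a period of each, and a period
determines an extension (`mk_eq_periodExtension`).

Comodules: an extension of `ℚ_(0)` by `ℚ_(n)` has coaction `e ↦ 1 ⊗ e + γ ⊗ eₙ` on a lift `e` of
degree `0`, and coassociativity says exactly that `γ` lies in `Ker ν̄`. Since `0 ≠ n`, the lift is
unique, so `c_n` is bijective. For `ω(E)` the element `γ` is `ι_n(E)` (`omegaCoact_vec`). Hence
`ι_n` lands in `Ker ν̄` and `ω_* = c_n ∘ ι_n`; all that remains is that `ι_n` hits the whole kernel.

Surjectivity: take `[H, v, f]` in the kernel and the least subobject `S` containing `v`. For `0 < k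
< n` the vanishing of `ν_{k,n-k}` gives `∑ [H, v, b_i^∨] ⊗ [H, b_i, f](-k) = 0`. A covector `φ` with
`[H, v, φ] = 0` vanishes on `S` by minimality, so linear algebra forces `[H, s, f](-k) = 0` for
every `s` in `S ∩ W_{-2k}`, that is, `s` is separated from `f`. The greatest subobject `T` of `S ∩
W_{-2}` killed by `f` therefore absorbs all weights strictly between `-2n` and `0`
(`exists_killed_sub`). What is left modulo `T` maps to a two-dimensional extension with the right
framing (`cls_mem_range_iota`). -/

open TensorProduct DirectSum

noncomputable section

namespace HTStructure

/-! ### Rational subspaces and their complexifications. -/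

section BaseChange

variable {V V' : Type} [AddCommGroup V] [Module ℚ V] [AddCommGroup V'] [Module ℚ V']

/-- The contraction `ℂ ⊗ V → V` with a `ℚ`-linear form on `ℂ`. -/
def contract (V : Type) [AddCommGroup V] [Module ℚ V] (l : ℂ →ₗ[ℚ] ℚ) : ℂ ⊗[ℚ] V →ₗ[ℚ] V :=
  (TensorProduct.lid ℚ V).toLinearMap ∘ₗ l.rTensor V

lemma contract_tmul (l : ℂ →ₗ[ℚ] ℚ) (c : ℂ) (x : V) : contract V l (c ⊗ₜ x) = l c • x := by
  simp [contract]

lemma contract_baseChange (g : V →ₗ[ℚ] V') (l : ℂ →ₗ[ℚ] ℚ) (z : ℂ ⊗[ℚ] V) :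
    contract V' l (g.baseChange ℂ z) = g (contract V l z) := by
  induction z using TensorProduct.induction_on with
  | zero => simp
  | tmul c x => rw [LinearMap.baseChange_tmul, contract_tmul, contract_tmul, map_smul]
  | add x y hx hy => simp only [map_add, hx, hy]

/-- Expanding `z` in a basis of `ℂ` over `ℚ`, the coordinate forms contract `z` to its coefficients,
which must therefore lie in `S`. Testing against forms makes compatibility of base change with
intersections and preimages immediate. -/
lemma mem_baseChange_iff (S : Submodule ℚ V) (z : ℂ ⊗[ℚ] V) :
    z ∈ S.baseChange ℂ ↔ ∀ l, contract V l z ∈ S := by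
  constructor
  · rintro ⟨y, rfl⟩ l
    rw [contract_baseChange]
    exact (contract S l y).2
  · intro h
    classical
    let b := Module.Basis.ofVectorSpace ℚ ℂ
    obtain ⟨c, rfl⟩ := TensorProduct.eq_repr_basis_left b z
    refine sum_mem fun i _ => Submodule.tmul_mem_baseChange_of_mem _ ?_
    have := h (b.coord i)
    rw [Finsupp.sum, map_sum] at this
    simp only [contract_tmul, Module.Basis.coord_apply, Module.Basis.repr_self] at this
    by_cases hi : i ∈ c.support
    · rwa [Finset.sum_eq_single_of_mem i hi fun j _ hj => by
        rw [Finsupp.single_eq_of_ne (Ne.symm hj), zero_smul], Finsupp.single_eq_same,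
        one_smul] at this
    · rw [Finsupp.notMem_support_iff.1 hi]
      exact zero_mem _

/-- Contracting with a form that does not vanish at `1` returns a non-zero multiple of `x`. This is
how conclusions reached over `ℂ` descend to `ℚ`. -/
lemma one_tmul_mem_baseChange {S : Submodule ℚ V} {x : V} :
    (1 : ℂ) ⊗ₜ[ℚ] x ∈ S.baseChange ℂ ↔ x ∈ S := by
  refine ⟨fun h => ?_, fun h => Submodule.tmul_mem_baseChange_of_mem _ h⟩
  obtain ⟨l, hl⟩ := Module.Projective.exists_dual_ne_zero ℚ (one_ne_zero (α := ℂ))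
  have := (mem_baseChange_iff S _).1 h l
  rw [contract_tmul] at this
  exact (S.smul_mem_iff hl).1 this

lemma mem_baseChange_inf {S T : Submodule ℚ V} {z : ℂ ⊗[ℚ] V} :
    z ∈ (S ⊓ T).baseChange ℂ ↔ z ∈ S.baseChange ℂ ∧ z ∈ T.baseChange ℂ := by
  simp only [mem_baseChange_iff, Submodule.mem_inf, forall_and]

lemma mem_baseChange_comap (g : V →ₗ[ℚ] V') (S : Submodule ℚ V') (z : ℂ ⊗[ℚ] V) :
    z ∈ (S.comap g).baseChange ℂ ↔ g.baseChange ℂ z ∈ S.baseChange ℂ := by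
  simp only [mem_baseChange_iff, Submodule.mem_comap, contract_baseChange]

lemma baseChange_sup_exists {S T : Submodule ℚ V} {z : ℂ ⊗[ℚ] V}
    (hz : z ∈ (S ⊔ T).baseChange ℂ) : ∃ a ∈ S.baseChange ℂ, ∃ b ∈ T.baseChange ℂ, a + b = z := by
  rw [← Submodule.mem_sup]
  rw [Submodule.baseChange_eq_span] at hz
  refine (Submodule.span_le.2 ?_ : _ ≤ S.baseChange ℂ ⊔ T.baseChange ℂ) hz
  rintro _ ⟨x, hx, rfl⟩
  obtain ⟨a, ha, b, hb, rfl⟩ := Submodule.mem_sup.1 hx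
  refine Submodule.mem_sup.2 ⟨_, Submodule.tmul_mem_baseChange_of_mem 1 ha, _,
    Submodule.tmul_mem_baseChange_of_mem 1 hb, ?_⟩
  exact (TensorProduct.tmul_add _ _ _).symm

lemma baseChange_map_exists (g : V →ₗ[ℚ] V') {S : Submodule ℚ V} {z : ℂ ⊗[ℚ] V'}
    (hz : z ∈ (S.map g).baseChange ℂ) : ∃ a ∈ S.baseChange ℂ, g.baseChange ℂ a = z := by
  rw [← Submodule.mem_map]
  rw [Submodule.baseChange_eq_span] at hz
  refine (Submodule.span_le.2 ?_ : _ ≤ (S.baseChange ℂ).map (g.baseChange ℂ)) hz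
  rintro _ ⟨_, ⟨x, hx, rfl⟩, rfl⟩
  exact ⟨1 ⊗ₜ x, Submodule.tmul_mem_baseChange_of_mem 1 hx, LinearMap.baseChange_tmul _ _ _⟩

lemma baseChange_injective {g : V →ₗ[ℚ] V'} (hg : Function.Injective g) :
    Function.Injective (g.baseChange ℂ) :=
  Module.Flat.lTensor_preserves_injective_linearMap (M := ℂ) g hg

lemma baseChange_span_singleton_exists {c : V} {z : ℂ ⊗[ℚ] V}
    (hz : z ∈ (Submodule.span ℚ {c}).baseChange ℂ) : ∃ a : ℂ, a ⊗ₜ[ℚ] c = z := by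
  rw [Submodule.baseChange_span] at hz
  simp only [Set.image_singleton] at hz
  obtain ⟨a, rfl⟩ := Submodule.mem_span_singleton.1 hz
  exact ⟨a, by simp [TensorProduct.smul_tmul']⟩

end BaseChange

/-! ### The splittings `W_{2j} ⊕ F^{j+1}`, subobjects and strictness. -/

section Splitting

variable {H H' : HTStructure}

/-- There are no odd weights, and `/` rounds down. The splittings exist only at even indices; this
makes them usable for an arbitrary `k`. -/
lemma W_even (H : HTStructure) (k : ℤ) : H.W k = H.W (2 * (k / 2)) := by
  rcases Int.emod_two_eq_zero_or_one k with h | h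
  · rw [show 2 * (k / 2) = k by omega]
  · rw [← H.W_odd, show 2 * (k / 2) + 1 = k by omega]

/-- Every complex vector is the sum of a vector in `W_{2j}` and one in `F^{j+1}`. -/
lemma exists_W_add_F (H : HTStructure) (j : ℤ) (z : ℂ ⊗[ℚ] H.V) :
    ∃ w ∈ (H.W (2 * j)).baseChange ℂ, ∃ u ∈ H.F (j + 1), w + u = z := by
  have := H.F_sup_W (j + 1)
  rw [add_sub_cancel_right, sup_comm] at this
  exact Submodule.mem_sup.1 (this ▸ Submodule.mem_top)

/-- The difference of the two weight parts lies in `F^{j+1} ∩ W_{2j} = 0`. Most arguments about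
filtrations below exhibit two decompositions of one vector and compare their weight parts through
this lemma. -/
lemma W_add_F_unique (H : HTStructure) (j : ℤ) {w w' u u' : ℂ ⊗[ℚ] H.V}
    (hw : w ∈ (H.W (2 * j)).baseChange ℂ) (hw' : w' ∈ (H.W (2 * j)).baseChange ℂ)
    (hu : u ∈ H.F (j + 1)) (hu' : u' ∈ H.F (j + 1)) (h : w + u = w' + u') : w = w' := by
  have h1 : w - w' = u' - u := by rw [sub_eq_sub_iff_add_eq_add, h, add_comm]
  have := (H.F_inf_W j).le ⟨h1 ▸ sub_mem hu' hu, sub_mem hw hw'⟩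
  exact sub_eq_zero.1 this

/-- A rational subspace of `H` on which the filtrations of `H` induce a Hodge–Tate structure: it
is stable under the projections to `W_{2j}` along `F^{j+1}`. -/
def IsSub (H : HTStructure) (S : Submodule ℚ H.V) : Prop :=
  ∀ (j : ℤ) (w u : ℂ ⊗[ℚ] H.V), w ∈ (H.W (2 * j)).baseChange ℂ → u ∈ H.F (j + 1) →
    w + u ∈ S.baseChange ℂ → w ∈ S.baseChange ℂ

lemma IsSub.inf {S T : Submodule ℚ H.V} (hS : H.IsSub S) (hT : H.IsSub T) : H.IsSub (S ⊓ T) := by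
  intro j w u hw hu h
  rw [mem_baseChange_inf] at h ⊢
  exact ⟨hS j w u hw hu h.1, hT j w u hw hu h.2⟩

/-- Projection is additive: decompose a summand from `S` and one from `T` separately and add. -/
lemma IsSub.sup {S T : Submodule ℚ H.V} (hS : H.IsSub S) (hT : H.IsSub T) : H.IsSub (S ⊔ T) := by
  intro j w u hw hu h
  obtain ⟨a, ha, b, hb, hab⟩ := baseChange_sup_exists h
  obtain ⟨wa, hwa, ua, hua, rfl⟩ := H.exists_W_add_F j a
  obtain ⟨wb, hwb, ub, hub, rfl⟩ := H.exists_W_add_F j b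
  have : w = wa + wb := H.W_add_F_unique j hw (add_mem hwa hwb) hu (add_mem hua hub)
    (by rw [← hab]; abel)
  rw [this]
  exact add_mem (Submodule.baseChange_mono ℂ le_sup_left (hS j wa ua hwa hua ha))
    (Submodule.baseChange_mono ℂ le_sup_right (hT j wb ub hwb hub hb))

lemma isSub_bot (H : HTStructure) : H.IsSub ⊥ := by
  intro j w u hw hu h
  rw [Submodule.baseChange_bot, Submodule.mem_bot] at h ⊢
  refine H.W_add_F_unique j hw (zero_mem _) hu (zero_mem _) (by rw [h, add_zero])

lemma isSub_top (H : HTStructure) : H.IsSub ⊤ := fun j w u _ _ _ => by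
  rw [Submodule.baseChange_top]; trivial

/-- Either `W_{2j}` is contained in `W_k`, or `W_k` is contained in `W_{2j}` and the projection
fixes it. -/
lemma isSub_W (H : HTStructure) (k : ℤ) : H.IsSub (H.W k) := by
  intro j w u hw hu h
  rw [W_even] at h ⊢
  rcases le_total j (k / 2) with hj | hj
  · exact Submodule.baseChange_mono ℂ (H.W_mono (by omega)) hw
  · have := H.W_add_F_unique j hw (Submodule.baseChange_mono ℂ (H.W_mono (by omega)) h) hu
      (zero_mem _) (by rw [add_zero])
    rw [this]; exact h

lemma Hom.map_baseChange_W (g : Hom H H') (k : ℤ) {w : ℂ ⊗[ℚ] H.V}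
    (hw : w ∈ (H.W k).baseChange ℂ) : g.toLin.baseChange ℂ w ∈ (H'.W k).baseChange ℂ :=
  baseChange_mem _ _ _ (g.map_W k) w hw

/-- A morphism respects both filtrations, hence carries decompositions to decompositions and
commutes with the projections. -/
lemma IsSub.map {S : Submodule ℚ H.V} (hS : H.IsSub S) (g : Hom H H') :
    H'.IsSub (S.map g.toLin) := by
  intro j w u hw hu h
  obtain ⟨a, ha, hab⟩ := baseChange_map_exists _ h
  obtain ⟨wa, hwa, ua, hua, rfl⟩ := H.exists_W_add_F j a
  rw [map_add] at hab
  have := H'.W_add_F_unique j (g.map_baseChange_W _ hwa) hw (g.map_F _ _ hua) hu hab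
  rw [← this]
  exact baseChange_mem _ _ _ (fun x hx => Submodule.mem_map_of_mem hx) _ (hS j wa ua hwa hua ha)

lemma IsSub.comap {S : Submodule ℚ H'.V} (hS : H'.IsSub S) (g : Hom H H') :
    H.IsSub (S.comap g.toLin) := by
  intro j w u hw hu h
  rw [mem_baseChange_comap] at h ⊢
  rw [map_add] at h
  exact hS j _ _ (g.map_baseChange_W _ hw) (g.map_F _ _ hu) h

/-- Twisting only renumbers the splittings: the one of index `j` for `H` has index `j - m` for
`H(m)`. -/
lemma IsSub.of_twist {m : ℤ} {S : Submodule ℚ H.V} (hS : (H.twist m).IsSub S) : H.IsSub S := by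
  intro j w u hw hu h
  refine hS (j - m) w u ?_ ?_ h
  · change w ∈ (H.W (2 * (j - m) + 2 * m)).baseChange ℂ
    rwa [show 2 * (j - m) + 2 * m = 2 * j by ring]
  · change u ∈ H.F (j - m + 1 + m)
    rwa [show j - m + 1 + m = j + 1 by ring]

/-- Strictness for sums of subobjects. -/
lemma IsSub.sup_inf_W {S T : Submodule ℚ H.V} (hS : H.IsSub S) (hT : H.IsSub T) (k : ℤ) {x : H.V}
    (hx : x ∈ S ⊔ T) (hk : x ∈ H.W k) : ∃ s ∈ S ⊓ H.W k, ∃ t ∈ T ⊓ H.W k, s + t = x := by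
  rw [← Submodule.mem_sup]
  rw [W_even] at hk ⊢
  obtain ⟨a, ha, b, hb, hab⟩ := baseChange_sup_exists (one_tmul_mem_baseChange.2 hx)
  obtain ⟨wa, hwa, ua, hua, rfl⟩ := H.exists_W_add_F (k / 2) a
  obtain ⟨wb, hwb, ub, hub, rfl⟩ := H.exists_W_add_F (k / 2) b
  -- Since `x` already lies in the weight step, it equals its own projection, and the projections of
  -- its two summands stay in `S` and `T`.
  have : (1 : ℂ) ⊗ₜ[ℚ] x = wa + wb := H.W_add_F_unique (k / 2) (one_tmul_mem_baseChange.2 hk)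
    (add_mem hwa hwb) (zero_mem _) (add_mem hua hub) (by rw [add_zero, ← hab]; abel)
  rw [← one_tmul_mem_baseChange, this]
  exact add_mem
    (Submodule.baseChange_mono ℂ le_sup_left (mem_baseChange_inf.2 ⟨hS _ wa ua hwa hua ha, hwa⟩))
    (Submodule.baseChange_mono ℂ le_sup_right (mem_baseChange_inf.2 ⟨hT _ wb ub hwb hub hb, hwb⟩))

/-- Strictness of morphisms on subobjects. -/
lemma IsSub.map_inf_W {S : Submodule ℚ H.V} (hS : H.IsSub S) (g : Hom H H') (k : ℤ) {x : H.V}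
    (hx : x ∈ S) (hk : g.toLin x ∈ H'.W k) : ∃ s ∈ S ⊓ H.W k, g.toLin s = g.toLin x := by
  rw [← Submodule.mem_map]
  rw [W_even] at hk ⊢
  obtain ⟨w, hw, u, hu, hwu⟩ := H.exists_W_add_F (k / 2) (1 ⊗ₜ x)
  have h1 : g.toLin.baseChange ℂ w + g.toLin.baseChange ℂ u = 1 ⊗ₜ g.toLin x := by
    rw [← map_add, hwu, LinearMap.baseChange_tmul]
  -- The image of `x` is its own projection, so the weight part `w` of `x` has the same image as
  -- `x`; membership in the image of `S ⊓ W_k` then descends from `ℂ` to `ℚ`.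
  have h2 := H'.W_add_F_unique (k / 2) (g.map_baseChange_W _ hw) (one_tmul_mem_baseChange.2 hk)
    (g.map_F _ _ hu) (zero_mem _) (by rw [h1, add_zero])
  rw [← one_tmul_mem_baseChange, ← h2]
  refine baseChange_mem _ _ _ (fun x hx => Submodule.mem_map_of_mem hx) _
    (mem_baseChange_inf.2 ⟨hS _ w u hw hu ?_, hw⟩)
  rw [hwu]
  exact one_tmul_mem_baseChange.2 hx

/-- A Hodge–Tate structure from a weight filtration and a complementary Hodge filtration. -/
def ofCompl (V : Type) [AddCommGroup V] [Module ℚ V] [FiniteDimensional ℚ V]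
    (W : ℤ → Submodule ℚ V) (F : ℤ → Submodule ℂ (ℂ ⊗[ℚ] V)) (W_mono : Monotone W)
    (W_bot : ∃ k, W k = ⊥) (W_top : ∃ k, W k = ⊤) (F_anti : Antitone F)
    (W_odd : ∀ k, W (2 * k + 1) = W (2 * k))
    (disj : ∀ j, F (j + 1) ⊓ (W (2 * j)).baseChange ℂ ≤ ⊥)
    (codisj : ∀ j, ⊤ ≤ F (j + 1) ⊔ (W (2 * j)).baseChange ℂ) : HTStructure where
  V := V
  W := W
  F := F
  W_mono := W_mono
  W_bot := W_bot
  W_top := W_top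
  F_anti := F_anti
  F_bot := by
    obtain ⟨k, hk⟩ := W_top
    -- The index `2 * |k|` is even and at least `k`, whatever the sign and parity of `k`.
    have hk : W (2 * |k|) = ⊤ := top_le_iff.1 (hk ▸ W_mono (by
      have := le_abs_self k
      have := abs_nonneg k
      omega))
    refine ⟨|k| + 1, le_bot_iff.1 ?_⟩
    simpa [hk] using disj |k|
  F_top := by
    obtain ⟨k, hk⟩ := W_bot
    have hk : W (2 * -|k|) = ⊥ := le_bot_iff.1 (hk ▸ W_mono (by
      have := neg_abs_le k
      have := abs_nonneg k
      omega))
    refine ⟨-|k| + 1, ?_⟩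
    have := codisj (-|k|)
    rwa [hk, Submodule.baseChange_bot, sup_bot_eq, top_le_iff] at this
  W_odd := W_odd
  F_gr_top k := by
    intro z hz
    -- Splitting at `k - 1` puts one part in `F^k` and the other in `W_{2k-2}`, which equals
    -- `W_{2k-1}` because odd weights are absent.
    have h1 := codisj (k - 1) (Submodule.mem_top (x := z))
    obtain ⟨u, hu, w, hw, rfl⟩ := Submodule.mem_sup.1 h1
    have hW : W (2 * k - 1) = W (2 * (k - 1)) := by
      rw [← W_odd]; congr 1; ring
    rw [hW]
    refine Submodule.mem_sup.2 ⟨u, ⟨by simpa using hu, ?_⟩, w, hw, rfl⟩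
    have := sub_mem hz (Submodule.baseChange_mono ℂ (W_mono (by omega : 2 * (k - 1) ≤ 2 * k)) hw)
    rwa [add_sub_cancel_right] at this
  F_gr_bot k := (disj k).trans bot_le

/-- The Hodge–Tate structure on a subobject. -/
def sub (H : HTStructure) (S : Submodule ℚ H.V) (hS : H.IsSub S) : HTStructure :=
  ofCompl S (fun k => (H.W k).comap S.subtype) (fun p => (H.F p).comap (S.subtype.baseChange ℂ))
    (fun _ _ h => Submodule.comap_mono (H.W_mono h))
    (by
      obtain ⟨k, hk⟩ := H.W_bot
      exact ⟨k, by simp [hk]⟩)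
    (by
      obtain ⟨k, hk⟩ := H.W_top
      exact ⟨k, by simp [hk]⟩)
    (fun _ _ h => Submodule.comap_mono (H.F_anti h))
    (fun k => by rw [H.W_odd])
    (fun j z hz => by
      have h1 := (H.F_inf_W j).le ⟨hz.1, (mem_baseChange_comap _ _ _).1 hz.2⟩
      exact baseChange_injective S.injective_subtype (h1.trans (map_zero _).symm))
    -- Only here is stability of `S` needed: the weight part of a vector of `S` comes from `S`,
    -- hence so does its Hodge part.
    (fun j z _ => by
      obtain ⟨w, hw, u, hu, hwu⟩ := H.exists_W_add_F j (S.subtype.baseChange ℂ z)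
      obtain ⟨w', rfl⟩ := hS j w u hw hu (hwu ▸ ⟨z, rfl⟩)
      refine Submodule.mem_sup.2 ⟨z - w', ?_, w', (mem_baseChange_comap _ _ _).2 hw, by abel⟩
      change S.subtype.baseChange ℂ (z - w') ∈ H.F (j + 1)
      rw [map_sub, ← hwu]
      convert hu using 1
      exact add_sub_cancel_left _ _)

/-- The inclusion of a subobject. -/
def subHom (H : HTStructure) (S : Submodule ℚ H.V) (hS : H.IsSub S) : Hom (H.sub S hS) H where
  toLin := S.subtype
  map_W _ _ hx := hx
  map_F _ _ hz := hz

/-- The inverse of a bijective morphism. -/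
def Hom.inverse (g : Hom H H') (hg : Function.Bijective g.toLin) : Hom H' H where
  toLin := (LinearEquiv.ofBijective g.toLin hg).symm.toLinearMap
  map_W k y hy := by
    obtain ⟨x, rfl⟩ := hg.2 y
    obtain ⟨s, hs, e⟩ := H.isSub_top.map_inf_W g k Submodule.mem_top hy
    have : (LinearEquiv.ofBijective g.toLin hg).symm (g.toLin x) = x :=
      (LinearEquiv.ofBijective g.toLin hg).symm_apply_apply x
    rw [LinearEquiv.coe_coe, this, ← hg.1 e]
    exact hs.2
  map_F p z hz := by
    -- Split the preimage of `z` at `p - 1`. The image of its weight part `w` is the weight part of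
    -- `z`, which is `0` as `z` lies in `F^p`; so `w = 0` and the preimage lies in `F^p`.
    obtain ⟨w, hw, u, hu, hwu⟩ := H.exists_W_add_F (p - 1)
      ((LinearEquiv.ofBijective g.toLin hg).symm.toLinearMap.baseChange ℂ z)
    rw [sub_add_cancel] at hu
    have h1 : g.toLin.baseChange ℂ w + g.toLin.baseChange ℂ u = z := by
      rw [← map_add, hwu, baseChange_comp_eq _ _ LinearMap.id
        (LinearMap.ext fun x => (LinearEquiv.ofBijective g.toLin hg).apply_symm_apply x)]
      simp
    have h2 := H'.W_add_F_unique (p - 1) (g.map_baseChange_W _ hw) (zero_mem _)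
      (g.map_F _ _ (by rwa [sub_add_cancel])) (by rwa [sub_add_cancel]) (h1.trans (zero_add z).symm)
    have h3 : w = 0 := baseChange_injective hg.1 (h2.trans (map_zero _).symm)
    rwa [← hwu, h3, zero_add]

end Splitting

end HTStructure

/-! ### Separation of a framing by a subobject, as a consequence of `[H, v, f] = 0`. -/

namespace HTStructure

variable {H H' : HTStructure}

/-- Some subobject of `H` contains `v` in its `gr^W_a` and is killed by `f` on its `gr^W_b`. -/
def Separated {a b : ℤ} (v : H.gr a) (f : H.gr b →ₗ[ℚ] ℚ) : Prop :=
  ∃ S, H.IsSub S ∧ (∃ x : H.W a, x.1 ∈ S ∧ Submodule.Quotient.mk x = v) ∧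
    ∀ y : H.W b, y.1 ∈ S → f (Submodule.Quotient.mk y) = 0

/-- Separating subobjects are pushed forward by images and pulled back by preimages. Strictness is
essential in both directions: elements of `g(S) ∩ W_b` must come from `S ∩ W_b`, and a lift of the
image vector must be corrected by an element of lower weight. -/
lemma separated_hom (g : Hom H H') {a b : ℤ} (v : H.gr a) (f : H'.gr b →ₗ[ℚ] ℚ) :
    Separated v (f ∘ₗ g.gr b) ↔ Separated (g.gr a v) f := by
  constructor
  · rintro ⟨S, hS, ⟨x, hx, rfl⟩, hf⟩
    refine ⟨S.map g.toLin, hS.map g, ⟨⟨g.toLin x, g.map_W a _ x.2⟩, ⟨_, hx, rfl⟩, rfl⟩, ?_⟩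
    rintro ⟨_, hy⟩ ⟨s, hs, rfl⟩
    obtain ⟨s', hs', e⟩ := hS.map_inf_W g b hs hy
    have := hf ⟨s', hs'.2⟩ hs'.1
    rw [LinearMap.comp_apply, Hom.gr_mk] at this
    rw [← this]
    exact congrArg f (congrArg Submodule.Quotient.mk (Subtype.ext e.symm))
  · rintro ⟨S, hS, ⟨x', hx', e⟩, hf⟩
    refine ⟨S.comap g.toLin, hS.comap g, ?_, fun y hy => hf ⟨g.toLin y, g.map_W b _ y.2⟩ hy⟩
    induction v using Submodule.Quotient.induction_on with
    | H x =>
      rw [Hom.gr_mk, eq_comm, Submodule.Quotient.eq] at e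
      have e : g.toLin x.1 - x'.1 ∈ H'.W (a - 1) := e
      -- The defect `g(x) - x'` lies in `W_{a-1}` and in `im g + S`. Strictness writes it as `g(s) +
      -- t` with both terms in `W_{a-1}`, and strictness of `g` replaces `s` by `s'` in `W_{a-1}`;
      -- then `x - s'` is a lift of the same class that maps into `S`.
      obtain ⟨_, ⟨⟨s, -, rfl⟩, hs⟩, t, ht, hst⟩ := (H.isSub_top.map g).sup_inf_W hS (a - 1)
        (Submodule.sub_mem_sup (Submodule.mem_map_of_mem Submodule.mem_top) hx') e
      obtain ⟨s', hs', e'⟩ := H.isSub_top.map_inf_W g (a - 1) Submodule.mem_top hs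
      refine ⟨⟨x.1 - s', sub_mem x.2 (H.W_mono (by omega) hs'.2)⟩, ?_, ?_⟩
      · change g.toLin (x.1 - s') ∈ S
        rw [map_sub, e']
        have : g.toLin x.1 - g.toLin s = x'.1 + t := by
          rw [sub_eq_iff_eq_add, add_assoc, add_comm t, hst]; abel
        rw [this]
        exact add_mem hx' ht.1
      · rw [Submodule.Quotient.eq]
        change x.1 - s' - x.1 ∈ H.W (a - 1)
        rw [sub_sub_cancel_left]
        exact neg_mem hs'.2

lemma separated_zero_left {a b : ℤ} (f : H.gr b →ₗ[ℚ] ℚ) : Separated (0 : H.gr a) f :=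
  ⟨⊥, H.isSub_bot, ⟨0, zero_mem _, rfl⟩, fun y hy => by
    have : y = 0 := Subtype.ext hy
    rw [this]
    exact map_zero f⟩

lemma separated_zero_right {a b : ℤ} (v : H.gr a) : Separated v (0 : H.gr b →ₗ[ℚ] ℚ) := by
  induction v using Submodule.Quotient.induction_on with
  | H x => exact ⟨⊤, H.isSub_top, ⟨x, trivial, rfl⟩, fun _ _ => rfl⟩

/-- If `[H, v, f] = 0`, then a subobject of `H` separates `v` from `f`. -/
lemma separated_of_cls_eq_zero {n : ℕ} {v : H.gr 0} {f : H.gr (-2 * (n : ℤ)) →ₗ[ℚ] ℚ}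
    (h : HTn.cls H v f = 0) : Separated v f := by
  by_cases hvf : v ≠ 0 ∧ f ≠ 0
  swap
  · have : v = 0 ∨ f = 0 := by tauto
    rcases this with rfl | rfl
    · exact separated_zero_left f
    · exact separated_zero_right v
  -- Invariance under morphisms makes separation a predicate on classes, so it suffices to check it
  -- on the representative `ℚ(0) ⊕ ℚ(n)` of zero.
  let N : HTn n → Prop := Quot.lift (fun X => Separated X.v X.f) (by
    rintro X Y ⟨g, hv, hf⟩
    exact propext (by rw [← hv, ← hf]; exact separated_hom g X.v Y.f))
  have h0 : N 0 := by
    change Separated (HTn.zeroF n).v (HTn.zeroF n).f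
    -- The separating subobject is the summand `ℚ(0)`.
    refine ⟨_, (isSub_top (tate 0)).map (Hom.inl (tate 0) (tate n)), ?_, ?_⟩
    · refine ⟨⟨((1 : ℚ), (0 : ℚ)), Submodule.mem_prod.2 ⟨?_, zero_mem _⟩⟩, ⟨(1 : ℚ), trivial, rfl⟩,
        ?_⟩
      · rw [tate_W_top (by omega)]; trivial
      · apply gr_sum_ext
        · simp only [HTn.zeroF, fst_sumVec]; rfl
        · simp only [HTn.zeroF, snd_sumVec]; rfl
    · rintro ⟨_, hy⟩ ⟨q, -, rfl⟩
      simp only [HTn.zeroF, sumCov_apply, LinearMap.zero_apply, zero_add]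
      exact map_zero (tateVal n _ rfl)
  rw [← h, HTn.cls_eq_mk ⟨H, v, f, hvf.1, hvf.2⟩] at h0
  exact h0

lemma separated_of_shiftCls_eq_zero {m n : ℤ} {d : ℕ} (h : m + d = n) {v : H.gr (-2 * m)}
    {f : H.gr (-2 * n) →ₗ[ℚ] ℚ} (h0 : H.shiftCls m n d h v f = 0) : Separated v f := by
  rw [shiftCls_apply] at h0
  obtain ⟨S, hS, ⟨x, hx, e⟩, hf⟩ := separated_of_cls_eq_zero h0
  refine ⟨S, hS.of_twist, ?_, fun y hy => ?_⟩
  · refine ⟨⟨x.1, ?_⟩, hx, ?_⟩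
    · have : x.1 ∈ H.W (0 + 2 * -m) := x.2
      rwa [show 0 + 2 * -m = -2 * m by ring] at this
    · rw [← H.ofTwist_toTwist (-m) (a := -2 * m) (b := 0) (by ring) v, ← e]
      rfl
  · exact hf ⟨y.1, by
      change y.1 ∈ H.W (-2 * (d : ℤ) + 2 * -m)
      rw [show -2 * (d : ℤ) + 2 * -m = -2 * n by rw [← h]; ring]
      exact y.2⟩ hy

end HTStructure

/-! ### Extensions of `ℚ(0)` by `ℚ(n)` and their periods. -/

namespace HTStructure

/-- The Hodge filtration on `ℂ ⊗ (ℚ e₀ ⊕ ℚ eₙ)` with `F^0` spanned by `e₀ + z eₙ`. -/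
def periodF (n : ℕ) (z : ℂ) (p : ℤ) : Submodule ℂ (ℂ ⊗[ℚ] (ℚ × ℚ)) :=
  if p ≤ -(n : ℤ) then ⊤ else
    if p ≤ 0 then Submodule.span ℂ {1 ⊗ₜ (1, 0) + z ⊗ₜ (0, 1)} else ⊥

/-- The weight filtration on `ℚ e₀ ⊕ ℚ eₙ`. -/
def periodW (n : ℕ) (k : ℤ) : Submodule ℚ (ℚ × ℚ) :=
  (if 0 ≤ k then ⊤ else ⊥ : Submodule ℚ ℚ).prod (if -2 * (n : ℤ) ≤ k then ⊤ else ⊥)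

lemma periodF_top {n : ℕ} {z : ℂ} {p : ℤ} (h : p ≤ -(n : ℤ)) : periodF n z p = ⊤ := if_pos h

lemma periodF_mid {n : ℕ} {z : ℂ} {p : ℤ} (h : -(n : ℤ) < p) (h' : p ≤ 0) :
    periodF n z p = Submodule.span ℂ {1 ⊗ₜ (1, 0) + z ⊗ₜ (0, 1)} := by
  rw [periodF, if_neg (by omega), if_pos h']

lemma periodF_bot {n : ℕ} {z : ℂ} {p : ℤ} (h : 0 < p) : periodF n z p = ⊥ := by
  rw [periodF, if_neg (by omega), if_neg (by omega)]

lemma periodW_top {n : ℕ} {k : ℤ} (h : 0 ≤ k) : periodW n k = ⊤ := by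
  rw [periodW, if_pos h, if_pos (by omega), Submodule.prod_top]

lemma periodW_mid {n : ℕ} {k : ℤ} (h : k < 0) (h' : -2 * (n : ℤ) ≤ k) :
    periodW n k = (⊥ : Submodule ℚ ℚ).prod ⊤ := by
  rw [periodW, if_neg (by omega), if_pos h']

lemma periodW_bot {n : ℕ} {k : ℤ} (h : k < -2 * (n : ℤ)) : periodW n k = ⊥ := by
  rw [periodW, if_neg (by omega), if_neg (by omega), Submodule.prod_bot]

lemma tmul_one_eq_zero {a : ℂ} (h : a ⊗ₜ[ℚ] (1 : ℚ) = 0) : a = 0 := by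
  have := congrArg (TensorProduct.rid ℚ ℂ) h
  simpa using this

lemma exists_tmul_one (z : ℂ ⊗[ℚ] ℚ) : ∃ a : ℂ, a ⊗ₜ[ℚ] (1 : ℚ) = z :=
  ⟨TensorProduct.rid ℚ ℂ z, by
    rw [← TensorProduct.rid_symm_apply, LinearEquiv.symm_apply_apply]⟩

lemma exists_tmul_pair (z : ℂ ⊗[ℚ] (ℚ × ℚ)) :
    ∃ a b : ℂ, a ⊗ₜ[ℚ] ((1, 0) : ℚ × ℚ) + b ⊗ₜ[ℚ] ((0, 1) : ℚ × ℚ) = z := by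
  obtain ⟨a, ha⟩ := exists_tmul_one ((LinearMap.fst ℚ ℚ ℚ).baseChange ℂ z)
  obtain ⟨b, hb⟩ := exists_tmul_one ((LinearMap.snd ℚ ℚ ℚ).baseChange ℂ z)
  refine ⟨a, b, ?_⟩
  rw [← sum_decomp z, ← ha, ← hb]
  rfl

/-- The Hodge–Tate structure `ℚ e₀ ⊕ ℚ eₙ` with period `z`: its subspace `F^0` is spanned by
`e₀ + z eₙ`. -/
def period (n : ℕ) (z : ℂ) : HTStructure :=
  ofCompl (ℚ × ℚ) (periodW n) (periodF n z)
    (fun a b h => Submodule.prod_mono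
      (by split_ifs <;> first | exact le_rfl | exact bot_le | exact le_top | (exfalso; omega))
      (by split_ifs <;> first | exact le_rfl | exact bot_le | exact le_top | (exfalso; omega)))
    ⟨-2 * n - 1, periodW_bot (by omega)⟩ ⟨0, periodW_top le_rfl⟩
    (fun a b h => by
      rcases le_or_gt a (-(n : ℤ)) with h1 | h1
      · rw [periodF_top h1]; exact le_top
      rcases le_or_gt b 0 with h2 | h2
      · rw [periodF_mid (by omega) h2, periodF_mid h1 (by omega)]
      · rw [periodF_bot h2]; exact bot_le)
    (fun k => by
      rw [periodW, periodW]
      congr 1 <;> split_ifs <;> first | rfl | (exfalso; omega))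
    -- In the ranges `j < -n`, `-n ≤ j < 0` and `0 ≤ j`, the step `W_{2j}` is zero, the line of `eₙ`
    -- and everything. In the middle range `F^{j+1}` is the line of `e₀ + z eₙ`, which meets the
    -- line of `eₙ` trivially, as the `e₀`-coordinate shows.
    (fun j => by
      rcases lt_or_ge j (-(n : ℤ)) with h1 | h1
      · rw [periodW_bot (by omega), Submodule.baseChange_bot]; exact inf_le_right
      rcases lt_or_ge j 0 with h2 | h2
      · rw [periodF_mid (by omega) (by omega), periodW_mid (by omega) (by omega)]
        rintro w ⟨hF, hW⟩
        obtain ⟨a, rfl⟩ := Submodule.mem_span_singleton.1 hF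
        have h3 := fst_mem _ _ _ hW
        rw [Submodule.baseChange_bot, Submodule.mem_bot, map_smul, map_add,
          LinearMap.baseChange_tmul, LinearMap.baseChange_tmul] at h3
        have h4 : a ⊗ₜ[ℚ] (1 : ℚ) = 0 := by
          rw [← h3]; simp [TensorProduct.smul_tmul']
        rw [tmul_one_eq_zero h4, zero_smul]
        exact zero_mem _
      · rw [periodF_bot (by omega)]; exact inf_le_left)
    (fun j => by
      rcases lt_or_ge j (-(n : ℤ)) with h1 | h1
      · rw [periodF_top (by omega)]; exact le_sup_left
      rcases lt_or_ge j 0 with h2 | h2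
      · rw [periodF_mid (by omega) (by omega), periodW_mid (by omega) (by omega)]
        intro w _
        obtain ⟨a, b, rfl⟩ := exists_tmul_pair w
        -- The identity `a e₀ + b eₙ = a (e₀ + z eₙ) + (b - a z) eₙ`.
        refine Submodule.mem_sup.2 ⟨a • (1 ⊗ₜ (1, 0) + z ⊗ₜ (0, 1)),
          Submodule.smul_mem _ _ (Submodule.mem_span_singleton_self _), (b - a * z) ⊗ₜ (0, 1),
          Submodule.tmul_mem_baseChange_of_mem _ ⟨rfl, trivial⟩, ?_⟩
        rw [smul_add, TensorProduct.smul_tmul', TensorProduct.smul_tmul', smul_eq_mul, mul_one,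
          smul_eq_mul, add_assoc, ← TensorProduct.add_tmul, add_sub_cancel]
      · rw [periodW_top (by omega), Submodule.baseChange_top]; exact le_sup_right)

/-- The extension of `ℚ(0)` by `ℚ(n)` with period `z`. -/
def periodExtension (n : ℕ) (z : ℂ) : Extension (tate 0) (tate n) where
  E := period n z
  i :=
    { toLin := LinearMap.inr ℚ ℚ ℚ
      map_W := fun k x hx => by
        change _ ∈ periodW n k
        refine Submodule.mem_prod.2 ⟨zero_mem _, hx⟩
      map_F := fun p w hw => by
        change _ ∈ periodF n z p
        rcases le_or_gt p (-(n : ℤ)) with h | h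
        · rw [periodF_top h]; trivial
        · rw [tate_F_bot h] at hw
          have hw : w = 0 := hw
          rw [hw, map_zero]; exact zero_mem _ }
  p :=
    { toLin := LinearMap.fst ℚ ℚ ℚ
      map_W := fun k x hx => (Submodule.mem_prod.1 (show x ∈ periodW n k from hx)).1
      map_F := fun p w hw => by
        have hw : w ∈ periodF n z p := hw
        rcases le_or_gt p 0 with h | h
        · have : (tate 0).F p = ⊤ := if_pos (by omega)
          rw [this]; trivial
        · exact Set.mem_of_eq_of_mem
            ((congrArg ((LinearMap.fst ℚ ℚ ℚ).baseChange ℂ) ((periodF_bot h).le hw)).trans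
              (map_zero _)) (zero_mem _) }
  inj := show Function.Injective (LinearMap.inr ℚ ℚ ℚ) from LinearMap.inr_injective
  surj := show Function.Surjective (LinearMap.fst ℚ ℚ ℚ) from LinearMap.fst_surjective
  exact x := by
    constructor
    · intro h
      exact ⟨x.2, Prod.ext h.symm rfl⟩
    · rintro ⟨a, rfl⟩
      rfl

lemma pairing_mem_F {n : ℕ} {z : ℂ} {H : HTStructure} {x y : H.V} (hF : H.F (-n) = ⊤)
    (hz : 1 ⊗ₜ x + z ⊗ₜ y ∈ H.F 0) {p : ℤ} {w : ℂ ⊗[ℚ] (ℚ × ℚ)} (hw : w ∈ periodF n z p) :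
    ((LinearMap.toSpanSingleton ℚ H.V x).coprod
      (LinearMap.toSpanSingleton ℚ H.V y)).baseChange ℂ w ∈ H.F p := by
  rcases le_or_gt p (-(n : ℤ)) with h | h
  · have := H.F_anti h
    rw [hF] at this
    exact this trivial
  rcases le_or_gt p 0 with h' | h'
  · rw [periodF_mid h h'] at hw
    obtain ⟨a, rfl⟩ := Submodule.mem_span_singleton.1 hw
    rw [map_smul]
    refine Submodule.smul_mem _ _ (H.F_anti h' ?_)
    convert hz using 1
    rw [map_add, LinearMap.baseChange_tmul, LinearMap.baseChange_tmul]
    simp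
  · rw [periodF_bot h', Submodule.mem_bot] at hw
    rw [hw, map_zero]
    exact zero_mem _

/-- The morphism out of a structure `ℚ e₀ ⊕ ℚ eₙ` with given values on `e₀` and `eₙ`. -/
def periodHom (n : ℕ) (z : ℂ) (H : HTStructure) (x y : H.V) (hx : x ∈ H.W 0)
    (hy : y ∈ H.W (-2 * n)) (hF : H.F (-n) = ⊤) (hz : 1 ⊗ₜ x + z ⊗ₜ y ∈ H.F 0) :
    Hom (period n z) H where
  toLin := (LinearMap.toSpanSingleton ℚ H.V x).coprod (LinearMap.toSpanSingleton ℚ H.V y)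
  map_W k := by
    rintro ⟨a, b⟩ hab
    change (a, b) ∈ periodW n k at hab
    change a • x + b • y ∈ H.W k
    rcases le_or_gt 0 k with h | h
    · exact H.W_mono h (add_mem (Submodule.smul_mem _ _ hx)
        (Submodule.smul_mem _ _ (H.W_mono (by omega) hy)))
    rcases le_or_gt (-2 * (n : ℤ)) k with h' | h'
    · rw [periodW_mid h h'] at hab
      have : a = 0 := hab.1
      rw [this, zero_smul, zero_add]
      exact Submodule.smul_mem _ _ (H.W_mono h' hy)
    · rw [periodW_bot h'] at hab
      obtain ⟨rfl, rfl⟩ := Prod.ext_iff.1 hab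
      simp
  map_F _ _ hw := pairing_mem_F hF hz hw

namespace Extension

variable {n : ℕ} (X : Extension (tate 0) (tate n))

lemma W_eq_bot {k : ℤ} (hk : k < -2 * (n : ℤ)) : X.E.W k = ⊥ := by
  rw [← le_bot_iff]
  intro x hx
  have h1 : X.p.toLin x = 0 := by
    have := X.p.map_W k x hx
    rwa [tate_W_bot (by omega)] at this
  obtain ⟨a, rfl⟩ := (X.exact x).1 h1
  have := X.strict_i hx
  rw [tate_W_bot hk] at this
  have h0 : a = 0 := this
  rw [h0, map_zero]
  exact zero_mem _

lemma mem_range_i {k : ℤ} (hk : k < 0) {x : X.E.V} (hx : x ∈ X.E.W k) :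
    ∃ a : (tate n).V, X.i.toLin a = x := by
  have := X.p.map_W k x hx
  rw [tate_W_bot (by omega)] at this
  exact (X.exact x).1 this

lemma i_mem_W (a : (tate n).V) : X.i.toLin a ∈ X.E.W (-2 * n) :=
  X.i.map_W _ _ (by rw [tate_W_top le_rfl]; trivial)

/-- The lowest weight is `-2n`, so the complement `W_{2(-n-1)}` of `F^{-n}` is zero. -/
lemma F_eq_top : X.E.F (-n) = ⊤ := by
  have := X.E.F_sup_W (-n)
  rwa [X.W_eq_bot (by omega), Submodule.baseChange_bot, sup_bot_eq] at this

lemma smul_i_one (q : ℚ) : q • X.i.toLin (1 : ℚ) = X.i.toLin q :=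
  (X.i.toLin.map_smul q (1 : ℚ)).symm.trans (congrArg X.i.toLin (mul_one q))

lemma p_smul {x : X.E.V} (hp : X.p.toLin x = (1 : ℚ)) (a : ℚ) : X.p.toLin (a • x) = a := by
  rw [map_smul, hp]
  exact mul_one a

lemma exists_add_i {x : X.E.V} (hp : X.p.toLin x = (1 : ℚ)) (y : X.E.V) :
    ∃ a b : ℚ, a • x + X.i.toLin b = y := by
  obtain ⟨a, ha⟩ : ∃ a : ℚ, X.p.toLin (a • x) = X.p.toLin y :=
    ⟨X.p.toLin y, X.p_smul hp _⟩
  obtain ⟨b, hb⟩ := (X.exact (y - a • x)).1 (by rw [map_sub, ha, sub_self])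
  exact ⟨a, b, by rw [hb, add_sub_cancel]⟩

lemma p_smul_add_i {x : X.E.V} (hp : X.p.toLin x = (1 : ℚ)) (a b : ℚ) :
    X.p.toLin (a • x + X.i.toLin b) = a := by
  rw [map_add, X.p_smul hp, (X.exact _).2 ⟨b, rfl⟩]
  exact add_zero a

/-- An extension is determined by its period. -/
lemma mk_eq_periodExtension (z : ℂ) (x : X.E.V) (hx : x ∈ X.E.W 0)
    (hp : X.p.toLin x = (1 : ℚ)) (hz : 1 ⊗ₜ x + z ⊗ₜ X.i.toLin (1 : ℚ) ∈ X.E.F 0) :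
    (Quotient.mk _ (periodExtension n z) : Ext1 (tate 0) (tate n)) = Quotient.mk _ X := by
  -- Sending `e₀` to `x` and `eₙ` to the image of the generator of `ℚ(n)` respects `F` because `F^0`
  -- contains `x + z i(1)`. Strictness makes the inverse of this bijective morphism a morphism.
  let g := periodHom n z X.E x (X.i.toLin (1 : ℚ)) hx (X.i_mem_W _) X.F_eq_top hz
  have hg : ∀ a b : ℚ, g.toLin ((a, b) : ℚ × ℚ) = a • x + X.i.toLin b := fun a b => by
    rw [← X.smul_i_one b]; rfl
  have hpg : ∀ a b : ℚ, X.p.toLin (g.toLin ((a, b) : ℚ × ℚ)) = a := fun a b =>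
    (congrArg X.p.toLin (hg a b)).trans (X.p_smul_add_i hp a b)
  have bij : Function.Bijective g.toLin := by
    constructor
    · rw [← LinearMap.ker_eq_bot, LinearMap.ker_eq_bot']
      rintro ⟨a, b⟩ h
      have ha : a = (0 : ℚ) := (hpg a b).symm.trans ((congrArg X.p.toLin h).trans (map_zero _))
      subst ha
      have hb : X.i.toLin b = 0 := by
        rw [← h]
        exact ((hg 0 b).trans (by rw [zero_smul, zero_add])).symm
      exact Prod.ext rfl (X.inj (hb.trans (map_zero _).symm))
    · intro y
      obtain ⟨a, b, rfl⟩ := X.exists_add_i hp y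
      exact ⟨((a, b) : ℚ × ℚ), hg a b⟩
  refine Quotient.sound ⟨g, g.inverse bij, ?_, ?_, ?_, ?_⟩
  · exact LinearMap.ext fun y => (LinearEquiv.ofBijective g.toLin bij).symm_apply_apply y
  · exact LinearMap.ext fun y => (LinearEquiv.ofBijective g.toLin bij).apply_symm_apply y
  · refine LinearMap.ext fun b => ?_
    exact (hg 0 b).trans (by rw [zero_smul, zero_add])
  · exact LinearMap.ext fun y => hpg y.1 y.2

end Extension

end HTStructure

/-! ### Injectivity of `ι_n`. -/

namespace HTStructure

namespace Extension

variable {n : ℕ}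

lemma p_eq_one {n : ℤ} (hn : 0 < n) (X : Extension (tate 0) (tate n)) {x : X.E.W 0}
    (hx : Submodule.Quotient.mk x = X.vec hn) : X.p.toLin x.1 = (1 : ℚ) := by
  have h := X.p_vec hn
  rw [← hx] at h
  exact congrArg (tateVal 0 0 rfl) h

lemma mk_eq_vec {n : ℤ} (hn : 0 < n) (X : Extension (tate 0) (tate n)) {x : X.E.W 0}
    (hx : X.p.toLin x.1 = (1 : ℚ)) : Submodule.Quotient.mk x = X.vec hn := by
  refine (X.gr_zero_bijective hn).1 ?_
  rw [X.p_vec hn, Hom.gr_mk]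
  exact congrArg Submodule.Quotient.mk (Subtype.ext hx)

lemma cov_mk {n : ℤ} (hn : 0 < n) (X : Extension (tate 0) (tate n)) (q : ℚ)
    (h : X.i.toLin q ∈ X.E.W (-2 * n)) :
    X.cov hn (Submodule.Quotient.mk ⟨X.i.toLin q, h⟩) = q :=
  X.cov_i hn (Submodule.Quotient.mk ⟨q, by rw [tate_W_top le_rfl]; trivial⟩)

end Extension

lemma iota_mk (n : ℕ) (hn : 0 < n) (X : Extension (tate 0) (tate n)) :
    iota n hn (Quotient.mk _ X) =
      HTn.cls X.E (X.vec (by omega)) (X.cov (by omega)) :=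
  (HTn.cls_eq_mk (X.framed n hn)).symm

lemma cls_sub_cls {H H' : HTStructure} {n : ℕ} (v : H.gr 0) (v' : H'.gr 0)
    (f : H.gr (-2 * (n : ℤ)) →ₗ[ℚ] ℚ) (f' : H'.gr (-2 * (n : ℤ)) →ₗ[ℚ] ℚ) :
    HTn.cls H v f - HTn.cls H' v' f' = HTn.cls (H.sum H') (sumVec v v') (sumCov f (-f')) := by
  rw [← HTn.cls_add_cls, sub_eq_add_neg, ← neg_one_smul ℚ (HTn.cls H' v' f'), HTn.smul_cls,
    neg_one_smul]

/-- Equal classes give a subobject `S` of the direct sum that behaves like a graph: it contains a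
lift of both weight-`0` generators, and it meets `W_{-2}` only in the diagonal `ℚ(n)`. Comparing
Hodge filtrations along it shows that the two extensions share a period. -/
lemma iota_injective (n : ℕ) (hn : 0 < n) : Function.Injective (iota n hn) := by
  intro ξ η h
  induction ξ using Quotient.inductionOn with | h X
  induction η using Quotient.inductionOn with | h Y
  have hn' : (0 : ℤ) < n := by omega
  rw [iota_mk, iota_mk, ← sub_eq_zero, cls_sub_cls] at h
  obtain ⟨S, hS, ⟨x, hxS, hx⟩, hf⟩ := separated_of_cls_eq_zero h
  have hx1 := congrArg ((Hom.fst _ _).gr 0) hx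
  have hx2 := congrArg ((Hom.snd _ _).gr 0) hx
  rw [fst_sumVec, Hom.gr_mk] at hx1
  rw [snd_sumVec, Hom.gr_mk] at hx2
  obtain ⟨w, hw, u, hu, hwu⟩ := (X.E.sum Y.E).exists_W_add_F (-1) (1 ⊗ₜ x.1)
  have hwS := hS (-1) w u hw hu (hwu ▸ one_tmul_mem_baseChange.2 hxS)
  let d : (tate n).V →ₗ[ℚ] (X.E.sum Y.E).V := (X.i.pair Y.i).toLin
  -- An element of negative weight has the form `(i(q), i(r))`, on which the difference covector
  -- takes the value `q - r`; it must vanish on `S`.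
  have hd : S ⊓ (X.E.sum Y.E).W (2 * -1) ≤ Submodule.map d ⊤ := by
    rintro ⟨a, b⟩ ⟨hab, hW⟩
    obtain ⟨q, rfl⟩ := X.mem_range_i (by norm_num) (Submodule.mem_prod.1 hW).1
    obtain ⟨r, rfl⟩ := Y.mem_range_i (by norm_num) (Submodule.mem_prod.1 hW).2
    have := hf ⟨(X.i.toLin q, Y.i.toLin r), Submodule.mem_prod.2 ⟨X.i_mem_W q, Y.i_mem_W r⟩⟩ hab
    rw [sumCov_apply, LinearMap.neg_apply] at this
    have h1 := X.cov_mk hn' q (X.i_mem_W q)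
    have h2 := Y.cov_mk hn' r (Y.i_mem_W r)
    have e : (q : ℚ) + -(r : ℚ) = 0 := (congrArg₂ (fun a b : ℚ => a + -b) h1 h2).symm.trans this
    have e : q = r := add_neg_eq_zero.1 e
    exact ⟨q, trivial, by rw [← e]; rfl⟩
  obtain ⟨a, ha⟩ : ∃ a : ℂ, a ⊗ₜ[ℚ] d (1 : ℚ) = w := by
    obtain ⟨c, -, hc⟩ := baseChange_map_exists d
      (Submodule.baseChange_mono ℂ hd (mem_baseChange_inf.2 ⟨hwS, hw⟩))
    obtain ⟨a, rfl⟩ := exists_tmul_one c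
    exact ⟨a, (LinearMap.baseChange_tmul _ _ _).symm.trans hc⟩
  -- The Hodge part of the lift is its value minus `a` times the diagonal generator. Both components
  -- of this vector lie in `F^0`, so both extensions have period `-a`.
  have hu' : u = 1 ⊗ₜ x.1 + (-a) ⊗ₜ d (1 : ℚ) := by
    rw [← hwu, ← ha, TensorProduct.neg_tmul]; abel
  have hu1 := (Hom.fst X.E Y.E).map_F 0 u hu
  have hu2 := (Hom.snd X.E Y.E).map_F 0 u hu
  rw [hu', map_add, LinearMap.baseChange_tmul, LinearMap.baseChange_tmul] at hu1 hu2
  rw [← X.mk_eq_periodExtension (-a) _ (Submodule.mem_prod.1 x.2).1 (X.p_eq_one hn' hx1) hu1,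
    ← Y.mk_eq_periodExtension (-a) _ (Submodule.mem_prod.1 x.2).2 (Y.p_eq_one hn' hx2) hu2]

end HTStructure

/-! ### Extensions of graded comodules and cocycles. -/

open HTStructure HTAlg

lemma tmul_left_injective {A V : Type*} [AddCommGroup A] [Module ℚ A] [AddCommGroup V]
    [Module ℚ V] {v : V} (hv : v ≠ 0) : Function.Injective fun a : A => a ⊗ₜ[ℚ] v := by
  obtain ⟨φ, hφ⟩ := Module.Projective.exists_dual_ne_zero ℚ hv
  intro a b h
  have := congrArg (fun z => TensorProduct.rid ℚ A (φ.lTensor A z)) h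
  simp only [LinearMap.lTensor_tmul, TensorProduct.rid_tmul] at this
  exact smul_right_injective A hφ this

lemma HTAlg.incl_injective (n : ℕ) : Function.Injective (incl n) :=
  fun _ _ h => DirectSum.of_injective n h

namespace GrComod

namespace Extension

variable {n : ℕ} (Y : Extension (triv 0) (triv n))

lemma i_eq_smul (q : ℚ) : Y.i.toLin q = q • Y.i.toLin (1 : ℚ) :=
  (congrArg Y.i.toLin (mul_one q)).symm.trans (Y.i.toLin.map_smul q (1 : ℚ))

lemma i_one_mem : Y.i.toLin (1 : ℚ) ∈ Y.E.gr n :=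
  Y.i.map_gr n (1 : ℚ) ((line_self (n : ℤ)).ge trivial)

lemma i_one_ne : Y.i.toLin (1 : ℚ) ≠ 0 := fun h =>
  one_ne_zero (α := ℚ) (Y.inj (h.trans (map_zero _).symm))

lemma p_i_one : Y.p.toLin (Y.i.toLin (1 : ℚ)) = (0 : ℚ) := (Y.exact _).2 ⟨_, rfl⟩

lemma p_eq_zero {m : ℤ} (hm : m ≠ 0) {y : Y.E.V} (hy : y ∈ Y.E.gr m) :
    Y.p.toLin y = (0 : ℚ) :=
  (line_ne hm).le (Y.p.map_gr m y hy)

lemma p_smul {e : Y.E.V} (he : Y.p.toLin e = (1 : ℚ)) (a : ℚ) : Y.p.toLin (a • e) = a := by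
  rw [map_smul, he]
  exact mul_one a

lemma eq_smul_i {y : Y.E.V} (hy : Y.p.toLin y = (0 : ℚ)) :
    ∃ q : ℚ, q • Y.i.toLin (1 : ℚ) = y := by
  obtain ⟨q, rfl⟩ := (Y.exact y).1 hy
  exact ⟨q, (Y.i_eq_smul q).symm⟩

lemma eq_zero_of_mem {m m' : ℤ} (h : m ≠ m') {y : Y.E.V} (hy : y ∈ Y.E.gr m)
    (hy' : y ∈ Y.E.gr m') : y = 0 :=
  Submodule.disjoint_def.1 (Y.E.gr_indep.pairwiseDisjoint h) y hy hy'

/-- Outside degree `0` the projection kills `y`, so `y` is a multiple of the generator of degree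
`n`; independence of the grading excludes every other degree. -/
lemma gr_eq_zero {m : ℤ} (h0 : m ≠ 0) (hn : m ≠ n) {y : Y.E.V} (hy : y ∈ Y.E.gr m) : y = 0 := by
  obtain ⟨q, rfl⟩ := Y.eq_smul_i (Y.p_eq_zero h0 hy)
  exact Y.eq_zero_of_mem hn hy (Submodule.smul_mem _ _ Y.i_one_mem)

lemma exists_smul_of_mem (hn : 0 < n) {e : Y.E.V} (he : e ∈ Y.E.gr 0)
    (hp : Y.p.toLin e = (1 : ℚ)) {y : Y.E.V} (hy : y ∈ Y.E.gr 0) : ∃ q : ℚ, q • e = y := by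
  obtain ⟨a, ha⟩ : ∃ a : ℚ, Y.p.toLin (a • e) = Y.p.toLin y := ⟨Y.p.toLin y, Y.p_smul hp _⟩
  obtain ⟨q, hq⟩ := Y.eq_smul_i (y := y - a • e) (by rw [map_sub, ha]; exact sub_self _)
  have h1 : y - a • e ∈ Y.E.gr 0 := sub_mem hy (Submodule.smul_mem _ _ he)
  have h2 : y - a • e ∈ Y.E.gr n := hq ▸ Submodule.smul_mem _ _ Y.i_one_mem
  have := Y.eq_zero_of_mem (by omega) h1 h2
  exact ⟨a, (sub_eq_zero.1 this).symm⟩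

/-- Take the degree-`0` component of any lift: the other components map to `0`. -/
lemma exists_lift : ∃ e ∈ Y.E.gr 0, Y.p.toLin e = (1 : ℚ) := by
  obtain ⟨x, hx⟩ := Y.surj (1 : ℚ)
  obtain ⟨f, hf, rfl⟩ := (Submodule.mem_iSup_iff_exists_finsupp _ _).1
    (Y.E.gr_span.ge (Submodule.mem_top (x := x)))
  refine ⟨f 0, hf 0, ?_⟩
  rw [← hx, Finsupp.sum, map_sum]
  refine (Finset.sum_eq_single 0 (fun m _ hm => Y.p_eq_zero hm (hf m)) fun h => ?_).symm
  rw [Finsupp.notMem_support_iff.1 h, map_zero]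

/-- The coaction on a lift of degree `0` of the generator of the quotient. -/
lemma exists_coact (hn : 0 < n) {e : Y.E.V} (he : e ∈ Y.E.gr 0) (hp : Y.p.toLin e = (1 : ℚ)) :
    ∃ γ : HTn n, Y.E.coact e = one ⊗ₜ e + incl n γ ⊗ₜ Y.i.toLin (1 : ℚ) := by
  let T : HTn 0 × HTn n →ₗ[ℚ] HTAlg ⊗[ℚ] Y.E.V :=
    ((TensorProduct.mk ℚ HTAlg Y.E.V).flip e ∘ₗ incl 0).coprod
      ((TensorProduct.mk ℚ HTAlg Y.E.V).flip (Y.i.toLin (1 : ℚ)) ∘ₗ incl n)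
  have hT : ∀ a b, T (a, b) = incl 0 a ⊗ₜ e + incl n b ⊗ₜ Y.i.toLin (1 : ℚ) := fun _ _ => rfl
  -- The middle term lives only in degrees `0` and `n`, so the degree condition confines the
  -- coaction of `e` to `ℋ_0 ⊗ e + ℋ_n ⊗ i(1)`.
  have h : (⨆ k : ℕ, LinearMap.range (TensorProduct.map (incl k) (Y.E.gr (0 + k)).subtype)) ≤
      LinearMap.range T := by
    refine iSup_le fun k => ?_
    rintro _ ⟨z, rfl⟩
    induction z using TensorProduct.induction_on with
    | zero => rw [map_zero]; exact zero_mem _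
    | add x y hx hy => rw [map_add]; exact add_mem hx hy
    | tmul a y =>
      rw [TensorProduct.map_tmul]
      obtain ⟨y, hy⟩ := y
      change incl k a ⊗ₜ y ∈ _
      rw [zero_add] at hy
      by_cases h0 : k = 0
      · subst h0
        obtain ⟨q, rfl⟩ := Y.exists_smul_of_mem hn he hp hy
        exact ⟨(q • a, 0), by
          rw [hT, map_zero, TensorProduct.zero_tmul, add_zero, map_smul, TensorProduct.smul_tmul]⟩
      by_cases h1 : k = n
      · subst h1
        obtain ⟨q, rfl⟩ := Y.eq_smul_i (Y.p_eq_zero (by omega) hy)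
        exact ⟨(0, q • a), by
          rw [hT, map_zero, TensorProduct.zero_tmul, zero_add, map_smul, TensorProduct.smul_tmul]⟩
      · rw [Y.gr_eq_zero (by omega) (by omega) hy, TensorProduct.tmul_zero]
        exact zero_mem _
  obtain ⟨⟨a, b⟩, hab⟩ := h (Y.E.coact_gr 0 e he)
  rw [hT] at hab
  have h1 := Y.p.map_coact e
  rw [← hab, hp, map_add, LinearMap.lTensor_tmul, LinearMap.lTensor_tmul, Y.p_i_one, hp] at h1
  -- The `ℋ_0`-coefficient is seen in the quotient `ℚ_(0)`, whose coaction is trivial; hence it is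
  -- `1`.
  have h2 : one ⊗ₜ[ℚ] (1 : ℚ) = incl 0 a ⊗ₜ[ℚ] (1 : ℚ) :=
    h1.trans ((congrArg (_ + ·) (TensorProduct.tmul_zero _ _)).trans (add_zero _))
  exact ⟨b, by rw [tmul_left_injective one_ne_zero h2, hab]⟩

lemma coact_i_one : Y.E.coact (Y.i.toLin (1 : ℚ)) = one ⊗ₜ Y.i.toLin (1 : ℚ) :=
  (Y.i.map_coact (1 : ℚ)).trans (LinearMap.lTensor_tmul _ _ _ _)

/-- Coassociativity at `e`, after cancelling `1 ⊗ 1 ⊗ e`, reads `ν(γ) ⊗ i(1) = (1 ⊗ γ + γ ⊗ 1) ⊗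
i(1)`, and tensoring with the non-zero vector `i(1)` is injective. -/
lemma mem_kerRedComul {e : Y.E.V} {γ : HTn n}
    (h : Y.E.coact e = one ⊗ₜ e + incl n γ ⊗ₜ Y.i.toLin (1 : ℚ)) : γ ∈ kerRedComul n := by
  rw [HTAlg.mem_kerRedComul]
  have h1 := Y.E.coassoc e
  rw [h] at h1
  simp only [map_add, LinearMap.rTensor_tmul, LinearMap.lTensor_tmul, comul_one, h, coact_i_one,
    TensorProduct.assoc_tmul, TensorProduct.tmul_add] at h1
  refine tmul_left_injective Y.i_one_ne
    ((TensorProduct.assoc ℚ HTAlg HTAlg Y.E.V).injective ?_)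
  simp only [TensorProduct.add_tmul, map_add, TensorProduct.assoc_tmul]
  rwa [add_assoc, add_right_inj] at h1

/-- An extension of comodules is isomorphic to the one attached to its cocycle. -/
lemma cobarClass_eq (hn : 0 < n) {e : Y.E.V} (he : e ∈ Y.E.gr 0) (hp : Y.p.toLin e = (1 : ℚ))
    (γ : kerRedComul n)
    (h : Y.E.coact e = one ⊗ₜ e + incl n γ.1 ⊗ₜ Y.i.toLin (1 : ℚ)) :
    cobarClass n hn γ = Quotient.mk _ Y := by
  let L : ℚ × ℚ →ₗ[ℚ] Y.E.V := (LinearMap.toSpanSingleton ℚ Y.E.V e).coprod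
    (LinearMap.toSpanSingleton ℚ Y.E.V (Y.i.toLin (1 : ℚ)))
  have hL : ∀ a b : ℚ, L (a, b) = a • e + b • Y.i.toLin (1 : ℚ) := fun _ _ => rfl
  have hpL : ∀ x : ℚ × ℚ, Y.p.toLin (L x) = x.1 := by
    rintro ⟨a, b⟩
    rw [hL, map_add, Y.p_smul hp, map_smul, Y.p_i_one]
    exact (congrArg (a + ·) (mul_zero b)).trans (add_zero a)
  have bij : Function.Bijective L := by
    constructor
    · rw [← LinearMap.ker_eq_bot, LinearMap.ker_eq_bot']
      rintro ⟨a, b⟩ hab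
      have ha : a = 0 := (hpL (a, b)).symm.trans ((congrArg Y.p.toLin hab).trans (map_zero _))
      subst ha
      rw [hL, zero_smul, zero_add] at hab
      rw [(smul_eq_zero.1 hab).resolve_right Y.i_one_ne]
      rfl
    · intro y
      obtain ⟨a, ha⟩ : ∃ a : ℚ, Y.p.toLin (a • e) = Y.p.toLin y := ⟨Y.p.toLin y, Y.p_smul hp _⟩
      obtain ⟨q, hq⟩ := Y.eq_smul_i (y := y - a • e) (by rw [map_sub, ha]; exact sub_self _)
      exact ⟨(a, q), by rw [hL, hq, add_sub_cancel]⟩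
  let g : Hom (cobar n hn γ.1 γ.2) Y.E :=
    { toLin := L
      map_gr := by
        rintro m ⟨a, b⟩ hab
        have h1 : a ∈ line 0 m := (Submodule.mem_prod.1 hab).1
        have h2 : b ∈ line n m := (Submodule.mem_prod.1 hab).2
        change L (a, b) ∈ _
        rw [hL]
        refine add_mem ?_ ?_
        · by_cases hm : m = 0
          · subst hm; exact Submodule.smul_mem _ _ he
          · rw [line_ne hm, Submodule.mem_bot] at h1
            rw [h1, zero_smul]; exact zero_mem _
        · by_cases hm : m = n
          · subst hm; exact Submodule.smul_mem _ _ Y.i_one_mem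
          · rw [line_ne hm, Submodule.mem_bot] at h2
            rw [h2, zero_smul]; exact zero_mem _
      map_coact := by
        rintro ⟨a, b⟩
        change Y.E.coact (L (a, b)) = L.lTensor HTAlg
          (one ⊗ₜ[ℚ] ((a, b) : ℚ × ℚ) + incl n γ.1 ⊗ₜ[ℚ] ((0, a) : ℚ × ℚ))
        rw [map_add, LinearMap.lTensor_tmul, LinearMap.lTensor_tmul, hL, hL, map_add, map_smul,
          map_smul, h, coact_i_one]
        simp only [smul_add, TensorProduct.tmul_add, TensorProduct.tmul_smul, zero_smul, zero_add]
        abel }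
  let L' := (LinearEquiv.ofBijective L bij).symm
  have hL' : ∀ x, L' (L x) = x := (LinearEquiv.ofBijective L bij).symm_apply_apply
  have hLL : ∀ y, L (L' y) = y := (LinearEquiv.ofBijective L bij).apply_symm_apply
  let g' : Hom Y.E (cobar n hn γ.1 γ.2) :=
    { toLin := L'.toLinearMap
      map_gr := by
        intro m y hy
        change L' y ∈ (line 0 m).prod (line n m)
        by_cases h0 : m = 0
        · subst h0
          obtain ⟨q, rfl⟩ := Y.exists_smul_of_mem hn he hp hy
          have : L' (q • e) = (q, 0) := by rw [← hL' (q, 0), hL, zero_smul, add_zero]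
          rw [this, line_self]
          exact ⟨trivial, zero_mem _⟩
        by_cases h1 : m = n
        · subst h1
          obtain ⟨q, rfl⟩ := Y.eq_smul_i (Y.p_eq_zero h0 hy)
          have : L' (q • Y.i.toLin (1 : ℚ)) = (0, q) := by
            rw [← hL' (0, q), hL, zero_smul, zero_add]
          rw [this, line_self]
          exact ⟨zero_mem _, trivial⟩
        · rw [Y.gr_eq_zero h0 h1 hy, map_zero]
          exact zero_mem _
      map_coact := by
        intro y
        have h1 := g.map_coact (L' y)
        change Y.E.coact (L (L' y)) = L.lTensor HTAlg _ at h1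
        rw [hLL] at h1
        rw [h1]
        have h2 : L'.toLinearMap ∘ₗ L = LinearMap.id := LinearMap.ext hL'
        have h3 : ∀ z, L'.toLinearMap.lTensor HTAlg (L.lTensor HTAlg z) = z := fun z => by
          rw [← LinearMap.lTensor_comp_apply, h2, LinearMap.lTensor_id, LinearMap.id_apply]
        exact (h3 _).symm }
  refine Quotient.sound ⟨g, g', LinearMap.ext hL', LinearMap.ext hLL, ?_, LinearMap.ext hpL⟩
  have h4 : ∀ q : ℚ, L (0, q) = Y.i.toLin q := fun q => by
    rw [hL, zero_smul, zero_add, ← Y.i_eq_smul q]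
  exact LinearMap.ext h4

end Extension

lemma cobarClass_surjective (n : ℕ) (hn : 0 < n) : Function.Surjective (cobarClass n hn) := by
  intro η
  induction η using Quotient.inductionOn with | h Y
  obtain ⟨e, he, hp⟩ := Y.exists_lift
  obtain ⟨γ, hγ⟩ := Y.exists_coact hn he hp
  exact ⟨⟨γ, Y.mem_kerRedComul hγ⟩, Y.cobarClass_eq hn he hp _ hγ⟩

/-- An isomorphism of extensions fixes `eₙ` and can change `e₀` only by a multiple of `eₙ`, which
has the wrong degree. So it is the identity on `ℚ e₀ ⊕ ℚ eₙ`, and the two coactions agree. -/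
lemma cobarClass_injective (n : ℕ) (hn : 0 < n) : Function.Injective (cobarClass n hn) := by
  intro γ γ' h
  obtain ⟨g, -, -, -, e1, e2⟩ := Quotient.exact h
  let G : ℚ × ℚ →ₗ[ℚ] ℚ × ℚ := g.toLin
  have h0 : G (0, 1) = (0, 1) := LinearMap.congr_fun e1 (1 : ℚ)
  have h1 : (G (1, 0)).1 = 1 := LinearMap.congr_fun e2 ((1, 0) : ℚ × ℚ)
  have h2 : G (1, 0) ∈ (line 0 0).prod (line n 0) :=
    g.map_gr 0 ((1, 0) : ℚ × ℚ) ⟨(line_self 0).ge trivial, zero_mem _⟩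
  have h3 : (G (1, 0)).2 = 0 := (line_ne (n := n) (m := 0) (by omega)).le h2.2
  have h4 : G (1, 0) = (1, 0) := Prod.ext h1 h3
  have h5 : one ⊗ₜ[ℚ] G (1, 0) + incl n γ'.1 ⊗ₜ[ℚ] ((0, (G (1, 0)).1) : ℚ × ℚ) =
      G.lTensor HTAlg (one ⊗ₜ[ℚ] ((1, 0) : ℚ × ℚ) + incl n γ.1 ⊗ₜ[ℚ] ((0, 1) : ℚ × ℚ)) :=
    g.map_coact ((1, 0) : ℚ × ℚ)
  rw [map_add, LinearMap.lTensor_tmul, LinearMap.lTensor_tmul, h0, h4, add_right_inj] at h5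
  exact Subtype.ext (incl_injective n (tmul_left_injective (by simp) h5)).symm

end GrComod

/-! ### The coaction on `ω(E)` and the identity `ω_* = c_n ∘ ι_n`. -/

namespace HTStructure

open HTAlg

/-- When the matrix coefficients depend on the covector only through its value at `w`, the sum over
the basis reassembles `w`. This removes the chosen basis from the coaction. -/
lemma coactTerm_eq {H : HTStructure} {m r : ℤ} {v : H.gr (-2 * m)} {w : H.gr (-2 * r)} {c : HTAlg}
    (h : ∀ f, H.coef m r v f = f w • c) : H.coactTerm m r v = c ⊗ₜ H.omegaIncl r w := by
  rw [coactTerm_apply]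
  simp only [h, TensorProduct.smul_tmul]
  rw [← TensorProduct.tmul_sum]
  simp only [← map_smul, ← map_sum]
  congr 2
  exact (H.grBasis r).sum_repr w

/-- The identity `H = H(0)`. -/
def twistZeroHom (H : HTStructure) : Hom H (H.twist (-0)) where
  toLin := (LinearMap.id : H.V →ₗ[ℚ] H.V)
  map_W k x hx := by
    change x ∈ H.W (k + 2 * -0)
    rwa [show k + 2 * -0 = k by ring]
  map_F p z hz := by
    change LinearMap.baseChange ℂ (LinearMap.id : H.V →ₗ[ℚ] H.V) z ∈ H.F (p + -0)
    rwa [LinearMap.baseChange_id, show p + -0 = p by ring]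

lemma shiftCls_zero (H : HTStructure) (n : ℕ) (h : (0 : ℤ) + n = n) (v : H.gr 0)
    (f : H.gr (-2 * (n : ℤ)) →ₗ[ℚ] ℚ) :
    H.shiftCls 0 n n h (v : H.gr (-2 * 0)) f = HTn.cls H v f := by
  rw [shiftCls_apply]
  refine (HTn.cls_hom H.twistZeroHom ?_ ?_).symm
  · induction v using Submodule.Quotient.induction_on with | H x => rfl
  · intro y
    induction y using Submodule.Quotient.induction_on with | H y => rfl

namespace Extension

variable {n : ℕ}

lemma gr_eq_zero (X : Extension (tate 0) (tate n)) {r : ℤ} (h0 : r ≠ 0) (h1 : r ≠ n)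
    (x : X.E.gr (-2 * r)) : x = 0 := by
  obtain ⟨a, rfl⟩ := (X.gr_exact _ x).1 (tate_gr_eq_zero (by omega) _)
  rw [tate_gr_eq_zero (by omega) a, map_zero]

variable (hn : (0 : ℤ) < n) (X : Extension (tate 0) (tate n))

/-- As `gr^W_0 E` is a line, `f` is a multiple of a covector pulled back from `ℚ(0)`; naturality of
coefficients then reduces to the coefficient `1` of `ℚ(0)`. -/
lemma coef_vec (f : X.E.gr (-2 * 0) →ₗ[ℚ] ℚ) :
    X.E.coef 0 0 (X.vec hn : X.E.gr (-2 * 0)) f = f (X.vec hn) • one := by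
  let u : X.E.gr (-2 * 0) := X.vec hn
  have hu : X.p.gr (-2 * 0) u = tateGen 0 _ rfl := X.p_vec hn
  change X.E.coef 0 0 u f = f u • one
  have hf : f = f u • (tateVal 0 _ rfl ∘ₗ X.p.gr (-2 * 0)) := by
    refine LinearMap.ext fun x => ?_
    have hx : x = tateVal 0 _ rfl (X.p.gr (-2 * 0) x) • u := by
      refine (X.gr_zero_bijective hn).1 ?_
      change X.p.gr (-2 * 0) x = X.p.gr (-2 * 0) _
      rw [map_smul, hu, smul_tateGen]
    exact (congrArg f hx).trans ((map_smul f _ _).trans (mul_comm _ _))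
  conv_lhs => rw [hf]
  rw [map_smul, coef_hom, hu, coef_tate]

lemma coef_vec_cov (f : X.E.gr (-2 * (n : ℤ)) →ₗ[ℚ] ℚ) :
    X.E.coef 0 n (X.vec hn : X.E.gr (-2 * 0)) f =
      f (X.i.gr _ (tateGen n _ rfl)) • incl n (HTn.cls X.E (X.vec hn) (X.cov hn)) := by
  have hf : f = f (X.i.gr _ (tateGen n _ rfl)) • X.cov hn := by
    refine LinearMap.ext fun x => ?_
    obtain ⟨y, rfl⟩ := (X.gr_bijective hn).2 x
    rw [← smul_tateGen n _ rfl y, LinearMap.smul_apply, X.cov_i hn, map_smul, map_smul, map_smul,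
      tateVal_gen, smul_eq_mul, smul_eq_mul, smul_eq_mul, mul_one, mul_comm]
  conv_lhs => rw [hf]
  rw [map_smul, coef_eq X.E 0 n n (zero_add _), shiftCls_zero]

/-- Only degrees `0` and `n` contribute; the first gives the unit and the second the framed class of
the extension. This is the link between `ι_n` and the comodule side. -/
lemma omegaCoact_vec :
    X.E.omegaCoact (X.E.omegaIncl 0 (X.vec hn)) = one ⊗ₜ X.E.omegaIncl 0 (X.vec hn) +
      incl n (HTn.cls X.E (X.vec hn) (X.cov hn)) ⊗ₜ
        X.E.omegaIncl n (X.i.gr _ (tateGen n _ rfl)) := by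
  have h0n : (0 : ℤ) ≠ n := hn.ne
  rw [omegaCoact_incl' _ 0 _ (X.E.weights ∪ {0, (n : ℤ)}) Finset.subset_union_left,
    ← Finset.sum_subset (Finset.subset_union_right (s₁ := X.E.weights)), Finset.sum_pair h0n,
    coactTerm_eq (X.coef_vec hn), coactTerm_eq (X.coef_vec_cov hn)]
  intro r _ hr
  simp only [Finset.mem_insert, Finset.mem_singleton, not_or] at hr
  rw [coactTerm_apply]
  refine Finset.sum_eq_zero fun i _ => ?_
  rw [X.gr_eq_zero hr.1 hr.2 (X.E.grBasis r i), map_zero, TensorProduct.tmul_zero]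

end Extension

/-- The cocycle read off from `ω(E)` is the class of `E`. Membership in `Ker ν̄` comes from
coassociativity of `ω(E)`, without computing `ν` on the class. -/
lemma iota_mem_and_cobarClass (n : ℕ) (hn : 0 < n) (ξ : Ext1 (tate 0) (tate n)) :
    ∃ h : iota n hn ξ ∈ kerRedComul n, GrComod.cobarClass n hn ⟨_, h⟩ = omegaExt n ξ := by
  induction ξ using Quotient.inductionOn with | h X
  have hn' : (0 : ℤ) < n := by omega
  have hi : X.omega.i.toLin (1 : ℚ) = X.E.omegaIncl n (X.i.gr _ (tateGen n _ rfl)) := by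
    change X.i.omegaLin ((1 : ℚ) • (tate n).omegaIncl n (tateGen n _ rfl)) = _
    rw [one_smul, Hom.omegaLin_incl]
  let e : X.omega.E.V := X.E.omegaIncl 0 (X.vec hn')
  have hp : X.omega.p.toLin e = (1 : ℚ) := by
    change tateVal 0 _ rfl ((tate 0).omegaProj 0 (X.p.omegaLin (X.E.omegaIncl 0 (X.vec hn')))) = 1
    rw [Hom.omegaLin_incl, omegaProj_incl]
    exact (congrArg (tateVal 0 _ rfl) (X.p_vec hn')).trans (tateVal_gen 0 _ rfl)
  have hc : X.omega.E.coact e =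
      one ⊗ₜ e + incl n (iota n hn (Quotient.mk _ X)) ⊗ₜ X.omega.i.toLin (1 : ℚ) := by
    rw [hi, iota_mk]
    exact X.omegaCoact_vec hn'
  have hm := X.omega.mem_kerRedComul hc
  exact ⟨hm, X.omega.cobarClass_eq hn ⟨_, rfl⟩ hp ⟨_, hm⟩ hc⟩

end HTStructure

/-! ### What vanishing of `ν̄` says about each bidegree. -/

lemma exists_comp_eq_of_ker_le {V V' : Type*} [AddCommGroup V] [Module ℚ V] [AddCommGroup V']
    [Module ℚ V'] (A : V →ₗ[ℚ] V') (f : V →ₗ[ℚ] ℚ) (h : ∀ x, A x = 0 → f x = 0) :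
    ∃ g : V' →ₗ[ℚ] ℚ, ∀ x, g (A x) = f x := by
  have : f ∈ LinearMap.range A.dualMap := by
    rw [LinearMap.range_dualMap_eq_dualAnnihilator_ker, Submodule.mem_dualAnnihilator]
    exact fun x hx => h x hx
  obtain ⟨g, rfl⟩ := this
  exact ⟨g, fun _ => rfl⟩

/-- If `∑ i, A (b i)^∨ ⊗ B (b i) = 0`, then `B` vanishes on the annihilator of the kernel of
`A`. -/
lemma eq_zero_of_sum_coord_tmul {M P Q ι : Type*} [AddCommGroup M] [Module ℚ M] [AddCommGroup P]
    [Module ℚ P] [AddCommGroup Q] [Module ℚ Q] [Fintype ι] (b : Module.Basis ι ℚ M)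
    (A : (M →ₗ[ℚ] ℚ) →ₗ[ℚ] P) (B : M →ₗ[ℚ] Q)
    (h : ∑ i, A (b.coord i) ⊗ₜ[ℚ] B (b i) = 0) {u : M} (hu : ∀ φ, A φ = 0 → φ u = 0) :
    B u = 0 := by
  -- By hypothesis, evaluation at `u` factors through `A` as `ψ ∘ A`. Applying `ψ ⊗ id` to the
  -- relation turns it into `∑ b_i^∨(u) B(b_i) = B(u)`.
  obtain ⟨ψ, hψ⟩ := exists_comp_eq_of_ker_le A (LinearMap.applyₗ u) hu
  have := congrArg (fun z => TensorProduct.lid ℚ Q (ψ.rTensor Q z)) h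
  simp only [map_sum, map_zero, LinearMap.rTensor_tmul, TensorProduct.lid_tmul, hψ,
    LinearMap.applyₗ_apply_apply, ← map_smul] at this
  rw [← map_sum] at this
  rw [← this]
  congr 1
  exact (b.sum_repr u).symm

namespace HTAlg

/-- The component of `ν` of degrees `(k, l)`, `k, l > 0`, vanishes on `Ker ν̄`. -/
lemma comulComp_eq_zero {k l n : ℕ} (hk : 0 < k) (hl : 0 < l) (h : k + l = n) {x : HTn n}
    (hx : x ∈ kerRedComul n) : HTn.comulComp k l n h x = 0 := by
  obtain rfl : l = n - k := by omega
  rw [mem_kerRedComul, comul_incl] at hx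
  have self : ∀ (i : ℕ) (y : HTn i), DirectSum.component ℚ ℕ HTn i (incl i y) = y := fun i y =>
    DirectSum.component.lof_self (R := ℚ) (M := HTn) i y
  have ne : ∀ (i j : ℕ) (y : HTn i), i ≠ j → DirectSum.component ℚ ℕ HTn j (incl i y) = 0 :=
    fun i j y hij => (DirectSum.component.of (R := ℚ) (M := HTn) j i y).trans (dif_neg hij)
  -- Project to bidegree `(k, n - k)`: the terms `1 ⊗ x` and `x ⊗ 1` sit in bidegrees `(0, n)` and
  -- `(n, 0)`, so they disappear.
  have key := congrArg (TensorProduct.map (DirectSum.component ℚ ℕ HTn k)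
    (DirectSum.component ℚ ℕ HTn (n - k))) hx
  rw [map_add, TensorProduct.map_tmul, TensorProduct.map_tmul, one, ne 0 k _ (by omega),
    ne 0 (n - k) _ (by omega), TensorProduct.zero_tmul, TensorProduct.tmul_zero, add_zero, map_sum,
    Finset.sum_eq_single ⟨k, by omega⟩] at key
  · rw [← key]
    generalize HTn.comulComp k (n - k) n h x = z
    induction z using TensorProduct.induction_on with
    | zero => simp only [map_zero]
    | tmul a b => rw [TensorProduct.map_tmul, TensorProduct.map_tmul, self, self]
    | add a b ha hb => rw [map_add, map_add, ← ha, ← hb]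
  · intro j _ hj
    have hj : (j : ℕ) ≠ k := fun e => hj (Fin.ext e)
    generalize HTn.comulComp j (n - j) n _ x = z
    induction z using TensorProduct.induction_on with
    | zero => simp only [map_zero]
    | tmul a b =>
      rw [TensorProduct.map_tmul, TensorProduct.map_tmul, ne _ _ _ hj, TensorProduct.zero_tmul]
    | add a b ha hb => rw [map_add, map_add, ha, hb, add_zero]
  · intro h'
    exact absurd (Finset.mem_univ _) h'

end HTAlg

/-! ### Extremal subobjects attached to a framing. -/

namespace HTStructure

variable {H : HTStructure}

/-- Two subobjects containing the same vector of `gr^W_a` have an intersection containing it. -/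
lemma IsSub.inf_lift {S T : Submodule ℚ H.V} (hS : H.IsSub S) (hT : H.IsSub T) {a : ℤ}
    {x x' : H.W a} (hx : x.1 ∈ S) (hx' : x'.1 ∈ T)
    (h : (Submodule.Quotient.mk x : H.gr a) = Submodule.Quotient.mk x') :
    ∃ y : H.W a, y.1 ∈ S ⊓ T ∧ (Submodule.Quotient.mk y : H.gr a) = Submodule.Quotient.mk x := by
  rw [Submodule.Quotient.eq] at h
  obtain ⟨s, hs, t, ht, hst⟩ := hS.sup_inf_W hT (a - 1)
    (sub_mem (Submodule.mem_sup_left hx) (Submodule.mem_sup_right hx')) h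
  refine ⟨⟨x.1 - s, sub_mem x.2 (H.W_mono (by omega) hs.2)⟩, ⟨sub_mem hx hs.1, ?_⟩, ?_⟩
  · have : x.1 - s = x'.1 + t := by
      rw [sub_eq_iff_eq_add, add_assoc, add_comm t, hst]; abel
    change x.1 - s ∈ T
    rw [this]
    exact add_mem hx' ht.1
  · rw [Submodule.Quotient.eq]
    change x.1 - s - x.1 ∈ H.W (a - 1)
    rw [sub_sub_cancel_left]
    exact neg_mem hs.2

/-- There is a smallest subobject containing a given vector of `gr^W_a`. -/
lemma exists_least_sub {a : ℤ} (v : H.gr a) : ∃ S, H.IsSub S ∧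
    (∃ x : H.W a, x.1 ∈ S ∧ Submodule.Quotient.mk x = v) ∧
    ∀ T, H.IsSub T → (∃ x : H.W a, x.1 ∈ T ∧ Submodule.Quotient.mk x = v) → S ≤ T := by
  obtain ⟨S, ⟨hS, x, hxS, hx⟩, hmin⟩ := exists_minimal_of_wellFoundedLT
    (fun S => H.IsSub S ∧ ∃ x : H.W a, x.1 ∈ S ∧ Submodule.Quotient.mk x = v)
    ⟨⊤, H.isSub_top, by
      induction v using Submodule.Quotient.induction_on with
      | H x => exact ⟨x, trivial, rfl⟩⟩
  refine ⟨S, hS, ⟨x, hxS, hx⟩, ?_⟩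
  rintro T hT ⟨x', hxT, hx'⟩
  -- Candidates are closed under intersection, so a minimal one is least.
  obtain ⟨y, hy, e⟩ := hS.inf_lift hT hxS hxT (hx.trans hx'.symm)
  exact (hmin ⟨hS.inf hT, y, hy, e.trans hx⟩ inf_le_left).trans inf_le_right

/-- If all vectors of `S` in weights between `-2n` and `0` are separated from `f`, then up to a
subobject killed by `f`, the only negative weights of `S` are at most `-2n`. -/
lemma exists_killed_sub {n : ℕ} (hn : 0 < n) {S : Submodule ℚ H.V} (hS : H.IsSub S)
    (f : H.gr (-2 * (n : ℤ)) →ₗ[ℚ] ℚ)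
    (h : ∀ (k : ℕ), 0 < k → k < n → ∀ s : H.W (-2 * (k : ℤ)), s.1 ∈ S →
      Separated (Submodule.Quotient.mk s : H.gr (-2 * (k : ℤ))) f) :
    ∃ T, H.IsSub T ∧ T ≤ S ⊓ H.W (-2) ∧
      (∀ y : H.W (-2 * (n : ℤ)), y.1 ∈ T → f (Submodule.Quotient.mk y) = 0) ∧
      S ⊓ H.W (-2) ≤ T ⊔ H.W (-2 * n) := by
  obtain ⟨T, ⟨hT, hTS, hTf⟩, hmax⟩ := exists_maximal_of_wellFoundedGT
    (fun T => H.IsSub T ∧ T ≤ S ⊓ H.W (-2) ∧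
      ∀ y : H.W (-2 * (n : ℤ)), y.1 ∈ T → f (Submodule.Quotient.mk y) = 0)
    ⟨⊥, H.isSub_bot, bot_le, fun y hy => by
      have : y = 0 := Subtype.ext hy
      rw [this]
      exact map_zero f⟩
  -- A sum of two subobjects killed by `f` is again killed, by strictness in weight `-2n`; hence the
  -- maximal `T` is the greatest.
  have hmax : ∀ T', H.IsSub T' → T' ≤ S ⊓ H.W (-2) →
      (∀ y : H.W (-2 * (n : ℤ)), y.1 ∈ T' → f (Submodule.Quotient.mk y) = 0) → T' ≤ T := by
    intro T' h1 h2 h3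
    refine le_sup_right.trans (hmax ⟨hT.sup h1, sup_le hTS h2, ?_⟩ (le_sup_left (b := T')))
    intro y hy
    obtain ⟨s, hs, t, ht, hst⟩ := hT.sup_inf_W h1 _ hy y.2
    have e1 := hTf ⟨s, hs.2⟩ hs.1
    have e2 := h3 ⟨t, ht.2⟩ ht.1
    have : y = ⟨s, hs.2⟩ + ⟨t, ht.2⟩ := Subtype.ext hst.symm
    rw [this, Submodule.Quotient.mk_add, map_add, e1, e2, add_zero]
  refine ⟨T, hT, hTS, hTf, ?_⟩
  -- Descend through the weights. The class of `s` in `gr^W_{-2k}` is also represented by some `y`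
  -- in `S ⊓ U`, with `U` killed by `f`; `y` is absorbed by `T`, and `s - y` has weight at most
  -- `-2(k+1)`.
  have step : ∀ d k : ℕ, 0 < k → k + d = n → S ⊓ H.W (-2 * k) ≤ T ⊔ H.W (-2 * n) := by
    intro d
    induction d with
    | zero =>
      rintro k - rfl
      exact inf_le_right.trans le_sup_right
    | succ d ih =>
      intro k hk hkd s hs
      obtain ⟨U, hU, ⟨x, hxU, hx⟩, hf⟩ := h k hk (by omega) ⟨s, hs.2⟩ hs.1
      obtain ⟨y, hy, e⟩ := hS.inf_lift hU (x := ⟨s, hs.2⟩) hs.1 hxU hx.symm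
      have hyT : y.1 ∈ T := by
        refine hmax ((S ⊓ U) ⊓ H.W (-2)) ((hS.inf hU).inf (H.isSub_W _))
          (inf_le_inf_right _ inf_le_left) (fun z hz => hf z hz.1.2)
          ⟨hy, H.W_mono (by omega) y.2⟩
      have hsy : s - y.1 ∈ H.W (-2 * ((k + 1 : ℕ) : ℤ)) := by
        rw [eq_comm, Submodule.Quotient.eq] at e
        have e : s - y.1 ∈ H.W (-2 * (k : ℤ) - 1) := e
        rw [W_even] at e
        rwa [show 2 * ((-2 * (k : ℤ) - 1) / 2) = -2 * ((k + 1 : ℕ) : ℤ) by omega] at e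
      have := ih (k + 1) (by omega) (by omega) ⟨sub_mem hs.1 hy.1, hsy⟩
      have := add_mem this (Submodule.mem_sup_left hyT)
      rwa [sub_add_cancel] at this
  exact step (n - 1) 1 one_pos (by omega)

end HTStructure

/-! ### Reduction to a two-dimensional structure and surjectivity onto `Ker ν̄`. -/

namespace HTStructure

lemma baseChange_eq_zero_of_mem {V V' : Type} [AddCommGroup V] [Module ℚ V] [AddCommGroup V']
    [Module ℚ V'] (g : V →ₗ[ℚ] V') {S : Submodule ℚ V} (h : ∀ x ∈ S, g x = 0) {z : ℂ ⊗[ℚ] V}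
    (hz : z ∈ S.baseChange ℂ) : g.baseChange ℂ z = 0 := by
  have := baseChange_mem g S ⊥ h z hz
  rwa [Submodule.baseChange_bot, Submodule.mem_bot] at this

variable {H : HTStructure}

/-- The subobject spanned by a subobject of `W_{-2} H` and a lift of a vector of `gr^W_0`. -/
lemma IsSub.span_sup {S : Submodule ℚ H.V} (hS : H.IsSub S) {c : H.V} (hc : c ∈ S)
    (hc0 : c ∈ H.W 0) : H.IsSub (Submodule.span ℚ {c} ⊔ S ⊓ H.W (-2)) := by
  have hcS : Submodule.span ℚ {c} ≤ S := (Submodule.span_singleton_le_iff_mem _ _).2 hc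
  have hc0 : Submodule.span ℚ {c} ≤ H.W 0 := (Submodule.span_singleton_le_iff_mem _ _).2 hc0
  intro j w u hw hu h
  -- For `j ≥ 0` the subspace lies in `W_{2j}` and is fixed by the projection. For `j < 0` the
  -- projection lands in `S ∩ W_{-2}`, although the line of `c` alone need not be stable.
  rcases le_or_gt 0 j with hj | hj
  · have h0 : Submodule.span ℚ {c} ⊔ S ⊓ H.W (-2) ≤ H.W (2 * j) :=
      sup_le (hc0.trans (H.W_mono (by omega))) (inf_le_right.trans (H.W_mono (by omega)))
    have := H.W_add_F_unique j hw (Submodule.baseChange_mono ℂ h0 h) hu (zero_mem _)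
      (by rw [add_zero])
    rwa [this]
  · have h0 : Submodule.span ℚ {c} ⊔ S ⊓ H.W (-2) ≤ S := sup_le hcS inf_le_left
    refine Submodule.baseChange_mono ℂ le_sup_right (mem_baseChange_inf.2
      ⟨hS j w u hw hu (Submodule.baseChange_mono ℂ h0 h), ?_⟩)
    exact Submodule.baseChange_mono ℂ (H.W_mono (by omega)) hw

/-- This is compatibility with `F` of the map `(χ, φ)` to the two-dimensional structure. The
essential range is `-n < p ≤ 0`: subtracting a multiple of `u`, whose image is `e₀ + z eₙ`, leaves a
vector of `F^p` over `S ∩ W_{-2}`, and that vector is killed because its weights between `-2n` and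
`0` come from `T`. -/
lemma mem_periodF {n : ℕ} {S T : Submodule ℚ H.V} (hT : H.IsSub T)
    (hST : S ⊓ H.W (-2) ≤ T ⊔ H.W (-2 * n)) {c : H.V} (hc0 : c ∈ H.W 0) {χ φ : H.V →ₗ[ℚ] ℚ}
    (hχc : χ c = 1) (hχ : ∀ x ∈ H.W (-2), χ x = 0) (hφc : φ c = 0) (hφT : ∀ x ∈ T, φ x = 0)
    {w u : ℂ ⊗[ℚ] H.V} (hw : w ∈ (S ⊓ H.W (-2)).baseChange ℂ) (hu : u ∈ H.F 0)
    (hwu : w + u = 1 ⊗ₜ c) {z : ℂ} (hz : φ.baseChange ℂ w = (-z) ⊗ₜ (1 : ℚ)) {p : ℤ}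
    {y : ℂ ⊗[ℚ] H.V} (hyF : y ∈ H.F p)
    (hy : y ∈ (Submodule.span ℚ {c} ⊔ S ⊓ H.W (-2)).baseChange ℂ) :
    (χ.prod φ).baseChange ℂ y ∈ periodF n z p := by
  have hg : ∀ y, (χ.prod φ).baseChange ℂ y =
      (LinearMap.inl ℚ ℚ ℚ).baseChange ℂ (χ.baseChange ℂ y) +
        (LinearMap.inr ℚ ℚ ℚ).baseChange ℂ (φ.baseChange ℂ y) := fun y => by
    rw [← sum_decomp ((χ.prod φ).baseChange ℂ y), baseChange_fst_prod, baseChange_snd_prod]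
  rcases le_or_gt p (-(n : ℤ)) with h | h
  · rw [periodF_top h]; trivial
  obtain ⟨a, ha, b, hb, rfl⟩ := baseChange_sup_exists hy
  obtain ⟨q, rfl⟩ := baseChange_span_singleton_exists ha
  rcases le_or_gt p 0 with h' | h'
  · have hsplit : q ⊗ₜ c + b = q • u + (q • w + b) := by
      rw [← add_assoc, ← smul_add, add_comm u, hwu, TensorProduct.smul_tmul', smul_eq_mul, mul_one]
    have hqF : q • w + b ∈ H.F p := by
      rw [hsplit] at hyF
      have := sub_mem hyF (Submodule.smul_mem _ q (H.F_anti h' hu))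
      rwa [add_sub_cancel_left] at this
    have hqS : q • w + b ∈ (S ⊓ H.W (-2)).baseChange ℂ :=
      add_mem (Submodule.smul_mem _ _ hw) hb
    have e1 : χ.baseChange ℂ (q • w + b) = 0 :=
      baseChange_eq_zero_of_mem χ (S := S ⊓ H.W (-2)) (fun x hx => hχ x hx.2) hqS
    -- Write the vector as `t + r` with `t` over `T` and `r` in `W_{-2n}`. It lies in `F^{-n+1}`, so
    -- its projection to `W_{-2n}` vanishes; thus `r` is minus the projection of `t`, which stays
    -- over `T`, where `φ` is zero.
    have e2 : φ.baseChange ℂ (q • w + b) = 0 := by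
      obtain ⟨t, ht, r, hr, htr⟩ := baseChange_sup_exists (Submodule.baseChange_mono ℂ hST hqS)
      rw [show -2 * (n : ℤ) = 2 * -(n : ℤ) by ring] at hr
      obtain ⟨wt, hwt, ut, hut, rfl⟩ := H.exists_W_add_F (-n) t
      have h0 : wt + r = 0 := H.W_add_F_unique (-n) (add_mem hwt hr) (zero_mem _) hut
        (H.F_anti (by omega) hqF) (by rw [zero_add, ← htr]; abel)
      have h1 := baseChange_eq_zero_of_mem φ hφT ht
      have h2 := baseChange_eq_zero_of_mem φ hφT (hT _ wt ut hwt hut ht)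
      rw [← htr, map_add, h1, zero_add, eq_neg_of_add_eq_zero_right h0, map_neg, h2, neg_zero]
    have eu : u = 1 ⊗ₜ c - w := by rw [← hwu, add_sub_cancel_left]
    have e3 : χ.baseChange ℂ u = 1 ⊗ₜ (1 : ℚ) := by
      rw [eu, map_sub, baseChange_eq_zero_of_mem χ (S := S ⊓ H.W (-2)) (fun x hx => hχ x hx.2) hw, sub_zero,
        LinearMap.baseChange_tmul, hχc]
    have e4 : φ.baseChange ℂ u = z ⊗ₜ (1 : ℚ) := by
      rw [eu, map_sub, hz, LinearMap.baseChange_tmul, hφc, TensorProduct.tmul_zero, zero_sub,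
        TensorProduct.neg_tmul, neg_neg]
    rw [periodF_mid h h', hsplit, map_add, map_smul, hg (q • w + b), e1, e2, map_zero, map_zero,
      add_zero, add_zero]
    refine Submodule.smul_mem _ _ (Submodule.mem_span_singleton.2 ⟨1, ?_⟩)
    rw [hg, e3, e4, LinearMap.baseChange_tmul, LinearMap.baseChange_tmul, one_smul]
    rfl
  · have hW : Submodule.span ℚ {c} ⊔ S ⊓ H.W (-2) ≤ H.W (2 * 0) :=
      sup_le ((Submodule.span_singleton_le_iff_mem _ _).2 hc0)
        (inf_le_right.trans (H.W_mono (by omega)))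
    have h0 := (H.F_inf_W 0).le ⟨H.F_anti (by omega) hyF, Submodule.baseChange_mono ℂ hW hy⟩
    rw [(Submodule.mem_bot ℂ).1 h0, map_zero]
    exact zero_mem _

/-- A framed Hodge–Tate structure with a subobject `S` containing the vector, such that up to a
subobject `T` killed by the covector the negative weights of `S` are at most `-2n`, is equivalent
to an extension of `ℚ(0)` by `ℚ(n)`. -/
lemma cls_mem_range_iota {n : ℕ} (hn : 0 < n) {S T : Submodule ℚ H.V} (hS : H.IsSub S)
    (hT : H.IsSub T) (hTS : T ≤ S ⊓ H.W (-2)) (hST : S ⊓ H.W (-2) ≤ T ⊔ H.W (-2 * n))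
    (f : H.gr (-2 * (n : ℤ)) →ₗ[ℚ] ℚ)
    (hf : ∀ y : H.W (-2 * (n : ℤ)), y.1 ∈ T → f (Submodule.Quotient.mk y) = 0)
    {c : H.W 0} (hc : c.1 ∈ S) (hv : (Submodule.Quotient.mk c : H.gr 0) ≠ 0) :
    ∃ ξ, iota n hn ξ = HTn.cls H (Submodule.Quotient.mk c) f := by
  obtain ⟨c, hc0⟩ := c
  have hn' : (0 : ℤ) < n := by omega
  have hW : H.W (0 - 1) = H.W (-2) := H.W_even _
  have hcW : c ∉ H.W (-2) := fun h => hv (by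
    rw [Submodule.Quotient.mk_eq_zero]
    change c ∈ H.W (0 - 1)
    rwa [hW])
  obtain ⟨χ₀, hχ₀, hχker⟩ := Submodule.exists_le_ker_of_notMem hcW
  let χ := (χ₀ c)⁻¹ • χ₀
  have hχc : χ c = 1 := inv_mul_cancel₀ hχ₀
  have hχ : ∀ x ∈ H.W (-2), χ x = 0 := fun x hx => by
    have : χ₀ x = 0 := hχker hx
    change (χ₀ c)⁻¹ • χ₀ x = 0
    rw [this, smul_zero]
  -- Extend `f` from `W_{-2n}` to all of `H`, with value zero on `T` and `c`. This is consistent: if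
  -- `t + a c` has weight at most `-2n`, then `χ` gives `a = 0`, and `f` kills `T`.
  obtain ⟨φ₀, hφ₀⟩ := exists_comp_eq_of_ker_le
    ((T ⊔ Submodule.span ℚ {c}).mkQ ∘ₗ (H.W (-2 * (n : ℤ))).subtype)
    (f ∘ₗ Submodule.mkQ _) (by
      intro x hx
      rw [LinearMap.comp_apply, Submodule.mkQ_apply, Submodule.Quotient.mk_eq_zero] at hx
      refine hf x ?_
      obtain ⟨t, ht, b, hb, htb⟩ := Submodule.mem_sup.1 hx
      obtain ⟨a, rfl⟩ := Submodule.mem_span_singleton.1 hb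
      have h1 : χ (t + a • c) = 0 := by
        rw [htb]
        exact hχ _ (H.W_mono (by omega) x.2)
      rw [map_add, map_smul, hχ t (hTS ht).2, hχc, zero_add, smul_eq_mul, mul_one] at h1
      rw [h1, zero_smul, add_zero] at htb
      change (H.W (-2 * (n : ℤ))).subtype x ∈ T
      rwa [← htb])
  let φ := φ₀ ∘ₗ (T ⊔ Submodule.span ℚ {c}).mkQ
  have hφ : ∀ x (hx : x ∈ H.W (-2 * (n : ℤ))), φ x = f (Submodule.Quotient.mk ⟨x, hx⟩) :=
    fun x hx => hφ₀ ⟨x, hx⟩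
  have hφ0 : ∀ x ∈ T ⊔ Submodule.span ℚ {c}, φ x = 0 := fun x hx => by
    change φ₀ (Submodule.Quotient.mk x) = 0
    rw [(Submodule.Quotient.mk_eq_zero _).2 hx, map_zero]
  have hφT : ∀ x ∈ T, φ x = 0 := fun x hx => hφ0 x (Submodule.mem_sup_left hx)
  have hφc : φ c = 0 := hφ0 c (Submodule.mem_sup_right (Submodule.mem_span_singleton_self c))
  obtain ⟨w, hw, u, hu, hwu⟩ := H.exists_W_add_F (-1) (1 ⊗ₜ c)
  have hwS := hS (-1) w u hw hu (hwu ▸ one_tmul_mem_baseChange.2 hc)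
  have hw' := mem_baseChange_inf.2 ⟨hwS, hw⟩
  obtain ⟨a, ha⟩ := exists_tmul_one (φ.baseChange ℂ w)
  have hM := hS.span_sup hc hc0
  let M := H.sub _ hM
  -- The Hodge part `u = c - w` of `c` has coordinates `χ(u) = 1` and `φ(u) = -a`, which dictates
  -- the period.
  let X := periodExtension n (-a)
  let ψ : Hom M X.E :=
    { toLin := χ.prod φ ∘ₗ Submodule.subtype _
      map_W := by
        rintro k ⟨x, hx⟩ (hk : x ∈ H.W k)
        change (χ x, φ x) ∈ periodW n k
        rcases le_or_gt 0 k with h | h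
        · rw [periodW_top h]; trivial
        have hx2 : x ∈ H.W (-2) := hW ▸ H.W_mono (by omega) hk
        rcases le_or_gt (-2 * (n : ℤ)) k with h' | h'
        · rw [periodW_mid h h']
          exact ⟨hχ x hx2, trivial⟩
        · have hxn : x ∈ H.W (-2 * (n : ℤ)) := H.W_mono h'.le hk
          have : (Submodule.Quotient.mk ⟨x, hxn⟩ : H.gr (-2 * (n : ℤ))) = 0 := by
            rw [Submodule.Quotient.mk_eq_zero]
            exact H.W_mono (by omega) hk
          rw [hχ x hx2, hφ x hxn, this, map_zero]
          exact zero_mem _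
      map_F := by
        intro p y hy
        refine Set.mem_of_eq_of_mem
          (baseChange_comp_eq (χ.prod φ) (Submodule.subtype _) _ rfl y).symm ?_
        exact mem_periodF hT hST hc0 hχc hχ hφc hφT hw' hu hwu (by rw [neg_neg]; exact ha.symm) hy
          ⟨y, rfl⟩ }
  have hcM : c ∈ Submodule.span ℚ {c} ⊔ S ⊓ H.W (-2) :=
    Submodule.mem_sup_left (Submodule.mem_span_singleton_self c)
  let v : M.gr 0 := Submodule.Quotient.mk ⟨⟨c, hcM⟩, hc0⟩
  refine ⟨Quotient.mk _ X, ?_⟩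
  rw [iota_mk]
  -- The equivalence is a zigzag: the subobject `M` includes into `H` and maps by `ψ` to `X`, both
  -- compatibly with the framings.
  refine Eq.trans (HTn.cls_hom ψ (v := v) (f := f ∘ₗ (H.subHom _ hM).gr _) ?_ ?_).symm
    (HTn.cls_hom (H.subHom _ hM) rfl fun _ => rfl)
  · exact X.mk_eq_vec hn' (x := ⟨ψ.toLin ⟨c, hcM⟩, _⟩) hχc
  · intro y
    induction y using Submodule.Quotient.induction_on with
    | H y =>
      obtain ⟨⟨y, hyM⟩, hy⟩ := y
      have hyn : y ∈ H.W (-2 * (n : ℤ)) := hy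
      have hχy : χ y = 0 := hχ y (H.W_mono (by omega) hyn)
      have e : ψ.toLin ⟨y, hyM⟩ = X.i.toLin (φ y) := Prod.ext hχy rfl
      have h1 := X.cov_mk hn' (φ y) (X.i_mem_W _)
      refine Eq.trans ?_ (h1.trans (hφ y hyn))
      exact congrArg _ (congrArg Submodule.Quotient.mk (Subtype.ext e))

/-- Every class in `Ker ν̄` comes from an extension. -/
lemma exists_iota_eq (n : ℕ) (hn : 0 < n) (x : HTn n) (hx : x ∈ HTAlg.kerRedComul n) :
    ∃ ξ, iota n hn ξ = x := by
  obtain ⟨⟨H, v, f, hv, hf⟩, rfl⟩ := Quot.exists_rep x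
  have hX : HTn.cls H v f = HTn.mk ⟨H, v, f, hv, hf⟩ := HTn.cls_eq_mk ⟨H, v, f, hv, hf⟩
  change HTn.mk ⟨H, v, f, hv, hf⟩ ∈ _ at hx
  change ∃ ξ, _ = HTn.mk ⟨H, v, f, hv, hf⟩
  rw [← hX] at hx ⊢
  obtain ⟨S, hS, ⟨c, hcS, rfl⟩, hmin⟩ := exists_least_sub v
  obtain ⟨T, hT, hTS, hTf, hST⟩ := exists_killed_sub hn hS f (by
    intro k hk hkn s hs
    have hkl : (k : ℤ) + (n - k : ℕ) = n := by omega
    have h0 := HTAlg.comulComp_eq_zero hk (l := n - k) (by omega) (by omega) hx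
    rw [HTn.comulComp_cls k (n - k) n (by omega) H (H.grBasis k)] at h0
    refine separated_of_shiftCls_eq_zero hkl ?_
    -- The `(k, n-k)` component of `ν` vanishes on the class, so `[H, s, f](-k) = 0` as soon as
    -- every `φ` with `[H, v, φ] = 0` kills `s`. Such a `φ` kills a subobject containing `v`, and
    -- that subobject contains the least one `S`.
    refine eq_zero_of_sum_coord_tmul (H.grBasis k) (HTn.clsL H (Submodule.Quotient.mk c))
      ((H.shiftCls k n (n - k) hkl).flip f) h0 fun φ hφ => ?_
    obtain ⟨U, hU, hvU, hφU⟩ := separated_of_cls_eq_zero hφ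
    exact hφU s (hmin U hU hvU hs))
  exact cls_mem_range_iota hn hS hT hTS hST f hTf hcS hv

end HTStructure

/-- For `n ≥ 1`: the map `ι_n : Ext^1(ℚ(0), ℚ(n)) → ℋ_n` is injective with image `Ker(ν̄|_{ℋ_n})`.
Moreover the maps `Ker(ν̄|_{ℋ_n}) → Ext^1(ℚ_(0), ℚ_(n))` (cocycles of the reduced cobar complex) and
`Ext^1(ℚ(0), ℚ(n)) → Ext^1(ℚ_(0), ℚ_(n))` (the functor `ω`) are bijective, and `ι_n` is the inverse
of the resulting bijection `Ker(ν̄|_{ℋ_n}) → Ext^1(ℚ(0), ℚ(n))`. -/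
theorem mainTheorem4 (n : ℕ) (hn : 0 < n) :
    Set.range (HTStructure.iota n hn) = (HTAlg.kerRedComul n : Set (HTn n)) ∧
    Function.Injective (HTStructure.iota n hn) ∧
    Function.Bijective (GrComod.cobarClass n hn) ∧
    Function.Bijective (HTStructure.omegaExt n) ∧
    ∀ (γ : HTAlg.kerRedComul n) (ξ : HTStructure.Ext1 (HTStructure.tate 0) (HTStructure.tate n)),
      GrComod.cobarClass n hn γ = HTStructure.omegaExt n ξ ↔ HTStructure.iota n hn ξ = γ := by
  have hinj := HTStructure.iota_injective n hn
  have hc : Function.Bijective (GrComod.cobarClass n hn) :=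
    ⟨GrComod.cobarClass_injective n hn, GrComod.cobarClass_surjective n hn⟩
  have hsurj := HTStructure.exists_iota_eq n hn
  have key := HTStructure.iota_mem_and_cobarClass n hn
  refine ⟨?_, hinj, hc, ⟨fun ξ η h => ?_, fun η => ?_⟩, fun γ ξ => ⟨fun h => ?_, fun h => ?_⟩⟩
  · ext x
    constructor
    · rintro ⟨ξ, rfl⟩
      exact (key ξ).1
    · exact hsurj x
  · obtain ⟨h1, e1⟩ := key ξ
    obtain ⟨h2, e2⟩ := key η
    -- From `ω_* = c_n ∘ ι_n`, injectivity of `ω_*` follows from that of `c_n` and `ι_n`.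
    exact hinj (congrArg Subtype.val (hc.1 (e1.trans (h.trans e2.symm))))
  · obtain ⟨γ, rfl⟩ := hc.2 η
    obtain ⟨ξ, hξ⟩ := hsurj γ.1 γ.2
    obtain ⟨h1, e1⟩ := key ξ
    exact ⟨ξ, e1.symm.trans (congrArg _ (Subtype.ext hξ))⟩
  · obtain ⟨h1, e1⟩ := key ξ
    exact congrArg Subtype.val (hc.1 (e1.trans h.symm))
  · obtain ⟨h1, e1⟩ := key ξ
    rw [← e1]
    exact congrArg _ (Subtype.ext h.symm)

end
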